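/- Let $n\ge 1$, $p\ge 1$, $\Lambda\ge 1$ and $0<\overline m\le\overline M<\infty$. For $x_0\in\mathbb{R}^n$ and $R>0$ write $B_R^+(x_0)=B_R(x_0)\cap\{x_n>0\}$, $B_R^+=B_R^+(0)$ and $\partial' B_R^+=(\partial B_R^+)\cap\{x_n=0\}$. There exist $\alpha>0$ and $C>0$, depending only on $n$, $p$, $\Lambda$, $\overline m$ and $\overline M$, such that the following holds. Let $G:B_1^+\to\mathbb{R}$ be measurable with $$\frac1\Lambda x_n\le G(x)\le \Lambda x_n\quad\text{for } x\in B_1^+,$$ and let $A=(a_{ij})$ be a measurable $n\times n$ matrix valued function on $B_1^+$ with $$\frac1\Lambda|\xi|^2\le\sum_{i,j=1}^n a_{ij}(x)\xi_i\xi_j\le\Lambda|\xi|^2\quad\text{and}\quad |A(x)\xi|\le\Lambda|\xi|\qquad\forall\,\xi\in\mathbb{R}^n,\ x\in B_1^+$$ (the bound $|A\xi|\le\Lambda|\xi|$ follows from the other one if $A$ is symmetric). Let $w$ be Lipschitz continuous in $\overline{B_1^+}\times(-1,0]$, with $\overline m\le w\le\overline M$ in $B_1^+\times(-1,0]$, and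 let $w$ solve $$G^{p+1}\,\partial_t w^p=\operatorname{div}(A\,G^2\nabla w)\quad\text{in } B_1^+\times(-1,0]$$ in the sense of distributions, that is, $$\int_{-1}^0\int_{B_1^+}G^{p+1}w^p\,\partial_t\varphi\,dx\,dt=\int_{-1}^0\int_{B_1^+}G^2\,A\nabla w\cdot\nabla\varphi\,dx\,dt\qquad\forall\,\varphi\in C_c^\infty(B_1^+\times(-1,0)).$$ Then for every $\bar x\in\partial'B_{1/2}^+$ and every $\bar t\in(-1/4,0)$, $$|w(x,t)-w(\bar x,\bar t)|\le C\big(|x-\bar x|+|t-\bar t|^{\frac1{p+1}}\big)^\alpha\qquad\forall\,(x,t)\in B_{1/2}^+(\bar x)\times(-1/4+\bar t,\bar t\,].$$ -/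

import Mathlib

open MeasureTheory

noncomputable section

namespace FastDiffusion

/-- Euclidean space `ℝⁿ` with `n = d + 1 ≥ 1`; the distinguished coordinate `x_n` of a point `x` is
`x (Fin.last d)`. -/
abbrev Space (d : ℕ) : Type := EuclideanSpace ℝ (Fin (d + 1))

/-- The half ball `B_R^+(x₀) = B_R(x₀) ∩ {x_n > 0}`. -/
def halfBall {d : ℕ} (x₀ : Space d) (R : ℝ) : Set (Space d) :=
  Metric.ball x₀ R ∩ {x | 0 < x (Fin.last d)}

/-- The flat part `∂'B_R^+(x₀) = ∂(B_R^+(x₀)) ∩ {x_n = 0}` of the boundary of a half ball. -/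
def flatBoundary {d : ℕ} (x₀ : Space d) (R : ℝ) : Set (Space d) :=
  frontier (halfBall x₀ R) ∩ {x | x (Fin.last d) = 0}

/-- The `i`-th spatial partial derivative of a function of `(x, t)`. -/
def spacePartial {d : ℕ} (f : Space d × ℝ → ℝ) (i : Fin (d + 1)) (z : Space d × ℝ) : ℝ :=
  fderiv ℝ (fun y : Space d => f (y, z.2)) z.1 (EuclideanSpace.single i 1)

/-- The time derivative of a function of `(x, t)`. -/
def timePartial {d : ℕ} (f : Space d × ℝ → ℝ) (z : Space d × ℝ) : ℝ :=
  deriv (fun s : ℝ => f (z.1, s)) z.2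

/-- The bilinear form `∑ i j, a_ij ξ_j η_i`, that is `(A ξ) · η`. -/
def matForm {d : ℕ} (A : Matrix (Fin (d + 1)) (Fin (d + 1)) ℝ) (ξ η : Fin (d + 1) → ℝ) : ℝ :=
  ∑ i, ∑ j, A i j * ξ j * η i

/-- `w` solves `G^{p+1} ∂ₜ(w^p) = div (A G² ∇w)` in `B_1^+ × (-1, 0]` in the sense of
distributions: the equation is tested with smooth functions compactly supported in the open set
`B_1^+ × (-1, 0)`, the time derivative being moved to the test function (`G` does not depend on
time). It is used for functions `w` that are Lipschitz continuous in `B_1^+ × (-1, 0]`, for which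
the spatial gradient exists almost everywhere and is the distributional gradient. -/
def IsDistribSolution {d : ℕ} (p : ℝ) (G : Space d → ℝ)
    (A : Space d → Matrix (Fin (d + 1)) (Fin (d + 1)) ℝ) (w : Space d × ℝ → ℝ) : Prop :=
  ∀ φ : Space d × ℝ → ℝ, ContDiff ℝ (⊤ : ℕ∞) φ → HasCompactSupport φ →
    tsupport φ ⊆ halfBall 0 1 ×ˢ Set.Ioo (-1 : ℝ) 0 →
    ∫ z in halfBall (0 : Space d) 1 ×ˢ Set.Ioo (-1 : ℝ) 0,
        G z.1 ^ (p + 1) * w z ^ p * timePartial φ z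
      = ∫ z in halfBall (0 : Space d) 1 ×ˢ Set.Ioo (-1 : ℝ) 0,
        G z.1 ^ 2 * matForm (A z.1) (fun j => spacePartial w j z) (fun i => spacePartial φ i z)

end FastDiffusion

end

noncomputable section

namespace FastDiffusion

open Set Metric Filter Topology ENNReal

variable {d : ℕ}

/-! Around a point `x₀` of the flat boundary the equation is invariant under `x ↦ x₀ + r x`, `t ↦ t₀
+ r ^ (p + 1) t`: `G / r` is comparable to the new `x_n`, and both sides of the equation scale
alike. So it suffices to find `ε > 0`, depending only on the structural constants, such that a
solution on the unit half cylinder with values in `[0, 1]` satisfies `u ≥ ε` or `u ≤ 1 - ε` on a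
smaller half cylinder (`exists_decay`). Iterating over the radii `4 ^ (-j) / 2` makes the
oscillation decay geometrically (`exists_oscillation`), and the exponent is read off from `(1/4) ^ α
= 1 - ε` (`holder`).

No boundary condition is imposed on `{x_n = 0}`, and none is needed. The diffusion carries the
weight `x_n ^ 2`, and a cutoff with slope of order `n` living in `x_n ≤ 2 / n` costs only `O(1 / n)`
against it. Hence test functions need not vanish on the flat boundary (`Coeff.weak_up_to_boundary`).
As `w` is Lipschitz, the time derivative can be moved back onto `w ^ p`, and since `w` stays between
two positive constants the equation becomes `g c(u) ∂ₜu = div (b ∇u)` with `c` bounded above and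
below, `b` comparable to `x_n ^ 2` and `g` between multiples of `x_n ^ q` and `x_n ^ 2`, where `q =
⌈p + 1⌉` (`Sol`, `sol_rescaled`).

The dichotomy is proved by De Giorgi's method. Its first half says that if `(k - u)_+` has small
mass then `u ≥ k / 2` further inside (`exists_deGiorgi`). The spatial tool is a Faber–Krahn
inequality with weight `x_n ^ 2` and no condition on `{x_n = 0}`: it is the unweighted one for `x_n
v`, the extra term in the gradient being absorbed by Hardy's inequality (`weighted_faberKrahn`). The
weight `g` may be much weaker than `x_n ^ 2`, so the energy at a fixed time only controls `∫ x_n ^ q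
(k - u)_+ ^ 2`. This is enough: the iteration needs that sublevel sets have small volume, and small
`x_n ^ q`-measure implies it (`exists_volume_le_ball`).

The second half produces the smallness of the mass. After exchanging `u` with `1 - u` if necessary,
`u ≥ 1/2` on at least half of the `g`-mass at time `-1/2`. Testing with `η ^ 2 / (u + a)` has two
effects. The set `{u ≥ k}` keeps a definite mass at all later times for some fixed small `k`
(`weight_superlevel_ge`), and the weighted `L²` norm squared of `∇ log (u + a)` is at most `C (1 +
log (1 / a))` (`lintegral_log_gradient_le`). The Poincaré inequality `weighted_poincare`, applied to
`(log k - log (u + a))_+`, which vanishes on `{u ≥ k}`, bounds the mass of `(a - u)_+` by `C a ^ 2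
(1 + log (1 / a)) / log (k / (2 a)) ^ 2` (`levelMass_le`). The square of the logarithm beats its
first power, so De Giorgi's lemma applies at the level `a` once `a` is small. -/

instance isAddHaarMeasure_spaceTime : (volume : Measure (Space d × ℝ)).IsAddHaarMeasure :=
  inferInstanceAs ((volume : Measure (Space d)).prod (volume : Measure ℝ)).IsAddHaarMeasure

/-! ### The degenerate weight -/

/-- The positive part of the distinguished coordinate. -/
def xp (x : Space d) : ℝ := max (x (Fin.last d)) 0

lemma xp_nonneg (x : Space d) : 0 ≤ xp x := le_max_right _ _

@[fun_prop]
lemma continuous_xp : Continuous (xp : Space d → ℝ) := by unfold xp; fun_prop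

@[fun_prop]
lemma measurable_xp : Measurable (xp : Space d → ℝ) := continuous_xp.measurable

lemma abs_coord_le (x : Space d) (i : Fin (d + 1)) : |x i| ≤ ‖x‖ := by
  simpa using PiLp.norm_apply_le x i

lemma xp_le_norm (x : Space d) : xp x ≤ ‖x‖ :=
  max_le ((le_abs_self _).trans (abs_coord_le x _)) (norm_nonneg _)

lemma lipschitzWith_xp : LipschitzWith 1 (xp : Space d → ℝ) := by
  refine LipschitzWith.of_dist_le_mul fun x y => ?_
  rw [NNReal.coe_one, one_mul, Real.dist_eq, dist_eq_norm]
  refine (abs_max_sub_max_le_abs _ _ _).trans ?_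
  simpa using abs_coord_le (x - y) (Fin.last d)

/-! ### Translations and the Faber–Krahn inequality -/

lemma sq_lintegral_le {α : Type*} [MeasurableSpace α] (μ : Measure α) {f : α → ℝ≥0∞}
    (hf : AEMeasurable f μ) : (∫⁻ a, f a ∂μ) ^ 2 ≤ μ univ * ∫⁻ a, f a ^ 2 ∂μ := by
  have h := ENNReal.lintegral_mul_le_Lp_mul_Lq μ Real.HolderConjugate.two_two
    (f := fun _ => 1) (g := f) aemeasurable_const hf
  simp only [Pi.mul_apply, one_mul, ENNReal.one_rpow, lintegral_const] at h
  calc (∫⁻ a, f a ∂μ) ^ 2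
      ≤ (μ univ ^ (1 / (2 : ℝ)) * (∫⁻ a, f a ^ (2 : ℝ) ∂μ) ^ (1 / (2 : ℝ))) ^ 2 := by gcongr
    _ = μ univ * ∫⁻ a, f a ^ 2 ∂μ := by
        rw [mul_pow, ← ENNReal.rpow_natCast, ← ENNReal.rpow_mul, ← ENNReal.rpow_natCast,
          ← ENNReal.rpow_mul]
        norm_num

lemma enorm_sq_eq (a : ℝ) : ‖a‖ₑ ^ 2 = ENNReal.ofReal (a ^ 2) := by
  rw [Real.enorm_eq_ofReal_abs, ← ENNReal.ofReal_pow (abs_nonneg a), sq_abs]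

/-- The fundamental theorem of calculus along a segment, squared. -/
lemma enorm_sub_sq_le_lintegral {f : Space d → ℝ} {K : NNReal} (hf : LipschitzWith K f)
    {x z : Space d} (hd : ∀ᵐ s : ℝ, s ∈ Ioc (0 : ℝ) 1 → DifferentiableAt ℝ f (x + s • z)) :
    ‖f (x + z) - f x‖ₑ ^ 2
      ≤ ‖z‖ₑ ^ 2 * ∫⁻ s in Ioc (0 : ℝ) 1, ‖fderiv ℝ f (x + s • z)‖ₑ ^ 2 := by
  have hL : LipschitzWith (K * ‖z‖₊) (fun s : ℝ => f (x + s • z)) := by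
    refine hf.comp (LipschitzWith.of_dist_le_mul fun s t => ?_)
    simp [dist_eq_norm, ← sub_smul, norm_smul, mul_comm]
  have hac : AbsolutelyContinuousOnInterval (fun s : ℝ => f (x + s • z)) 0 1 :=
    (hL.lipschitzOnWith (s := uIcc 0 1)).absolutelyContinuousOnInterval
  have h1 := hac.integral_deriv_eq_sub
  simp only [one_smul, zero_smul, add_zero] at h1
  rw [intervalIntegral.integral_of_le zero_le_one] at h1
  have hm : Measurable fun s : ℝ => ‖fderiv ℝ f (x + s • z)‖ₑ :=
    (measurable_fderiv ℝ f).enorm.comp (by fun_prop)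
  have h2 : ‖f (x + z) - f x‖ₑ ≤ ∫⁻ s in Ioc (0 : ℝ) 1, ‖fderiv ℝ f (x + s • z)‖ₑ * ‖z‖ₑ := by
    rw [← h1]
    refine (enorm_integral_le_lintegral_enorm _).trans ?_
    refine lintegral_mono_ae ?_
    rw [ae_restrict_iff' measurableSet_Ioc]
    filter_upwards [hd] with s hs hsm
    have hder : HasDerivAt (fun s : ℝ => f (x + s • z)) (fderiv ℝ f (x + s • z) z) s := by
      have hl : HasDerivAt (fun s : ℝ => x + s • z) z s := by
        simpa using ((hasDerivAt_id s).smul_const z).const_add x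
      exact (hs hsm).hasFDerivAt.comp_hasDerivAt s hl
    rw [hder.deriv]
    exact (fderiv ℝ f (x + s • z)).le_opENorm z
  rw [lintegral_mul_const _ hm] at h2
  calc ‖f (x + z) - f x‖ₑ ^ 2
      ≤ ((∫⁻ s in Ioc (0 : ℝ) 1, ‖fderiv ℝ f (x + s • z)‖ₑ) * ‖z‖ₑ) ^ 2 := by gcongr
    _ = ‖z‖ₑ ^ 2 * (∫⁻ s in Ioc (0 : ℝ) 1, ‖fderiv ℝ f (x + s • z)‖ₑ) ^ 2 := by
        rw [mul_pow, mul_comm]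
    _ ≤ _ := by
        gcongr
        refine (sq_lintegral_le _ hm.aemeasurable).trans ?_
        simp

/-- A weighted `L²` estimate for the increment of a Lipschitz function by a translation. -/
lemma lintegral_increment_sq_le {f : Space d → ℝ} {K : NNReal} (hf : LipschitzWith K f)
    (z : Space d) {W h : Space d → ℝ≥0∞} (hh : Measurable h)
    (hWh : ∀ x, ∀ s ∈ Ioc (0 : ℝ) 1, W x * ‖fderiv ℝ f (x + s • z)‖ₑ ^ 2 ≤ h (x + s • z)) :
    ∫⁻ x, W x * ‖f (x + z) - f x‖ₑ ^ 2 ≤ ‖z‖ₑ ^ 2 * ∫⁻ x, h x := by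
  have hae : ∀ᵐ x : Space d, ∀ᵐ s : ℝ, DifferentiableAt ℝ f (x + s • z) := by
    have hms : MeasurableSet {p : Space d × ℝ | DifferentiableAt ℝ f (p.1 + p.2 • z)} :=
      (measurableSet_of_differentiableAt ℝ f).preimage (by fun_prop)
    -- For each fixed `s` the points where differentiability fails form a translate of a null set
    -- (Rademacher). Fubini exchanges the quantifiers, so that almost every segment is good at
    -- almost every parameter.
    rw [Measure.ae_ae_comm (p := fun x s => DifferentiableAt ℝ f (x + s • z)) hms]
    refine Eventually.of_forall fun s => ?_
    exact (quasiMeasurePreserving_add_right volume (s • z)).ae hf.ae_differentiableAt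
  have hm : Measurable fun p : Space d × ℝ => ‖fderiv ℝ f (p.1 + p.2 • z)‖ₑ ^ 2 :=
    ((measurable_fderiv ℝ f).enorm.comp (by fun_prop)).pow_const 2
  calc ∫⁻ x, W x * ‖f (x + z) - f x‖ₑ ^ 2
      ≤ ∫⁻ x, ‖z‖ₑ ^ 2 * ∫⁻ s in Ioc (0 : ℝ) 1, h (x + s • z) := by
        refine lintegral_mono_ae ?_
        filter_upwards [hae] with x hx
        calc W x * ‖f (x + z) - f x‖ₑ ^ 2
            ≤ W x * (‖z‖ₑ ^ 2 * ∫⁻ s in Ioc (0 : ℝ) 1, ‖fderiv ℝ f (x + s • z)‖ₑ ^ 2) := by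
              gcongr
              exact enorm_sub_sq_le_lintegral hf (hx.mono fun s hs _ => hs)
          _ = ‖z‖ₑ ^ 2 * ∫⁻ s in Ioc (0 : ℝ) 1, W x * ‖fderiv ℝ f (x + s • z)‖ₑ ^ 2 := by
              have hmx : Measurable fun s : ℝ => ‖fderiv ℝ f (x + s • z)‖ₑ ^ 2 :=
                ((measurable_fderiv ℝ f).enorm.comp (by fun_prop)).pow_const 2
              rw [lintegral_const_mul _ hmx, mul_left_comm]
          _ ≤ _ := by
              refine mul_le_mul_right (lintegral_mono_ae ?_) _
              rw [ae_restrict_iff' measurableSet_Ioc]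
              exact Eventually.of_forall fun s hs => hWh x s hs
    _ = ‖z‖ₑ ^ 2 * ∫⁻ x, ∫⁻ s in Ioc (0 : ℝ) 1, h (x + s • z) := by
        rw [lintegral_const_mul]
        exact Measurable.lintegral_prod_right'
          (f := fun p : Space d × ℝ => h (p.1 + p.2 • z)) (hh.comp (by fun_prop))
    _ = ‖z‖ₑ ^ 2 * ∫⁻ s in Ioc (0 : ℝ) 1, ∫⁻ x, h (x + s • z) := by
        rw [lintegral_lintegral_swap]
        exact (hh.comp (by fun_prop)).aemeasurable
    _ = ‖z‖ₑ ^ 2 * ∫⁻ x, h x := by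
        simp [lintegral_add_right_eq_self h]

/-- A Faber–Krahn inequality. -/
lemma faberKrahn {f : Space d → ℝ} {K : NNReal} (hf : LipschitzWith K f)
    (hc : HasCompactSupport f) {S : Set (Space d)} (hS : MeasurableSet S)
    (hfS : ∀ x ∉ S, f x = 0) {r : ℝ} (hr : 0 < r)
    (hSr : 4 * volume S ≤ volume (ball (0 : Space d) r)) :
    ∫⁻ x, ‖f x‖ₑ ^ 2 ≤ 2 * ENNReal.ofReal r ^ 2 * ∫⁻ x, ‖fderiv ℝ f x‖ₑ ^ 2 := by
  set I := ∫⁻ x, ‖f x‖ₑ ^ 2 with hI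
  set D := ∫⁻ x, ‖fderiv ℝ f x‖ₑ ^ 2 with hD
  set V := volume (ball (0 : Space d) r) with hV
  have hfm : Measurable f := hf.continuous.measurable
  have hfe : Measurable fun x => ‖f x‖ₑ := hfm.enorm
  have hV0 : V ≠ 0 := (measure_ball_pos volume _ hr).ne'
  have hVt : V ≠ ∞ := measure_ball_lt_top.ne
  -- Finiteness is needed to subtract `V * I` at the end.
  have hIt : I ≠ ∞ := by
    have h : Integrable (fun x => f x * f x) :=
      (hf.continuous.mul hf.continuous).integrable_of_hasCompactSupport hc.mul_left
    have h2 := h.hasFiniteIntegral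
    simp only [HasFiniteIntegral, ← sq, enorm_pow] at h2
    exact h2.ne
  -- Expand `(f (x + z) - f x) ^ 2` and drop the term `f (x + z) ^ 2`. Averaging over `z` in the
  -- ball then makes the correlation term small.
  have hpt : ∀ x z, ‖f x‖ₑ ^ 2 ≤ ‖f (x + z) - f x‖ₑ ^ 2 + 2 * (‖f x‖ₑ * ‖f (x + z)‖ₑ) := by
    intro x z
    rw [enorm_sq_eq, enorm_sq_eq, ← enorm_mul, Real.enorm_eq_ofReal_abs,
      two_mul, ← ENNReal.ofReal_add (abs_nonneg _) (abs_nonneg _),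
      ← ENNReal.ofReal_add (sq_nonneg _) (by positivity)]
    refine ENNReal.ofReal_le_ofReal ?_
    nlinarith [le_abs_self (f x * f (x + z)), sq_nonneg (f (x + z))]
  have hz : ∀ z ∈ ball (0 : Space d) r, I ≤ ENNReal.ofReal r ^ 2 * D
      + 2 * ∫⁻ x, ‖f x‖ₑ * ‖f (x + z)‖ₑ := by
    intro z hz
    have hinc : ∫⁻ x, ‖f (x + z) - f x‖ₑ ^ 2 ≤ ‖z‖ₑ ^ 2 * D := by
      have := lintegral_increment_sq_le hf z (W := fun _ => 1)
        (h := fun x => ‖fderiv ℝ f x‖ₑ ^ 2)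
        ((measurable_fderiv ℝ f).enorm.pow_const 2) (by simp)
      simpa using this
    have hzr : ‖z‖ₑ ≤ ENNReal.ofReal r := by
      rw [← ofReal_norm]
      exact ENNReal.ofReal_le_ofReal (by simpa using (mem_ball_zero_iff.1 hz).le)
    calc I ≤ ∫⁻ x, (‖f (x + z) - f x‖ₑ ^ 2 + 2 * (‖f x‖ₑ * ‖f (x + z)‖ₑ)) :=
          lintegral_mono fun x => hpt x z
      _ = (∫⁻ x, ‖f (x + z) - f x‖ₑ ^ 2) + 2 * ∫⁻ x, ‖f x‖ₑ * ‖f (x + z)‖ₑ := by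
          rw [lintegral_add_left, lintegral_const_mul]
          · exact hfe.mul (hfe.comp (by fun_prop))
          · exact (((hfm.comp (by fun_prop)).sub hfm).enorm).pow_const 2
      _ ≤ _ := by
          gcongr
          exact hinc.trans (by gcongr)
  have hJ : (∫⁻ x, ‖f x‖ₑ) ^ 2 ≤ volume S * I := by
    have h1 : ∫⁻ x, ‖f x‖ₑ = ∫⁻ x in S, ‖f x‖ₑ := by
      rw [← lintegral_indicator hS]
      congr 1; ext x
      by_cases hx : x ∈ S
      · simp [hx]
      · simp [hx, hfS x hx]
    rw [h1]
    refine (sq_lintegral_le _ hfe.aemeasurable).trans ?_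
    rw [Measure.restrict_apply_univ]
    exact mul_le_mul_right (setLIntegral_le_lintegral _ _) _
  -- Enlarging the ball to the whole space turns the double integral into `(∫ |f|) ^ 2`, and
  -- Cauchy–Schwarz on the support yields the factor `volume S`.
  have hprod : ∫⁻ z in ball (0 : Space d) r, ∫⁻ x, ‖f x‖ₑ * ‖f (x + z)‖ₑ ≤ volume S * I := by
    refine le_trans ?_ hJ
    calc ∫⁻ z in ball (0 : Space d) r, ∫⁻ x, ‖f x‖ₑ * ‖f (x + z)‖ₑ
        ≤ ∫⁻ z, ∫⁻ x, ‖f x‖ₑ * ‖f (x + z)‖ₑ := setLIntegral_le_lintegral _ _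
      _ = ∫⁻ x, ∫⁻ z, ‖f x‖ₑ * ‖f (x + z)‖ₑ := by
          rw [lintegral_lintegral_swap]
          refine Measurable.aemeasurable ?_
          exact (hfe.comp measurable_snd).mul (hfe.comp (by fun_prop))
      _ = ∫⁻ x, ‖f x‖ₑ * ∫⁻ z, ‖f z‖ₑ := by
          congr 1; ext x
          have hm : Measurable fun z => ‖f (x + z)‖ₑ := hfe.comp (by fun_prop)
          rw [lintegral_const_mul _ hm, lintegral_add_left_eq_self (fun z => ‖f z‖ₑ) x]
      _ = (∫⁻ x, ‖f x‖ₑ) ^ 2 := by rw [lintegral_mul_const _ hfe, sq]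
  have hmain : V * I ≤ V * (ENNReal.ofReal r ^ 2 * D) + 2 * (volume S * I) := by
    calc V * I = ∫⁻ z in ball (0 : Space d) r, I := by simp [hV, mul_comm]
      _ ≤ ∫⁻ z in ball (0 : Space d) r, (ENNReal.ofReal r ^ 2 * D
          + 2 * ∫⁻ x, ‖f x‖ₑ * ‖f (x + z)‖ₑ) :=
          setLIntegral_mono' measurableSet_ball hz
      _ = V * (ENNReal.ofReal r ^ 2 * D)
          + 2 * ∫⁻ z in ball (0 : Space d) r, ∫⁻ x, ‖f x‖ₑ * ‖f (x + z)‖ₑ := by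
          have hm : Measurable fun z => ∫⁻ x, ‖f x‖ₑ * ‖f (x + z)‖ₑ :=
            Measurable.lintegral_prod_right'
              (f := fun p : Space d × Space d => ‖f p.2‖ₑ * ‖f (p.2 + p.1)‖ₑ)
              ((hfe.comp measurable_snd).mul (hfe.comp (by fun_prop)))
          rw [lintegral_add_left measurable_const, lintegral_const_mul _ hm, setLIntegral_const,
            mul_comm _ V]
      _ ≤ _ := by gcongr
  -- This is where the factor 4 in the smallness of `S` is used: the correlation term becomes at
  -- most half of the left side and is absorbed.
  have h2 : 2 * (V * I) ≤ 2 * (V * (ENNReal.ofReal r ^ 2 * D)) + V * I := by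
    calc 2 * (V * I) ≤ 2 * (V * (ENNReal.ofReal r ^ 2 * D) + 2 * (volume S * I)) := by gcongr
      _ = 2 * (V * (ENNReal.ofReal r ^ 2 * D)) + (4 * volume S) * I := by ring
      _ ≤ _ := by gcongr
  have hVI : V * I ≠ ∞ := ENNReal.mul_ne_top hVt hIt
  rw [two_mul (V * I), ENNReal.add_le_add_iff_right hVI] at h2
  rw [show 2 * (V * (ENNReal.ofReal r ^ 2 * D)) = V * (2 * ENNReal.ofReal r ^ 2 * D) by ring] at h2
  exact (ENNReal.mul_le_mul_iff_right hV0 hVt).1 h2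

/-! ### Hardy's inequality and its weighted consequence -/

lemma integrable_of_bounded_of_support {α : Type*} [MeasurableSpace α] {μ : Measure α} {f : α → ℝ}
    {S : Set α} (hS : MeasurableSet S) (hμ : μ S ≠ ∞) (hf : AEStronglyMeasurable f μ) (C : ℝ)
    (hC : ∀ x ∈ S, |f x| ≤ C) (h0 : ∀ x ∉ S, f x = 0) : Integrable f μ := by
  rw [← integrableOn_iff_integrable_of_support_subset (s := S)
    (fun x hx => by by_contra h; exact hx (h0 x h))]
  exact Measure.integrableOn_of_bounded hμ hf ((ae_restrict_iff' hS).2 (Eventually.of_forall hC))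

lemma lipschitzWith_mul_of_bounded {α : Type*} [PseudoMetricSpace α] {f g : α → ℝ} {K K' : NNReal}
    (hf : LipschitzWith K f) (hg : LipschitzWith K' g) (A B : NNReal) (hA : ∀ x, |f x| ≤ A)
    (hB : ∀ x, |g x| ≤ B) : LipschitzWith (A * K' + B * K) (fun x => f x * g x) := by
  refine LipschitzWith.of_dist_le_mul fun x y => ?_
  have h1 := hf.dist_le_mul x y
  have h2 := hg.dist_le_mul x y
  rw [Real.dist_eq] at *
  calc |f x * g x - f y * g y| = |f x * (g x - g y) + g y * (f x - f y)| := by ring_nf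
    _ ≤ |f x| * |g x - g y| + |g y| * |f x - f y| := by
        refine (abs_add_le _ _).trans ?_
        rw [abs_mul, abs_mul]
    _ ≤ A * (K' * dist x y) + B * (K * dist x y) := by
        gcongr
        · exact hA x
        · exact hB y
    _ = _ := by push_cast; ring

/-- This makes the kink of `xp` harmless: near almost every point `xp` is either the linear
coordinate or zero. -/
lemma ae_coord_ne_zero : ∀ᵐ x : Space d, x (Fin.last d) ≠ 0 := by
  let l : Space d →ₗ[ℝ] ℝ := (EuclideanSpace.proj (𝕜 := ℝ) (Fin.last d)).toLinearMap
  have h : volume ((LinearMap.ker l : Submodule ℝ (Space d)) : Set (Space d)) = 0 := by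
    refine Measure.addHaar_submodule _ _ fun h => ?_
    have : EuclideanSpace.single (Fin.last d) (1 : ℝ) ∈ LinearMap.ker l := by rw [h]; trivial
    simp [l] at this
  rw [ae_iff]
  convert! h using 2
  ext x
  simp [l]

lemma hasFDerivAt_xp {x : Space d} (hx : 0 < x (Fin.last d)) :
    HasFDerivAt xp (EuclideanSpace.proj (𝕜 := ℝ) (Fin.last d)) x := by
  have h := (EuclideanSpace.proj (Fin.last d) : Space d →L[ℝ] ℝ).hasFDerivAt (x := x)
  refine h.congr_of_eventuallyEq ?_
  have : ∀ᶠ y : Space d in 𝓝 x, 0 < y (Fin.last d) :=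
    (Continuous.tendsto (by fun_prop) x).eventually (lt_mem_nhds hx)
  filter_upwards [this] with y hy
  simp [xp, hy.le]

lemma xp_eventuallyEq_zero {x : Space d} (hx : x (Fin.last d) < 0) : xp =ᶠ[𝓝 x] fun _ => 0 := by
  have : ∀ᶠ y : Space d in 𝓝 x, y (Fin.last d) < 0 :=
    (Continuous.tendsto (by fun_prop) x).eventually (gt_mem_nhds hx)
  filter_upwards [this] with y hy
  simp [xp, hy.le]

lemma lineDeriv_fun_const (c : ℝ) (x v : Space d) : lineDeriv ℝ (fun _ => c) x v = 0 := by
  simp [lineDeriv]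

lemma norm_proj_le (i : Fin (d + 1)) :
    ‖(EuclideanSpace.proj i : Space d →L[ℝ] ℝ)‖ ≤ 1 :=
  ContinuousLinearMap.opNorm_le_bound _ zero_le_one fun x => by
    simpa using abs_coord_le x i

/-- A bounded Lipschitz function with compact support stays so after multiplication by `xp`. -/
lemma exists_lipschitzWith_xp_mul {v : Space d → ℝ} {K : NNReal} (hv : LipschitzWith K v)
    (hc : HasCompactSupport v) : ∃ K', LipschitzWith K' fun x => xp x * v x := by
  obtain ⟨R, hR⟩ := hc.isCompact.isBounded.subset_closedBall 0
  obtain ⟨B, hB⟩ := hv.continuous.bounded_above_of_compact_support hc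
  -- `xp` is unbounded, but only its values on the support of `v` matter, so it may be capped there.
  have heq : (fun x => xp x * v x) = fun x => min (xp x) (max R 0) * v x := by
    ext x
    by_cases hx : x ∈ tsupport v
    · have : xp x ≤ max R 0 :=
        (xp_le_norm x).trans ((mem_closedBall_zero_iff.1 (hR hx)).trans (le_max_left _ _))
      rw [min_eq_left this]
    · simp [image_eq_zero_of_notMem_tsupport hx]
  rw [heq]
  refine ⟨_, lipschitzWith_mul_of_bounded (lipschitzWith_xp.min_const (max R 0)) hv
    ⟨max R 0, le_max_right _ _⟩ ⟨max B 0, le_max_right _ _⟩ (fun x => ?_) (fun x => ?_)⟩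
  · rw [abs_of_nonneg (le_min (xp_nonneg x) (le_max_right _ _))]
    exact min_le_right _ _
  · exact (hB x).trans (le_max_left _ _)

/-- A Hardy inequality. -/
lemma hardy {v : Space d → ℝ} {K : NNReal} (hv : LipschitzWith K v) (hc : HasCompactSupport v) :
    ∫⁻ x in {x : Space d | 0 < x (Fin.last d)}, ‖v x‖ₑ ^ 2
      ≤ 4 * ∫⁻ x, ENNReal.ofReal (xp x) ^ 2 * ‖fderiv ℝ v x‖ₑ ^ 2 := by
  set H : Set (Space d) := {x | 0 < x (Fin.last d)} with hH
  have hHm : MeasurableSet H := measurableSet_lt measurable_const (by fun_prop)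
  set T := tsupport v with hT
  have hTm : MeasurableSet T := (isClosed_tsupport v).measurableSet
  have hTf : volume T ≠ ∞ := hc.isCompact.measure_lt_top.ne
  obtain ⟨B, hB⟩ := hv.continuous.bounded_above_of_compact_support hc
  obtain ⟨R, hR⟩ := hc.isCompact.isBounded.subset_closedBall 0
  have hxpR : ∀ x ∈ T, xp x ≤ R := fun x hx =>
    (xp_le_norm x).trans (mem_closedBall_zero_iff.1 (hR hx))
  have hDK : ∀ x, ‖fderiv ℝ v x‖ ≤ K := fun x => norm_fderiv_le_of_lipschitz ℝ hv
  have hD0 : ∀ x ∉ T, fderiv ℝ v x = 0 := fun x hx =>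
    image_eq_zero_of_notMem_tsupport (fun h => hx (tsupport_fderiv_subset ℝ h))
  have hv0 : ∀ x ∉ T, v x = 0 := fun x hx => image_eq_zero_of_notMem_tsupport hx
  set e : Space d := EuclideanSpace.single (Fin.last d) (1 : ℝ) with he
  have hne : ‖e‖ = 1 := by simp [he]
  obtain ⟨K1, hK1⟩ := exists_lipschitzWith_xp_mul hv hc
  have hF : ∃ K2, LipschitzWith K2 fun x => (xp x * v x) * v x := by
    have hc' : HasCompactSupport fun x => xp x * v x := hc.mul_left
    obtain ⟨B', hB'⟩ := hK1.continuous.bounded_above_of_compact_support hc'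
    exact ⟨_, lipschitzWith_mul_of_bounded hK1 hv ⟨max B' 0, le_max_right _ _⟩
      ⟨max B 0, le_max_right _ _⟩ (fun x => (hB' x).trans (le_max_left _ _))
      (fun x => (hB x).trans (le_max_left _ _))⟩
  obtain ⟨K2, hK2⟩ := hF
  -- The field `xp v ^ 2 e` has compact support, so its divergence integrates to zero. There is no
  -- contribution from the hyperplane because `xp` vanishes on it. The formula is integration by
  -- parts against the constant 1.
  have hint0 : ∫ x, lineDeriv ℝ (fun x => (xp x * v x) * v x) x e = 0 := by
    have h := (LipschitzWith.const (1 : ℝ)).integral_lineDeriv_mul_eq (μ := volume) hK2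
      (hc.mul_left (f := fun x => xp x * v x)) (-e)
    have h0 : ∀ x : Space d, lineDeriv ℝ (fun _ : Space d => (1 : ℝ)) x (-e) = 0 := fun x =>
      lineDeriv_fun_const _ _ _
    simpa [h0] using h.symm
  have hder : ∀ᵐ x, lineDeriv ℝ (fun x => (xp x * v x) * v x) x e
      = H.indicator (fun x => v x ^ 2) x + H.indicator (fun x => 2 * xp x * v x * fderiv ℝ v x e) x := by
    filter_upwards [ae_coord_ne_zero, hv.ae_differentiableAt] with x hx hdx
    rcases lt_or_gt_of_ne hx with hx | hx
    · have hxH : x ∉ H := by simp [hH, hx.le]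
      have : (fun x => (xp x * v x) * v x) =ᶠ[𝓝 x] fun _ => 0 := by
        filter_upwards [xp_eventuallyEq_zero hx] with y hy
        simp [hy]
      rw [this.lineDeriv_eq, lineDeriv_fun_const]
      simp [hxH]
    · have hxH : x ∈ H := hx
      have h1 := (((hasFDerivAt_xp hx).mul hdx.hasFDerivAt).mul hdx.hasFDerivAt)
      have h2 := (h1.hasLineDerivAt e).lineDeriv
      simp only [Pi.mul_def] at h2
      rw [h2]
      simp [hxH, he]
      ring
  have hi1 : Integrable (H.indicator fun x => v x ^ 2) := by
    refine Integrable.indicator ?_ hHm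
    refine integrable_of_bounded_of_support hTm hTf (hv.continuous.pow 2).aestronglyMeasurable
      (B ^ 2) (fun x _ => ?_) (fun x hx => by simp [hv0 x hx])
    rw [abs_pow]
    exact pow_le_pow_left₀ (abs_nonneg _) (hB x) 2
  have hR0 : ∀ x ∈ T, 0 ≤ R := fun x hx => (xp_nonneg x).trans (hxpR x hx)
  have hi2 : Integrable (H.indicator fun x => 2 * xp x * v x * fderiv ℝ v x e) := by
    refine Integrable.indicator ?_ hHm
    have hm : Measurable fun x => 2 * xp x * v x * fderiv ℝ v x e :=
      ((measurable_const.mul measurable_xp).mul hv.continuous.measurable).mul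
        (measurable_fderiv_apply_const ℝ v e)
    refine integrable_of_bounded_of_support hTm hTf hm.aestronglyMeasurable (2 * R * B * K)
      (fun x hx => ?_) (fun x hx => by simp [hv0 x hx])
    rw [abs_mul, abs_mul, abs_mul, abs_two, abs_of_nonneg (xp_nonneg x)]
    have h1 : |fderiv ℝ v x e| ≤ K := by
      have := (fderiv ℝ v x).le_opNorm e
      rw [hne, mul_one] at this
      exact this.trans (hDK x)
    have := hR0 x hx
    have hB0 : 0 ≤ B := (norm_nonneg _).trans (hB x)
    gcongr
    · exact hxpR x hx
    · exact hB x
  have hmD : Measurable fun x => xp x ^ 2 * ‖fderiv ℝ v x‖ ^ 2 :=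
    (measurable_xp.pow_const 2).mul ((measurable_fderiv ℝ v).norm.pow_const 2)
  have hi3 : Integrable fun x => xp x ^ 2 * ‖fderiv ℝ v x‖ ^ 2 := by
    refine integrable_of_bounded_of_support hTm hTf hmD.aestronglyMeasurable (R ^ 2 * K ^ 2)
      (fun x hx => ?_) (fun x hx => by simp [hD0 x hx])
    rw [abs_of_nonneg (by positivity)]
    have := hR0 x hx
    have := xp_nonneg x
    gcongr
    · exact hxpR x hx
    · exact hDK x
  rw [integral_congr_ae hder, integral_add hi1 hi2] at hint0
  -- Young's inequality `-2 v y ≤ v ^ 2 / 2 + 2 y ^ 2` with `y = xp ∂ₙv`. Half of `∫ v ^ 2` is then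
  -- absorbed, which gives the constant 4.
  have hle : -∫ x, H.indicator (fun x => 2 * xp x * v x * fderiv ℝ v x e) x
      ≤ ∫ x, ((1 / 2) * H.indicator (fun x => v x ^ 2) x
        + 2 * (xp x ^ 2 * ‖fderiv ℝ v x‖ ^ 2)) := by
    rw [← integral_neg]
    refine integral_mono hi2.neg ((hi1.const_mul _).add (hi3.const_mul _)) fun x => ?_
    by_cases hx : x ∈ H
    · simp only [hx, indicator_of_mem]
      have h1 : |fderiv ℝ v x e| ≤ ‖fderiv ℝ v x‖ := by
        simpa [hne] using (fderiv ℝ v x).le_opNorm e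
      have h2 : (fderiv ℝ v x e) ^ 2 ≤ ‖fderiv ℝ v x‖ ^ 2 := by
        rw [← sq_abs]; gcongr
      have h3 : xp x ^ 2 * (fderiv ℝ v x e) ^ 2 ≤ xp x ^ 2 * ‖fderiv ℝ v x‖ ^ 2 := by gcongr
      nlinarith [sq_nonneg (v x + 2 * (xp x * fderiv ℝ v x e))]
    · simp only [hx, not_false_eq_true, indicator_of_notMem]
      have := xp_nonneg x
      simp only [neg_zero, mul_zero, zero_add]
      positivity
  rw [integral_add (hi1.const_mul _) (hi3.const_mul _), integral_const_mul,
    integral_const_mul] at hle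
  have hfin : ∫ x, H.indicator (fun x => v x ^ 2) x
      ≤ 4 * ∫ x, xp x ^ 2 * ‖fderiv ℝ v x‖ ^ 2 := by linarith
  have e1 : ∫⁻ x in H, ‖v x‖ₑ ^ 2 = ENNReal.ofReal (∫ x, H.indicator (fun x => v x ^ 2) x) := by
    rw [ofReal_integral_eq_lintegral_ofReal hi1
      (Eventually.of_forall fun x => indicator_nonneg (fun y _ => sq_nonneg _) x),
      ← lintegral_indicator hHm]
    congr 1; ext x
    by_cases hx : x ∈ H <;> simp [hx, enorm_sq_eq]
  have e2 : ∫⁻ x, ENNReal.ofReal (xp x) ^ 2 * ‖fderiv ℝ v x‖ₑ ^ 2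
      = ENNReal.ofReal (∫ x, xp x ^ 2 * ‖fderiv ℝ v x‖ ^ 2) := by
    rw [ofReal_integral_eq_lintegral_ofReal hi3 (Eventually.of_forall fun x => by positivity)]
    congr 1; ext x
    rw [ENNReal.ofReal_mul (by positivity), ENNReal.ofReal_pow (xp_nonneg x),
      ENNReal.ofReal_pow (norm_nonneg _), ofReal_norm]
  rw [e1, e2, show (4 : ℝ≥0∞) = ENNReal.ofReal 4 by simp, ← ENNReal.ofReal_mul (by norm_num)]
  exact ENNReal.ofReal_le_ofReal hfin

lemma enorm_add_sq_le {F : Type*} [SeminormedAddCommGroup F] (a b : F) :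
    ‖a + b‖ₑ ^ 2 ≤ 2 * ‖a‖ₑ ^ 2 + 2 * ‖b‖ₑ ^ 2 := by
  have h1 : ‖a + b‖ ^ 2 ≤ 2 * ‖a‖ ^ 2 + 2 * ‖b‖ ^ 2 := by
    nlinarith [norm_add_le a b, norm_nonneg (a + b), sq_nonneg (‖a‖ - ‖b‖), norm_nonneg a,
      norm_nonneg b]
  have h2 := ENNReal.ofReal_le_ofReal h1
  rw [ENNReal.ofReal_add (by positivity) (by positivity), ENNReal.ofReal_mul zero_le_two,
    ENNReal.ofReal_mul zero_le_two] at h2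
  simpa [ENNReal.ofReal_pow, ofReal_norm] using h2

/-- A Faber–Krahn inequality with weight `xp ^ 2`, without boundary condition on `{xp = 0}`. -/
lemma weighted_faberKrahn {v : Space d → ℝ} {K : NNReal} (hv : LipschitzWith K v)
    (hc : HasCompactSupport v) {S : Set (Space d)} (hS : MeasurableSet S)
    (hvS : ∀ x, 0 < x (Fin.last d) → x ∉ S → v x = 0) {r : ℝ} (hr : 0 < r)
    (hSr : 4 * volume S ≤ volume (ball (0 : Space d) r)) :
    ∫⁻ x, ENNReal.ofReal (xp x) ^ 2 * ‖v x‖ₑ ^ 2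
      ≤ 20 * ENNReal.ofReal r ^ 2 * ∫⁻ x, ENNReal.ofReal (xp x) ^ 2 * ‖fderiv ℝ v x‖ₑ ^ 2 := by
  obtain ⟨K1, hK1⟩ := exists_lipschitzWith_xp_mul hv hc
  -- The product `xp v` vanishes for `x_n ≤ 0` whatever `v` does there, so the unweighted inequality
  -- applies and no condition on the hyperplane is needed.
  have h1 := faberKrahn hK1 hc.mul_left hS (fun x hx => by
    rcases le_or_gt (x (Fin.last d)) 0 with h | h
    · simp [xp, h]
    · simp [hvS x h hx]) hr hSr
  set P := ∫⁻ x, ENNReal.ofReal (xp x) ^ 2 * ‖fderiv ℝ v x‖ₑ ^ 2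
  set H : Set (Space d) := {x | 0 < x (Fin.last d)} with hH
  have hHm : MeasurableSet H := measurableSet_lt measurable_const (by fun_prop)
  have h2 : ∫⁻ x, ‖fderiv ℝ (fun x => xp x * v x) x‖ₑ ^ 2 ≤ 10 * P := by
    calc ∫⁻ x, ‖fderiv ℝ (fun x => xp x * v x) x‖ₑ ^ 2
        ≤ ∫⁻ x, (2 * (ENNReal.ofReal (xp x) ^ 2 * ‖fderiv ℝ v x‖ₑ ^ 2)
          + 2 * H.indicator (fun x => ‖v x‖ₑ ^ 2) x) := by
          refine lintegral_mono_ae ?_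
          filter_upwards [ae_coord_ne_zero, hv.ae_differentiableAt] with x hx hdx
          rcases lt_or_gt_of_ne hx with hx | hx
          · have : (fun x => xp x * v x) =ᶠ[𝓝 x] fun _ => 0 := by
              filter_upwards [xp_eventuallyEq_zero hx] with y hy
              simp [hy]
            rw [this.fderiv_eq, fderiv_const_apply, enorm_eq_nnnorm, nnnorm_zero]
            simp
          · have hxH : x ∈ H := hx
            have h := ((hasFDerivAt_xp hx).mul hdx.hasFDerivAt).fderiv
            simp only [Pi.mul_def] at h
            rw [h, indicator_of_mem hxH]
            refine (enorm_add_sq_le _ _).trans ?_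
            rw [enorm_smul, enorm_smul, mul_pow, mul_pow,
              Real.enorm_of_nonneg (xp_nonneg x)]
            have hp : ‖(EuclideanSpace.proj (Fin.last d) : Space d →L[ℝ] ℝ)‖ₑ ^ 2 ≤ 1 := by
              refine pow_le_one' ?_ 2
              rw [← ofReal_norm]
              simpa using ENNReal.ofReal_le_ofReal (norm_proj_le (Fin.last d))
            gcongr
            calc _ ≤ ‖v x‖ₑ ^ 2 * 1 := by gcongr
              _ = _ := mul_one _
      _ = 2 * P + 2 * ∫⁻ x in H, ‖v x‖ₑ ^ 2 := by
          rw [lintegral_add_left, lintegral_const_mul, lintegral_const_mul,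
            lintegral_indicator hHm]
          · exact (hv.continuous.measurable.enorm.pow_const 2).indicator hHm
          · exact (measurable_xp.ennreal_ofReal.pow_const 2).mul
              ((measurable_fderiv ℝ v).enorm.pow_const 2)
          · exact ((measurable_xp.ennreal_ofReal.pow_const 2).mul
              ((measurable_fderiv ℝ v).enorm.pow_const 2)).const_mul _
      -- The term `v ∇xp` is of order zero in `v` and carries no weight; Hardy's inequality returns
      -- it to the weighted gradient.
      _ ≤ 2 * P + 2 * (4 * P) := by gcongr; exact hardy hv hc
      _ = 10 * P := by ring
  calc ∫⁻ x, ENNReal.ofReal (xp x) ^ 2 * ‖v x‖ₑ ^ 2 = ∫⁻ x, ‖xp x * v x‖ₑ ^ 2 := by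
        congr 1; ext x
        rw [enorm_mul, mul_pow, Real.enorm_of_nonneg (xp_nonneg x)]
    _ ≤ 2 * ENNReal.ofReal r ^ 2 * (10 * P) := h1.trans (by gcongr)
    _ = _ := by ring

/-! ### Volume versus weighted measure, and a weighted Poincaré inequality -/

/-- The part of the unit ball in a thin slab is small. -/
lemma volume_slab_le (ε : ℝ) :
    volume (ball (0 : Space d) 1 ∩ {x | 0 < x (Fin.last d) ∧ x (Fin.last d) ≤ ε})
      ≤ ENNReal.ofReal (2 ^ d * ε) := by
  have hmp := EuclideanSpace.volume_preserving_symm_measurableEquiv_toLp (Fin (d + 1))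
  -- The slab lies in the box `[-1, 1]^d × [0, ε]`.
  set a : Fin (d + 1) → ℝ := Fin.snoc (α := fun _ => ℝ) (fun _ => -1) 0
  set b : Fin (d + 1) → ℝ := Fin.snoc (α := fun _ => ℝ) (fun _ => 1) ε
  have hsub : ball (0 : Space d) 1 ∩ {x | 0 < x (Fin.last d) ∧ x (Fin.last d) ≤ ε}
      ⊆ (MeasurableEquiv.toLp 2 (Fin (d + 1) → ℝ)).symm ⁻¹' (Icc a b) := by
    rintro x ⟨hx, h0, hε⟩
    have hx1 : ∀ i, |x i| ≤ 1 := fun i =>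
      (abs_coord_le x i).trans (mem_ball_zero_iff.1 hx).le
    constructor
    · intro i
      refine Fin.lastCases ?_ (fun j => ?_) i
      · simpa [a] using h0.le
      · simpa [a] using (abs_le.1 (hx1 j.castSucc)).1
    · intro i
      refine Fin.lastCases ?_ (fun j => ?_) i
      · simpa [b] using hε
      · simpa [b] using (abs_le.1 (hx1 j.castSucc)).2
  refine (measure_mono hsub).trans ?_
  rw [hmp.measure_preimage measurableSet_Icc.nullMeasurableSet, Real.volume_Icc_pi,
    Fin.prod_univ_castSucc]
  rcases le_or_gt ε 0 with h | h
  · simp [a, b, ENNReal.ofReal_of_nonpos h]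
  · rw [ENNReal.ofReal_mul (by positivity), ENNReal.ofReal_pow zero_le_two]
    simp only [a, b, Fin.snoc_castSucc, Fin.snoc_last, Finset.prod_const, Finset.card_univ,
      Fintype.card_fin, sub_zero]
    norm_num

/-- A set of small weighted measure has small volume. -/
lemma exists_volume_le_ball (d q : ℕ) : ∃ (N : ℕ) (c : ℝ), 0 < c ∧ ∀ r : ℝ, 0 < r →
    ∀ S : Set (Space d), MeasurableSet S → S ⊆ halfBall 0 1 →
      ∫⁻ x in S, ENNReal.ofReal (xp x) ^ q ≤ ENNReal.ofReal (c * r ^ N) →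
      4 * volume S ≤ volume (ball (0 : Space d) r) := by
  set V := (volume (ball (0 : Space d) 1)).toReal with hV
  have hVt : volume (ball (0 : Space d) 1) ≠ ∞ := measure_ball_lt_top.ne
  have hV0 : 0 < V := ENNReal.toReal_pos (measure_ball_pos volume _ one_pos).ne' hVt
  set a := V / (8 * 2 ^ d) with ha
  have ha0 : 0 < a := by positivity
  -- The set is cut at height `ε = a r ^ (d + 1)`. The choice of `a` makes the slab below take at
  -- most an eighth of the volume of the ball of radius `r`. Above it Chebyshev's inequality, where
  -- the weight is at least `ε ^ q`, gives another eighth: this is what fixes `N` and `c`.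
  refine ⟨(d + 1) * (q + 1), V / 8 * a ^ q, by positivity, fun r hr S hS hSb hSq => ?_⟩
  set ε := a * r ^ (d + 1) with hε
  have hε0 : 0 < ε := by positivity
  have hsplit : S ⊆ (ball (0 : Space d) 1 ∩ {x | 0 < x (Fin.last d) ∧ x (Fin.last d) ≤ ε})
      ∪ {x | x ∈ S ∧ ε ≤ xp x} := by
    intro x hx
    rcases le_or_gt (x (Fin.last d)) ε with h | h
    · exact Or.inl ⟨(hSb hx).1, (hSb hx).2, h⟩
    · exact Or.inr ⟨hx, h.le.trans (le_max_left _ _)⟩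
  have hbig : volume {x | x ∈ S ∧ ε ≤ xp x} ≤ ENNReal.ofReal (V / 8 * r ^ (d + 1)) := by
    have hm : MeasurableSet {x : Space d | ε ≤ xp x} :=
      measurableSet_le measurable_const measurable_xp
    have h1 : ENNReal.ofReal (ε ^ q) * volume {x | x ∈ S ∧ ε ≤ xp x}
        ≤ ENNReal.ofReal (ε ^ q) * ENNReal.ofReal (V / 8 * r ^ (d + 1)) := by
      calc ENNReal.ofReal (ε ^ q) * volume {x | x ∈ S ∧ ε ≤ xp x}
          = ∫⁻ x in {x | x ∈ S ∧ ε ≤ xp x}, ENNReal.ofReal (ε ^ q) := by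
            rw [setLIntegral_const]
        _ ≤ ∫⁻ x in {x | x ∈ S ∧ ε ≤ xp x}, ENNReal.ofReal (xp x) ^ q := by
            refine setLIntegral_mono' (hS.inter hm) fun x hx => ?_
            rw [ENNReal.ofReal_pow hε0.le]
            gcongr
            exact hx.2
        _ ≤ ∫⁻ x in S, ENNReal.ofReal (xp x) ^ q := lintegral_mono_set fun x hx => hx.1
        _ ≤ _ := hSq
        _ = _ := by
            rw [← ENNReal.ofReal_mul (by positivity)]
            congr 1
            rw [hε]; ring
    exact (ENNReal.mul_le_mul_iff_right (by simpa using by positivity) ENNReal.ofReal_ne_top).1 h1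
  calc 4 * volume S
      ≤ 4 * (ENNReal.ofReal (2 ^ d * ε) + ENNReal.ofReal (V / 8 * r ^ (d + 1))) := by
        gcongr
        refine (measure_mono hsplit).trans ((measure_union_le _ _).trans ?_)
        gcongr
        exact volume_slab_le ε
    _ = volume (ball (0 : Space d) r) := by
        rw [Measure.addHaar_ball _ _ hr.le, finrank_euclideanSpace_fin,
          ← ENNReal.ofReal_toReal hVt, ← hV, ← ENNReal.ofReal_add (by positivity) (by positivity),
          show (4 : ℝ≥0∞) = ENNReal.ofReal 4 by simp, ← ENNReal.ofReal_mul (by norm_num),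
          ← ENNReal.ofReal_mul (by positivity)]
        congr 1
        rw [hε, ha]
        field_simp
        ring

lemma measurableSet_halfBall (x₀ : Space d) (R : ℝ) : MeasurableSet (halfBall x₀ R) :=
  measurableSet_ball.inter (measurableSet_lt measurable_const (by fun_prop))

lemma convex_halfBall (x₀ : Space d) (R : ℝ) : Convex ℝ (halfBall x₀ R) :=
  (convex_ball x₀ R).inter
    (convex_halfSpace_gt (𝕜 := ℝ) (f := fun x : Space d => x (Fin.last d))
      ⟨fun _ _ => rfl, fun _ _ => rfl⟩ 0)

/-- A Poincaré inequality for functions vanishing on a set of positive measure. -/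
lemma weighted_poincare {v : Space d → ℝ} {K : NNReal} (hv : LipschitzWith K v)
    {Z : Set (Space d)} (hZ : MeasurableSet Z) (hZD : Z ⊆ halfBall 0 (1 / 2))
    (hvZ : ∀ x ∈ Z, v x = 0) :
    (∫⁻ x in Z, ENNReal.ofReal (xp x) ^ 2)
        * ∫⁻ x in halfBall 0 (1 / 2), ENNReal.ofReal (xp x) ^ 2 * ‖v x‖ₑ ^ 2
      ≤ 4 * volume (ball (0 : Space d) 1)
        * ∫⁻ x in halfBall 0 (1 / 2), ENNReal.ofReal (xp x) ^ 2 * ‖fderiv ℝ v x‖ₑ ^ 2 := by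
  set D : Set (Space d) := halfBall 0 (1 / 2) with hD
  have hDm : MeasurableSet D := measurableSet_halfBall _ _
  have hDc : Convex ℝ D := convex_halfBall _ _
  set ω : Space d → ℝ≥0∞ := fun x => ENNReal.ofReal (xp x) ^ 2 with hω
  have hωm : Measurable ω := measurable_xp.ennreal_ofReal.pow_const 2
  have hω1 : ∀ x ∈ D, ω x ≤ 1 := by
    intro x hx
    refine pow_le_one' ?_ 2
    rw [ENNReal.ofReal_le_one]
    refine (xp_le_norm x).trans ?_
    have := mem_ball_zero_iff.1 hx.1
    linarith
  have hvm : Measurable v := hv.continuous.measurable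
  set P := ∫⁻ x in D, ω x * ‖fderiv ℝ v x‖ₑ ^ 2 with hP
  have hDmm : Measurable (D.indicator (fun _ => (1 : ℝ≥0∞))) := measurable_const.indicator hDm
  -- Points `x` of the half ball and `y` of `Z` are compared through their midpoint. Each half
  -- segment is measured with the weight at its own endpoint, because along that half the weight
  -- cannot drop by more than a factor 4.
  set J : Space d → Space d → ℝ≥0∞ := fun x y =>
    (D.indicator (fun _ => 1) x * D.indicator (fun _ => 1) y * ω x)
      * ‖v (x + (1 / 2 : ℝ) • (y - x)) - v x‖ₑ ^ 2 with hJ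
  have hJm : Measurable (Function.uncurry J) := by
    refine Measurable.mul (((hDmm.comp measurable_fst).mul (hDmm.comp measurable_snd)).mul
      (hωm.comp measurable_fst)) (Measurable.pow_const (Measurable.enorm ?_) 2)
    exact (hvm.comp (by fun_prop)).sub (hvm.comp measurable_fst)
  have hJint : ∫⁻ x, ∫⁻ y, J x y ≤ volume (ball (0 : Space d) 1) * P := by
    have hW : ∀ w ∈ ball (0 : Space d) 1, ∫⁻ x, J x (x + w) ≤ P := by
      intro w hw
      have h := lintegral_increment_sq_le hv ((1 / 2 : ℝ) • w)
        (W := fun x => D.indicator (fun _ => 1) x * D.indicator (fun _ => 1) (x + w) * ω x)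
        (h := fun x => 4 * D.indicator (fun x => ω x * ‖fderiv ℝ v x‖ₑ ^ 2) x)
        (((hωm.mul ((measurable_fderiv ℝ v).enorm.pow_const 2)).indicator hDm).const_mul 4)
        (fun x s hs => ?_)
      · calc ∫⁻ x, J x (x + w) = ∫⁻ x, D.indicator (fun _ => 1) x
              * D.indicator (fun _ => 1) (x + w) * ω x
              * ‖v (x + (1 / 2 : ℝ) • w) - v x‖ₑ ^ 2 := by simp [hJ]
          _ ≤ _ := h
          _ = ‖(1 / 2 : ℝ) • w‖ₑ ^ 2 * (4 * P) := by
              rw [lintegral_const_mul, lintegral_indicator hDm]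
              exact (hωm.mul ((measurable_fderiv ℝ v).enorm.pow_const 2)).indicator hDm
          _ ≤ ENNReal.ofReal (1 / 4) * (4 * P) := by
              gcongr
              rw [← ofReal_norm, ← ENNReal.ofReal_pow (norm_nonneg _)]
              refine ENNReal.ofReal_le_ofReal ?_
              have h1 := mem_ball_zero_iff.1 hw
              rw [norm_smul]
              norm_num
              nlinarith [norm_nonneg w]
          _ = P := by
              rw [← mul_assoc, show (4 : ℝ≥0∞) = ENNReal.ofReal 4 by simp,
                ← ENNReal.ofReal_mul (by norm_num)]
              norm_num
      · by_cases hx : x ∈ D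
        · by_cases hy : x + w ∈ D
          · have hmem : x + s • ((1 / 2 : ℝ) • w) ∈ D := by
              have := hDc.add_smul_sub_mem hx hy (t := s * (1 / 2))
                ⟨by linarith [hs.1], by linarith [hs.2]⟩
              simpa [smul_smul] using this
            simp only [hx, hy, hmem, indicator_of_mem, one_mul]
            rw [← mul_assoc]
            gcongr
            -- On the first half of the segment from `x` to `x + w` at least half of the height of
            -- `x` is kept, since the other endpoint also has positive height. The resulting factor
            -- 4 is cancelled by the square of the length of the half segment.
            have h1 : xp x ≤ 2 * xp (x + s • ((1 / 2 : ℝ) • w)) := by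
              have hx0 : 0 < x (Fin.last d) := hx.2
              have hy0 : 0 < (x + w) (Fin.last d) := hy.2
              have hm0 : 0 < (x + s • ((1 / 2 : ℝ) • w)) (Fin.last d) := hmem.2
              simp only [xp, max_eq_left hx0.le, max_eq_left hm0.le]
              simp only [PiLp.add_apply, PiLp.smul_apply, smul_eq_mul] at hy0 ⊢
              nlinarith [hs.1, hs.2]
            simp only [hω]
            calc ENNReal.ofReal (xp x) ^ 2
                ≤ ENNReal.ofReal (2 * xp (x + s • ((1 / 2 : ℝ) • w))) ^ 2 := by gcongr
              _ = _ := by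
                  rw [ENNReal.ofReal_mul zero_le_two, mul_pow]
                  norm_num
          · simp [hy]
        · simp [hx]
    calc ∫⁻ x, ∫⁻ y, J x y = ∫⁻ x, ∫⁻ w, J x (x + w) := by
          congr 1; ext x
          exact (lintegral_add_left_eq_self (J x) x).symm
      _ = ∫⁻ w, ∫⁻ x, J x (x + w) := by
          rw [lintegral_lintegral_swap]
          exact (hJm.comp (f := fun p : Space d × Space d => (p.1, p.1 + p.2))
            (by fun_prop)).aemeasurable
      _ = ∫⁻ w in ball (0 : Space d) 1, ∫⁻ x, J x (x + w) := by
          rw [← lintegral_indicator measurableSet_ball]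
          congr 1; ext w
          by_cases hw : w ∈ ball (0 : Space d) 1
          · simp [hw]
          · rw [indicator_of_notMem hw]
            have : ∀ x, J x (x + w) = 0 := by
              intro x
              by_cases hx : x ∈ D
              · by_cases hy : x + w ∈ D
                · exfalso
                  refine hw (mem_ball_zero_iff.2 ?_)
                  have h1 := mem_ball_zero_iff.1 hx.1
                  have h2 := mem_ball_zero_iff.1 hy.1
                  have : ‖w‖ ≤ ‖x + w‖ + ‖x‖ := by
                    simpa using norm_sub_le (x + w) x
                  linarith
                · simp [hJ, hy]
              · simp [hJ, hx]
            simp [this]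
      _ ≤ ∫⁻ w in ball (0 : Space d) 1, P := setLIntegral_mono' measurableSet_ball hW
      _ = _ := by rw [setLIntegral_const, mul_comm]
  -- Since `v y = 0`, the value `v x` is the sum of the increments over the two halves. In each term
  -- the weight at the far endpoint is bounded by 1.
  have hpt : ∀ y x, (Z.indicator ω y) * D.indicator (fun x => ω x * ‖v x‖ₑ ^ 2) x
      ≤ 2 * J x y + 2 * J y x := by
    intro y x
    by_cases hy : y ∈ Z
    · by_cases hx : x ∈ D
      · have hyD := hZD hy
        simp only [hJ, hx, hy, hyD, indicator_of_mem, one_mul]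
        have hmid : y + (1 / 2 : ℝ) • (x - y) = x + (1 / 2 : ℝ) • (y - x) := by
          module
        rw [hmid, hvZ y hy, sub_zero]
        set m := v (x + (1 / 2 : ℝ) • (y - x))
        have h1 : ‖v x‖ₑ ^ 2 ≤ 2 * ‖m - v x‖ₑ ^ 2 + 2 * ‖m‖ₑ ^ 2 := by
          have := enorm_add_sq_le (-(m - v x)) m
          rw [enorm_neg] at this
          simpa using this
        calc ω y * (ω x * ‖v x‖ₑ ^ 2)
            ≤ ω y * (ω x * (2 * ‖m - v x‖ₑ ^ 2 + 2 * ‖m‖ₑ ^ 2)) := by gcongr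
          _ = ω y * (2 * (ω x * ‖m - v x‖ₑ ^ 2)) + ω x * (2 * (ω y * ‖m‖ₑ ^ 2)) := by ring
          _ ≤ 1 * (2 * (ω x * ‖m - v x‖ₑ ^ 2)) + 1 * (2 * (ω y * ‖m‖ₑ ^ 2)) := by
              gcongr
              · exact hω1 y hyD
              · exact hω1 x hx
          _ = _ := by rw [one_mul, one_mul]
      · simp [hx]
    · simp [hy]
  have hmv : Measurable (D.indicator (fun x => ω x * ‖v x‖ₑ ^ 2)) :=
    (hωm.mul (hvm.enorm.pow_const 2)).indicator hDm
  calc (∫⁻ x in Z, ω x) * ∫⁻ x in D, ω x * ‖v x‖ₑ ^ 2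
      = ∫⁻ y, ∫⁻ x, (Z.indicator ω y) * D.indicator (fun x => ω x * ‖v x‖ₑ ^ 2) x := by
        simp_rw [lintegral_const_mul _ hmv]
        rw [lintegral_mul_const _ (hωm.indicator hZ), lintegral_indicator hZ,
          lintegral_indicator hDm]
    _ ≤ ∫⁻ y, ∫⁻ x, (2 * J x y + 2 * J y x) :=
        lintegral_mono fun y => lintegral_mono fun x => hpt y x
    _ = 2 * (∫⁻ y, ∫⁻ x, J x y) + 2 * ∫⁻ y, ∫⁻ x, J y x := by
        have h1 : ∀ y, Measurable fun x => J x y := fun y =>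
          hJm.comp (f := fun x => (x, y)) (by fun_prop)
        have h2 : ∀ y, Measurable fun x => J y x := fun y =>
          hJm.comp (f := fun x => (y, x)) (by fun_prop)
        have h3 : Measurable fun y => ∫⁻ x, J x y :=
          Measurable.lintegral_prod_left' (f := Function.uncurry J) hJm
        have h4 : Measurable fun y => ∫⁻ x, J y x :=
          Measurable.lintegral_prod_right' (f := Function.uncurry J) hJm
        have : ∀ y, ∫⁻ x, (2 * J x y + 2 * J y x)
            = 2 * (∫⁻ x, J x y) + 2 * ∫⁻ x, J y x := fun y => by
          rw [lintegral_add_left ((h1 y).const_mul 2), lintegral_const_mul _ (h1 y),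
            lintegral_const_mul _ (h2 y)]
        simp_rw [this]
        rw [lintegral_add_left (h3.const_mul 2), lintegral_const_mul _ h3,
          lintegral_const_mul _ h4]
    _ = 4 * ∫⁻ x, ∫⁻ y, J x y := by
        rw [lintegral_lintegral_swap (f := fun y x => J x y)
          (hJm.comp (f := Prod.swap) measurable_swap).aemeasurable]
        ring
    _ ≤ 4 * (volume (ball (0 : Space d) 1) * P) := by gcongr
    _ = _ := by rw [mul_assoc]

/-! ### Calculus for Lipschitz functions on space-time -/

/-- The spatial gradient of a function of `(x, t)`. -/
def sg (f : Space d × ℝ → ℝ) (z : Space d × ℝ) : Space d :=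
  WithLp.toLp 2 fun i => fderiv ℝ f z (EuclideanSpace.single i 1, 0)

/-- The time derivative of a function of `(x, t)`, through the total derivative. -/
def td (f : Space d × ℝ → ℝ) (z : Space d × ℝ) : ℝ := fderiv ℝ f z (0, 1)

/-- `matForm` on Euclidean vectors. -/
def bil (B : Matrix (Fin (d + 1)) (Fin (d + 1)) ℝ) (ξ η : Space d) : ℝ :=
  matForm B (fun i => ξ i) (fun i => η i)

lemma bil_add_right (B : Matrix (Fin (d + 1)) (Fin (d + 1)) ℝ) (ξ η ζ : Space d) :
    bil B ξ (η + ζ) = bil B ξ η + bil B ξ ζ := by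
  simp [bil, matForm, mul_add, Finset.sum_add_distrib]

lemma bil_smul_right (B : Matrix (Fin (d + 1)) (Fin (d + 1)) ℝ) (a : ℝ) (ξ η : Space d) :
    bil B ξ (a • η) = a * bil B ξ η := by
  simp only [bil, matForm, PiLp.smul_apply, smul_eq_mul, Finset.mul_sum]
  exact Finset.sum_congr rfl fun i _ => Finset.sum_congr rfl fun j _ => by ring

lemma bil_smul_left (B : Matrix (Fin (d + 1)) (Fin (d + 1)) ℝ) (a : ℝ) (ξ η : Space d) :
    bil B (a • ξ) η = a * bil B ξ η := by
  simp only [bil, matForm, PiLp.smul_apply, smul_eq_mul, Finset.mul_sum]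
  exact Finset.sum_congr rfl fun i _ => Finset.sum_congr rfl fun j _ => by ring

lemma bil_smul_matrix (B : Matrix (Fin (d + 1)) (Fin (d + 1)) ℝ) (a : ℝ) (ξ η : Space d) :
    bil (a • B) ξ η = a * bil B ξ η := by
  simp only [bil, matForm, Matrix.smul_apply, smul_eq_mul, Finset.mul_sum]
  exact Finset.sum_congr rfl fun i _ => Finset.sum_congr rfl fun j _ => by ring

lemma fderiv_space_eq_inner (f : Space d × ℝ → ℝ) (z : Space d × ℝ) (v : Space d) :
    fderiv ℝ f z (v, 0) = inner ℝ (sg f z) v := by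
  have hv : (v, (0 : ℝ)) = ∑ i, v i • ((EuclideanSpace.single i (1 : ℝ) : Space d), (0 : ℝ)) := by
    ext1
    · simp only [Prod.fst_sum, Prod.smul_fst]
      ext j
      simp [Finset.sum_apply, Pi.single_apply]
    · simp [Prod.snd_sum]
  rw [hv, map_sum]
  simp_rw [map_smul]
  simp [sg, PiLp.inner_apply]

/-- The derivative is evaluated on the gradient itself: in the sup norm of the product `(sg f z, 0)`
has length `‖sg f z‖`, whence `‖sg f z‖ ^ 2 ≤ K ‖sg f z‖`. -/
lemma norm_sg_le {f : Space d × ℝ → ℝ} {K : NNReal} (hf : LipschitzWith K f)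
    (z : Space d × ℝ) : ‖sg f z‖ ≤ K := by
  have h1 : ‖sg f z‖ ^ 2 ≤ K * ‖sg f z‖ := by
    rw [← real_inner_self_eq_norm_sq, ← fderiv_space_eq_inner]
    refine (le_abs_self _).trans (((fderiv ℝ f z).le_opNorm _).trans ?_)
    rw [Prod.norm_mk, norm_zero, max_eq_left (norm_nonneg _)]
    gcongr
    exact norm_fderiv_le_of_lipschitz ℝ hf
  by_contra h
  push Not at h
  have : 0 < ‖sg f z‖ := K.2.trans_lt h
  nlinarith

lemma abs_td_le {f : Space d × ℝ → ℝ} {K : NNReal} (hf : LipschitzWith K f)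
    (z : Space d × ℝ) : |td f z| ≤ K := by
  refine ((fderiv ℝ f z).le_opNorm _).trans ?_
  simpa [Prod.norm_mk] using norm_fderiv_le_of_lipschitz ℝ hf (x₀ := z)

@[fun_prop]
lemma measurable_sg (f : Space d × ℝ → ℝ) : Measurable (sg f) := by
  refine (WithLp.measurable_toLp 2 _).comp (measurable_pi_lambda _ fun i => ?_)
  exact measurable_fderiv_apply_const ℝ f _

@[fun_prop]
lemma measurable_td (f : Space d × ℝ → ℝ) : Measurable (td f) :=
  measurable_fderiv_apply_const ℝ f _

lemma sg_mul {f g : Space d × ℝ → ℝ} {z : Space d × ℝ} (hf : DifferentiableAt ℝ f z)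
    (hg : DifferentiableAt ℝ g z) :
    sg (fun y => f y * g y) z = f z • sg g z + g z • sg f z := by
  ext i
  simp [sg, fderiv_fun_mul hf hg]

lemma sg_congr {f g : Space d × ℝ → ℝ} {z : Space d × ℝ} (h : f =ᶠ[𝓝 z] g) :
    sg f z = sg g z := by
  simp [sg, h.fderiv_eq]

lemma sg_comp {f : Space d × ℝ → ℝ} {ψ : ℝ → ℝ} {ψ' : ℝ} {z : Space d × ℝ}
    (hf : DifferentiableAt ℝ f z) (hψ : HasDerivAt ψ ψ' (f z)) :
    sg (fun y => ψ (f y)) z = ψ' • sg f z := by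
  have h := (hψ.comp_hasFDerivAt z hf.hasFDerivAt).fderiv
  simp only [Function.comp_def] at h
  ext i
  simp [sg, h]

lemma td_comp {f : Space d × ℝ → ℝ} {ψ : ℝ → ℝ} {ψ' : ℝ} {z : Space d × ℝ}
    (hf : DifferentiableAt ℝ f z) (hψ : HasDerivAt ψ ψ' (f z)) :
    td (fun y => ψ (f y)) z = ψ' * td f z := by
  have h := (hψ.comp_hasFDerivAt z hf.hasFDerivAt).fderiv
  simp only [Function.comp_def] at h
  simp [td, h]

lemma hasFDerivAt_slice_space {f : Space d × ℝ → ℝ} {x : Space d} {t : ℝ}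
    (hf : DifferentiableAt ℝ f (x, t)) : HasFDerivAt (fun y => f (y, t))
      ((fderiv ℝ f (x, t)).comp (ContinuousLinearMap.inl ℝ (Space d) ℝ)) x :=
  hf.hasFDerivAt.comp x (hasFDerivAt_prodMk_left x t)

lemma hasDerivAt_slice_time {f : Space d × ℝ → ℝ} {x : Space d} {t : ℝ}
    (hf : DifferentiableAt ℝ f (x, t)) : HasDerivAt (fun s => f (x, s)) (td f (x, t)) t := by
  have h := hf.hasFDerivAt.comp t (hasFDerivAt_prodMk_right x t)
  have h' := h.hasDerivAt
  simp only [ContinuousLinearMap.comp_apply, ContinuousLinearMap.inr_apply] at h'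
  exact h'

lemma norm_fderiv_slice_le {f : Space d × ℝ → ℝ} {x : Space d} {t : ℝ}
    (hf : DifferentiableAt ℝ f (x, t)) : ‖fderiv ℝ (fun y => f (y, t)) x‖ ≤ ‖sg f (x, t)‖ := by
  rw [(hasFDerivAt_slice_space hf).fderiv]
  refine ContinuousLinearMap.opNorm_le_bound _ (norm_nonneg _) fun v => ?_
  simp only [ContinuousLinearMap.comp_apply, ContinuousLinearMap.inl_apply, fderiv_space_eq_inner]
  exact abs_real_inner_le_norm _ _

lemma lipschitzWith_slice_space {f : Space d × ℝ → ℝ} {K : NNReal} (hf : LipschitzWith K f)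
    (t : ℝ) : LipschitzWith K fun x => f (x, t) := by
  simpa [Function.comp_def] using hf.comp (LipschitzWith.prodMk_right t)

lemma lipschitzWith_slice_time {f : Space d × ℝ → ℝ} {K : NNReal} (hf : LipschitzWith K f)
    (x : Space d) : LipschitzWith K fun t => f (x, t) := by
  simpa [Function.comp_def] using hf.comp (LipschitzWith.prodMk_left x)

lemma ae_ae_differentiableAt {f : Space d × ℝ → ℝ} {K : NNReal} (hf : LipschitzWith K f) :
    ∀ᵐ x : Space d, ∀ᵐ t : ℝ, DifferentiableAt ℝ f (x, t) :=
  Measure.ae_ae_of_ae_prod (hf.ae_differentiableAt (μ := volume))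

lemma ae_ae_differentiableAt' {f : Space d × ℝ → ℝ} {K : NNReal} (hf : LipschitzWith K f) :
    ∀ᵐ t : ℝ, ∀ᵐ x : Space d, DifferentiableAt ℝ f (x, t) := by
  rw [← Measure.ae_ae_comm (p := fun x t => DifferentiableAt ℝ f (x, t))
    (measurableSet_of_differentiableAt ℝ f)]
  exact ae_ae_differentiableAt hf

/-- The fundamental theorem of calculus in time. -/
lemma ae_integral_td {f : Space d × ℝ → ℝ} {K : NNReal} (hf : LipschitzWith K f)
    {t₁ t₂ : ℝ} (h12 : t₁ ≤ t₂) :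
    ∀ᵐ x : Space d, ∫ t in Ioc t₁ t₂, td f (x, t) = f (x, t₂) - f (x, t₁) := by
  filter_upwards [ae_ae_differentiableAt hf] with x hx
  have hac : AbsolutelyContinuousOnInterval (fun t => f (x, t)) t₁ t₂ :=
    ((lipschitzWith_slice_time hf x).lipschitzOnWith
      (s := uIcc t₁ t₂)).absolutelyContinuousOnInterval
  rw [← hac.integral_deriv_eq_sub, intervalIntegral.integral_of_le h12]
  refine setIntegral_congr_ae measurableSet_Ioc ?_
  filter_upwards [hx] with t ht _
  exact (hasDerivAt_slice_time ht).deriv.symm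

/-! ### Normalized solutions and the energy inequality -/

/-- A solution with values in `[0, 1]` of `g c(u) ∂ₜu = div (b ∇u)` in `B_1^+ × (-1, 0]`, where
`g` and `b` degenerate on `{xp = 0}`. The equation is tested with Lipschitz functions that need
not vanish on `{xp = 0}`. -/
structure Sol (L : ℝ) (q : ℕ) (g : Space d → ℝ)
    (b : Space d → Matrix (Fin (d + 1)) (Fin (d + 1)) ℝ) (c : ℝ → ℝ) (u : Space d × ℝ → ℝ) :
    Prop where
  one_le : 1 ≤ L
  g_meas : AEMeasurable g
  g_lower : ∀ x ∈ ball (0 : Space d) 1, L⁻¹ * xp x ^ q ≤ g x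
  g_upper : ∀ x ∈ ball (0 : Space d) 1, g x ≤ L * xp x ^ 2
  b_meas : ∀ i j, AEMeasurable (fun x => b x i j)
  b_lower : ∀ x ∈ ball (0 : Space d) 1, ∀ ξ, L⁻¹ * xp x ^ 2 * ‖ξ‖ ^ 2 ≤ bil (b x) ξ ξ
  b_upper : ∀ x ∈ ball (0 : Space d) 1, ∀ ξ η, |bil (b x) ξ η| ≤ L * xp x ^ 2 * ‖ξ‖ * ‖η‖
  c_cont : Continuous c
  c_lower : ∀ s, L⁻¹ ≤ c s
  c_upper : ∀ s, c s ≤ L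
  lip : ∃ K, LipschitzWith K u
  nonneg : ∀ z, 0 ≤ u z
  le_one : ∀ z, u z ≤ 1
  eqn : ∀ φ : Space d × ℝ → ℝ, (∃ K, LipschitzWith K φ) → ∀ ρ < 1,
    (∀ x t, ρ ≤ ‖x‖ → φ (x, t) = 0) → ∀ t₁ t₂, -1 ≤ t₁ → t₁ ≤ t₂ → t₂ ≤ 0 →
    ∫ z in ball (0 : Space d) 1 ×ˢ Ioc t₁ t₂,
      (g z.1 * c (u z) * td u z * φ z + bil (b z.1) (sg u z) (sg φ z)) = 0

lemma volume_cyl_ne_top (t₁ t₂ : ℝ) : volume (ball (0 : Space d) 1 ×ˢ Ioc t₁ t₂) ≠ ∞ := by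
  rw [Measure.volume_eq_prod, Measure.prod_prod]
  exact ENNReal.mul_ne_top measure_ball_lt_top.ne measure_Ioc_lt_top.ne

lemma measurableSet_cyl (t₁ t₂ : ℝ) : MeasurableSet (ball (0 : Space d) 1 ×ˢ Ioc t₁ t₂) :=
  measurableSet_ball.prod measurableSet_Ioc

lemma integrableOn_cyl {f : Space d × ℝ → ℝ} {t₁ t₂ : ℝ} (hf : AEStronglyMeasurable f) (C : ℝ)
    (hC : ∀ z : Space d × ℝ, z.1 ∈ ball (0 : Space d) 1 → |f z| ≤ C) :
    IntegrableOn f (ball (0 : Space d) 1 ×ˢ Ioc t₁ t₂) :=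
  Measure.integrableOn_of_bounded (volume_cyl_ne_top t₁ t₂) hf
    ((ae_restrict_iff' (measurableSet_cyl t₁ t₂)).2 (Eventually.of_forall fun z hz => hC z hz.1))

lemma xp_le_one {x : Space d} (hx : x ∈ ball (0 : Space d) 1) : xp x ≤ 1 :=
  (xp_le_norm x).trans (mem_ball_zero_iff.1 hx).le

lemma aemeasurable_bil {α : Type*} [MeasurableSpace α] {μ : Measure α}
    {B : α → Matrix (Fin (d + 1)) (Fin (d + 1)) ℝ} {ξ η : α → Space d}
    (hB : ∀ i j, AEMeasurable (fun a => B a i j) μ) (hξ : Measurable ξ) (hη : Measurable η) :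
    AEMeasurable (fun a => bil (B a) (ξ a) (η a)) μ := by
  unfold bil matForm
  refine Finset.aemeasurable_fun_sum _ fun i _ => Finset.aemeasurable_fun_sum _ fun j _ => ?_
  exact ((hB i j).mul (by fun_prop)).mul (by fun_prop)

namespace Sol

variable {L : ℝ} {q : ℕ} {g : Space d → ℝ} {b : Space d → Matrix (Fin (d + 1)) (Fin (d + 1)) ℝ}
  {c : ℝ → ℝ} {u : Space d × ℝ → ℝ}

lemma L_pos (h : Sol L q g b c u) : 0 < L := one_pos.trans_le h.one_le

lemma g_nonneg (h : Sol L q g b c u) {x : Space d} (hx : x ∈ ball (0 : Space d) 1) : 0 ≤ g x :=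
  (mul_nonneg (inv_nonneg.2 h.L_pos.le) (pow_nonneg (xp_nonneg x) _)).trans (h.g_lower x hx)

lemma g_le (h : Sol L q g b c u) {x : Space d} (hx : x ∈ ball (0 : Space d) 1) : g x ≤ L := by
  refine (h.g_upper x hx).trans (mul_le_of_le_one_right h.L_pos.le ?_)
  exact pow_le_one₀ (xp_nonneg x) (xp_le_one hx)

lemma abs_g_le (h : Sol L q g b c u) {x : Space d} (hx : x ∈ ball (0 : Space d) 1) : |g x| ≤ L := by
  rw [abs_of_nonneg (h.g_nonneg hx)]
  exact h.g_le hx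

lemma c_nonneg (h : Sol L q g b c u) (s : ℝ) : 0 ≤ c s :=
  (inv_nonneg.2 h.L_pos.le).trans (h.c_lower s)

lemma measurable_u (h : Sol L q g b c u) : Measurable u := by
  obtain ⟨K, hK⟩ := h.lip
  exact hK.continuous.measurable

lemma mem_Icc (h : Sol L q g b c u) (z : Space d × ℝ) : u z ∈ Icc (0 : ℝ) 1 :=
  ⟨h.nonneg z, h.le_one z⟩

lemma g_meas_fst (h : Sol L q g b c u) : AEMeasurable (fun z : Space d × ℝ => g z.1) :=
  h.g_meas.comp_fst

/-- The energy inequality for a test function `η² ψ(u)`, where `ψ` is decreasing. -/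
lemma energy (h : Sol L q g b c u) {η : Space d → ℝ} {Kη : NNReal} (hη : LipschitzWith Kη η)
    (hη0 : ∀ x, 0 ≤ η x) (hη1 : ∀ x, η x ≤ 1) {ρ : ℝ} (hρ : ρ < 1)
    (hηρ : ∀ x, ρ ≤ ‖x‖ → η x = 0) {ψ θ ω : ℝ → ℝ} (hψ : Continuous ψ) (hθ : Measurable θ)
    (hω : Measurable ω) {Kψ : NNReal} (hψu : LipschitzWith Kψ fun z => ψ (u z)) {C : ℝ}
    (hψC : ∀ s ∈ Icc (0 : ℝ) 1, |ψ s| ≤ C) (hθC : ∀ s ∈ Icc (0 : ℝ) 1, |θ s| ≤ C)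
    (hωC : ∀ s ∈ Icc (0 : ℝ) 1, |ω s| ≤ C) (hψω : ∀ s ∈ Icc (0 : ℝ) 1, ψ s = ω s * θ s)
    (hgrad : ∀ᵐ z, sg (fun y => ψ (u y)) z = (-(θ (u z) ^ 2)) • sg u z)
    {t₁ t₂ : ℝ} (ht₁ : -1 ≤ t₁) (h12 : t₁ ≤ t₂) (ht₂ : t₂ ≤ 0) :
    ∫ x in ball (0 : Space d) 1, g x * η x ^ 2 * ∫ s in u (x, t₂)..1, c s * ψ s
      ≤ (∫ x in ball (0 : Space d) 1, g x * η x ^ 2 * ∫ s in u (x, t₁)..1, c s * ψ s)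
      - 1 / (2 * L) * (∫ z in ball (0 : Space d) 1 ×ˢ Ioc t₁ t₂,
          xp z.1 ^ 2 * η z.1 ^ 2 * (θ (u z) ^ 2 * ‖sg u z‖ ^ 2))
      + 2 * L ^ 3 * Kη ^ 2 * ∫ z in ball (0 : Space d) 1 ×ˢ Ioc t₁ t₂,
          (ball (0 : Space d) ρ).indicator (fun _ => 1) z.1 * (xp z.1 ^ 2 * ω (u z) ^ 2) := by
  obtain ⟨Ku, hKu⟩ := h.lip
  have hL := h.L_pos
  have hC0 : 0 ≤ C := (abs_nonneg _).trans (hψC 0 ⟨le_rfl, zero_le_one⟩)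
  have hum := h.measurable_u
  set φ : Space d × ℝ → ℝ := fun z => η z.1 ^ 2 * ψ (u z) with hφ
  have hηX : LipschitzWith Kη fun z : Space d × ℝ => η z.1 := by
    simpa [Function.comp_def] using hη.comp LipschitzWith.prod_fst
  have hηabs : ∀ x, |η x| ≤ 1 := fun x => by rw [abs_of_nonneg (hη0 x)]; exact hη1 x
  have hη2 : LipschitzWith (1 * Kη + 1 * Kη) fun z : Space d × ℝ => η z.1 ^ 2 := by
    have := lipschitzWith_mul_of_bounded hηX hηX 1 1 (fun z => by simpa using hηabs z.1)
      (fun z => by simpa using hηabs z.1)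
    simpa [sq] using this
  have hη2abs : ∀ x, |η x ^ 2| ≤ 1 := fun x => by
    rw [abs_pow]; exact pow_le_one₀ (abs_nonneg _) (hηabs x)
  have hφL := lipschitzWith_mul_of_bounded hη2 hψu 1 ⟨C, hC0⟩
    (fun z => by simpa using hη2abs z.1) (fun z => hψC _ (h.mem_Icc z))
  obtain ⟨Kφ, hφL⟩ : ∃ K, LipschitzWith K φ := ⟨_, hφL⟩
  have heq := h.eqn φ ⟨_, hφL⟩ ρ hρ (fun x t hx => by simp [hφ, hηρ x hx]) t₁ t₂ ht₁ h12 ht₂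
  -- the primitive
  set Ψ : ℝ → ℝ := fun s => ∫ τ in s..1, c τ * ψ τ with hΨ
  have hcψ : Continuous fun τ => c τ * ψ τ := h.c_cont.mul hψ
  have hΨd : ∀ s, HasDerivAt Ψ (-(c s * ψ s)) s := fun s =>
    intervalIntegral.integral_hasDerivAt_left (hcψ.intervalIntegrable _ _)
      (hcψ.stronglyMeasurableAtFilter _ _) hcψ.continuousAt
  have hΨc : Continuous Ψ := continuous_iff_continuousAt.2 fun s => (hΨd s).continuousAt
  have hcabs : ∀ s, |c s| ≤ L := fun s => by
    rw [abs_of_nonneg (h.c_nonneg s)]; exact h.c_upper s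
  have hΨL : LipschitzOnWith (L * C).toNNReal Ψ (Icc 0 1) := by
    refine (convex_Icc (0 : ℝ) 1).lipschitzOnWith_of_nnnorm_hasDerivWithin_le
      (fun s _ => (hΨd s).hasDerivWithinAt) fun s hs => ?_
    rw [← NNReal.coe_le_coe, coe_nnnorm, norm_neg, norm_mul, Real.coe_toNNReal _ (by positivity)]
    exact mul_le_mul (hcabs s) (hψC s hs) (abs_nonneg _) hL.le
  have hΨu : LipschitzWith ((L * C).toNNReal * Ku) fun z => Ψ (u z) := by
    rw [← lipschitzOnWith_univ] at hKu ⊢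
    exact hΨL.comp hKu fun z _ => h.mem_Icc z
  obtain ⟨CΨ, hCΨ⟩ : ∃ CΨ, ∀ s ∈ Icc (0 : ℝ) 1, |Ψ s| ≤ CΨ :=
    isCompact_Icc.exists_bound_of_continuousOn hΨc.continuousOn
  set B : Set (Space d × ℝ) := ball (0 : Space d) 1 ×ˢ Ioc t₁ t₂ with hB
  have hBm : MeasurableSet B := measurableSet_cyl t₁ t₂
  have hgm := h.g_meas_fst
  have hηm : Measurable η := hη.continuous.measurable
  -- integrability
  have hi1 : IntegrableOn (fun z => g z.1 * c (u z) * td u z * φ z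
      + bil (b z.1) (sg u z) (sg φ z)) B := by
    refine integrableOn_cyl (AEMeasurable.aestronglyMeasurable ?_)
      (L * L * Ku * C + L * 1 ^ 2 * Ku * Kφ) (fun z hz => ?_)
    · refine AEMeasurable.add (((hgm.mul (h.c_cont.measurable.comp hum).aemeasurable).mul
        (measurable_td u).aemeasurable).mul hφL.continuous.aemeasurable) ?_
      exact aemeasurable_bil (fun i j => (h.b_meas i j).comp_fst) (measurable_sg u)
        (measurable_sg φ)
    · refine (abs_add_le _ _).trans (add_le_add ?_ ?_)
      · rw [abs_mul, abs_mul, abs_mul]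
        have hφC : |φ z| ≤ C := by
          rw [hφ, abs_mul]
          calc _ ≤ 1 * C := mul_le_mul (hη2abs _) (hψC _ (h.mem_Icc z)) (abs_nonneg _) zero_le_one
            _ = C := one_mul C
        gcongr
        · exact h.abs_g_le hz
        · exact hcabs _
        · exact abs_td_le hKu z
      · refine (h.b_upper _ hz _ _).trans ?_
        gcongr
        · exact xp_nonneg _
        · exact xp_le_one hz
        · exact norm_sg_le hKu z
        · exact norm_sg_le hφL z
  have hi2 : IntegrableOn (fun z => -(g z.1 * η z.1 ^ 2 * td (fun y => Ψ (u y)) z)) B := by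
    refine (integrableOn_cyl (AEMeasurable.aestronglyMeasurable ?_)
      (L * 1 * ((L * C).toNNReal * Ku : NNReal)) (fun z hz => ?_)).neg
    · exact (hgm.mul ((hηm.comp measurable_fst).pow_const 2).aemeasurable).mul
        (measurable_td _).aemeasurable
    · rw [abs_mul, abs_mul]
      gcongr
      · exact h.abs_g_le hz
      · exact hη2abs _
      · exact abs_td_le hΨu z
  have hi3 : IntegrableOn (fun z => xp z.1 ^ 2 * η z.1 ^ 2 * (θ (u z) ^ 2 * ‖sg u z‖ ^ 2)) B := by
    refine integrableOn_cyl (Measurable.aestronglyMeasurable ?_)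
      (1 ^ 2 * 1 * (C ^ 2 * Ku ^ 2)) (fun z hz => ?_)
    · exact (((measurable_xp.comp measurable_fst).pow_const 2).mul
        ((hηm.comp measurable_fst).pow_const 2)).mul
        (((hθ.comp hum).pow_const 2).mul ((measurable_sg u).norm.pow_const 2))
    · rw [abs_mul, abs_mul, abs_mul, abs_pow, abs_pow (θ _), abs_pow ‖_‖, abs_norm,
        abs_of_nonneg (xp_nonneg _)]
      gcongr
      · exact xp_nonneg _
      · exact xp_le_one hz
      · exact hη2abs _
      · exact hθC _ (h.mem_Icc z)
      · exact norm_sg_le hKu z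
  have hi4 : IntegrableOn (fun z : Space d × ℝ =>
      (ball (0 : Space d) ρ).indicator (fun _ => (1 : ℝ)) z.1 * (xp z.1 ^ 2 * ω (u z) ^ 2)) B := by
    refine integrableOn_cyl (Measurable.aestronglyMeasurable ?_)
      (1 * (1 ^ 2 * C ^ 2)) (fun z hz => ?_)
    · exact ((measurable_const.indicator measurableSet_ball).comp measurable_fst).mul
        (((measurable_xp.comp measurable_fst).pow_const 2).mul ((hω.comp hum).pow_const 2))
    · rw [abs_mul, abs_mul, abs_pow, abs_pow (ω _), abs_of_nonneg (xp_nonneg _)]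
      gcongr
      · by_cases hzρ : z.1 ∈ ball (0 : Space d) ρ <;> simp [hzρ]
      · exact xp_nonneg _
      · exact xp_le_one hz
      · exact hωC _ (h.mem_Icc z)
  -- the pointwise inequality
  have hpt : ∀ᵐ z ∂(volume.restrict B), g z.1 * c (u z) * td u z * φ z
      + bil (b z.1) (sg u z) (sg φ z)
      ≤ (-(g z.1 * η z.1 ^ 2 * td (fun y => Ψ (u y)) z)
        - 1 / (2 * L) * (xp z.1 ^ 2 * η z.1 ^ 2 * (θ (u z) ^ 2 * ‖sg u z‖ ^ 2)))
        + 2 * L ^ 3 * Kη ^ 2 * ((ball (0 : Space d) ρ).indicator (fun _ => (1 : ℝ)) z.1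
          * (xp z.1 ^ 2 * ω (u z) ^ 2)) := by
    rw [ae_restrict_iff' hBm]
    filter_upwards [hgrad, hKu.ae_differentiableAt (μ := volume),
      hψu.ae_differentiableAt (μ := volume), hηX.ae_differentiableAt (μ := volume)]
      with z hz hdu hdψ hdη hzB
    have hzb : z.1 ∈ ball (0 : Space d) 1 := hzB.1
    rw [td_comp hdu (hΨd (u z))]
    have hsgφ : sg φ z = (2 * η z.1 * ψ (u z)) • sg (fun y : Space d × ℝ => η y.1) z
        + (-(η z.1 ^ 2 * θ (u z) ^ 2)) • sg u z := by
      have h1 : sg φ z = _ := sg_mul (f := fun y : Space d × ℝ => η y.1 * η y.1)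
        (g := fun y => ψ (u y)) (hdη.mul hdη) hdψ |> fun h => by
          simpa [hφ, sq] using h
      rw [h1, sg_mul hdη hdη, hz]
      module
    rw [hsgφ, bil_add_right, bil_smul_right, bil_smul_right]
    have hbu := h.b_upper _ hzb (sg u z) (sg (fun y : Space d × ℝ => η y.1) z)
    have hbl := h.b_lower _ hzb (sg u z)
    set X := bil (b z.1) (sg u z) (sg (fun y : Space d × ℝ => η y.1) z)
    set Y := bil (b z.1) (sg u z) (sg u z)
    set a := ‖sg u z‖
    have ha : 0 ≤ a := norm_nonneg _
    have hxp := xp_nonneg z.1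
    have hX : |X| ≤ L * xp z.1 ^ 2 * a * Kη :=
      hbu.trans (by gcongr; exact norm_sg_le hηX z)
    by_cases hzρ : z.1 ∈ ball (0 : Space d) ρ
    · rw [indicator_of_mem hzρ, one_mul]
      have e1 : 2 * η z.1 * ψ (u z) * X ≤ 2 * η z.1 * (|ω (u z)| * |θ (u z)|)
          * (L * xp z.1 ^ 2 * a * Kη) := by
        refine (le_abs_self _).trans ?_
        rw [hψω _ (h.mem_Icc z), abs_mul, abs_mul, abs_mul, abs_mul, abs_two,
          abs_of_nonneg (hη0 z.1)]
        have := hη0 z.1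
        gcongr
      have e2 : -(η z.1 ^ 2 * θ (u z) ^ 2) * Y
          ≤ -(η z.1 ^ 2 * θ (u z) ^ 2) * (L⁻¹ * xp z.1 ^ 2 * a ^ 2) := by
        have : 0 ≤ η z.1 ^ 2 * θ (u z) ^ 2 := by positivity
        nlinarith
      -- Completing the square: half of the dissipation absorbs the cross term created by `∇η`.
      -- Writing `ψ = ω θ` leaves a remainder that involves `ω` alone and no gradient of `u`.
      have e3 : 2 * η z.1 * (|ω (u z)| * |θ (u z)|) * (L * xp z.1 ^ 2 * a * Kη)
          + -(η z.1 ^ 2 * θ (u z) ^ 2) * (L⁻¹ * xp z.1 ^ 2 * a ^ 2)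
          + 1 / (2 * L) * (xp z.1 ^ 2 * η z.1 ^ 2 * (θ (u z) ^ 2 * a ^ 2))
          - 2 * L ^ 3 * Kη ^ 2 * (xp z.1 ^ 2 * ω (u z) ^ 2)
          = -(1 / (2 * L)) * xp z.1 ^ 2
            * (η z.1 * |θ (u z)| * a - 2 * L ^ 2 * Kη * |ω (u z)|) ^ 2 := by
        rw [← sq_abs (θ (u z)), ← sq_abs (ω (u z))]
        field_simp
        ring
      have e4 : -(1 / (2 * L)) * xp z.1 ^ 2
            * (η z.1 * |θ (u z)| * a - 2 * L ^ 2 * Kη * |ω (u z)|) ^ 2 ≤ 0 := by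
        have : 0 ≤ 1 / (2 * L) * xp z.1 ^ 2
            * (η z.1 * |θ (u z)| * a - 2 * L ^ 2 * Kη * |ω (u z)|) ^ 2 := by positivity
        linarith
      -- By `Ψ' = -c ψ` the time term is an exact time derivative, up to the factor `g η ^ 2`, which
      -- does not depend on time.
      have e5 : g z.1 * c (u z) * td u z * φ z
          = -(g z.1 * η z.1 ^ 2 * (-(c (u z) * ψ (u z)) * td u z)) := by
        simp only [hφ]; ring
      rw [e5]
      linarith
    · have hη0' : η z.1 = 0 := hηρ _ (by simpa using hzρ)
      simp [hφ, hη0', hzρ]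
  have hle := integral_mono_ae hi1
    ((hi2.sub (hi3.const_mul (1 / (2 * L)))).add (hi4.const_mul (2 * L ^ 3 * Kη ^ 2))) hpt
  rw [heq] at hle
  have hadd := integral_add (hi2.sub (hi3.const_mul (1 / (2 * L))))
    (hi4.const_mul (2 * L ^ 3 * Kη ^ 2))
  have hsub := integral_sub hi2 (hi3.const_mul (1 / (2 * L)))
  simp only [Pi.add_apply, Pi.sub_apply] at hle hadd hsub
  rw [hadd, hsub, integral_const_mul, integral_const_mul] at hle
  -- time integration
  have htime : ∫ z in B, -(g z.1 * η z.1 ^ 2 * td (fun y => Ψ (u y)) z)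
      = (∫ x in ball (0 : Space d) 1, g x * η x ^ 2 * Ψ (u (x, t₁)))
        - ∫ x in ball (0 : Space d) 1, g x * η x ^ 2 * Ψ (u (x, t₂)) := by
    have hslice : ∀ t, IntegrableOn (fun x => g x * η x ^ 2 * Ψ (u (x, t)))
        (ball (0 : Space d) 1) := by
      intro t
      refine Measure.integrableOn_of_bounded (M := L * 1 * CΨ) measure_ball_lt_top.ne
        (AEMeasurable.aestronglyMeasurable ?_)
        ((ae_restrict_iff' measurableSet_ball).2 (Eventually.of_forall fun x hx => ?_))
      · exact (h.g_meas.mul (hηm.pow_const 2).aemeasurable).mul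
          (hΨc.measurable.comp (hum.comp (by fun_prop))).aemeasurable
      · rw [norm_mul, norm_mul]
        gcongr
        · exact h.abs_g_le hx
        · exact hη2abs _
        · exact hCΨ _ (h.mem_Icc _)
    rw [← integral_sub (hslice t₁) (hslice t₂), hB]
    rw [Measure.volume_eq_prod, setIntegral_prod _ hi2]
    refine setIntegral_congr_ae measurableSet_ball ?_
    filter_upwards [ae_integral_td hΨu h12] with x hx _
    rw [integral_neg, integral_const_mul, hx]
    ring
  rw [htime] at hle
  linarith

end Sol

/-! ### Cutoffs, truncations and the Caccioppoli inequality -/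

/-- A radial cutoff function, equal to `1` for `‖x‖ ≤ r'` and to `0` for `r ≤ ‖x‖`. -/
def cutoff (r' r : ℝ) (x : Space d) : ℝ := max 0 (min 1 ((r - ‖x‖) / (r - r')))

lemma cutoff_nonneg (r' r : ℝ) (x : Space d) : 0 ≤ cutoff r' r x := le_max_left _ _

lemma cutoff_le_one (r' r : ℝ) (x : Space d) : cutoff r' r x ≤ 1 :=
  max_le zero_le_one (min_le_left _ _)

lemma cutoff_eq_one {r' r : ℝ} (h : r' < r) {x : Space d} (hx : ‖x‖ ≤ r') : cutoff r' r x = 1 := by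
  have : 1 ≤ (r - ‖x‖) / (r - r') := by rw [le_div_iff₀ (by linarith)]; linarith
  simp [cutoff, this]

lemma cutoff_eq_zero {r' r : ℝ} (h : r' < r) {x : Space d} (hx : r ≤ ‖x‖) : cutoff r' r x = 0 := by
  have : (r - ‖x‖) / (r - r') ≤ 0 := div_nonpos_of_nonpos_of_nonneg (by linarith) (by linarith)
  simp [cutoff, this]

lemma lipschitzWith_cutoff {r' r : ℝ} (h : r' < r) :
    LipschitzWith (1 / (r - r')).toNNReal (cutoff r' r : Space d → ℝ) := by
  have hpos : 0 < r - r' := by linarith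
  refine LipschitzWith.const_max (LipschitzWith.const_min ?_ 1) 0
  refine LipschitzWith.of_dist_le_mul fun x y => ?_
  rw [Real.coe_toNNReal _ (by positivity), Real.dist_eq, ← sub_div, abs_div, abs_of_pos hpos,
    dist_eq_norm, div_mul_eq_mul_div, one_mul]
  gcongr
  rw [show r - ‖x‖ - (r - ‖y‖) = -(‖x‖ - ‖y‖) by ring, abs_neg]
  exact abs_norm_sub_norm_le x y

lemma ofReal_setIntegral_ball {f : Space d → ℝ} (hf : AEMeasurable f) {C : ℝ}
    (hC : ∀ x ∈ ball (0 : Space d) 1, |f x| ≤ C) (h0 : ∀ x ∈ ball (0 : Space d) 1, 0 ≤ f x) :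
    ENNReal.ofReal (∫ x in ball (0 : Space d) 1, f x)
      = ∫⁻ x in ball (0 : Space d) 1, ENNReal.ofReal (f x) := by
  refine ofReal_integral_eq_lintegral_ofReal ?_
    ((ae_restrict_iff' measurableSet_ball).2 (Eventually.of_forall h0))
  exact Measure.integrableOn_of_bounded (M := C) measure_ball_lt_top.ne hf.aestronglyMeasurable
    ((ae_restrict_iff' measurableSet_ball).2 (Eventually.of_forall hC))

lemma ofReal_setIntegral_cyl {f : Space d × ℝ → ℝ} (hf : Measurable f) {C t₁ t₂ : ℝ}
    (hC : ∀ z : Space d × ℝ, z.1 ∈ ball (0 : Space d) 1 → |f z| ≤ C) (h0 : ∀ z, 0 ≤ f z) :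
    ENNReal.ofReal (∫ z in ball (0 : Space d) 1 ×ˢ Ioc t₁ t₂, f z)
      = ∫⁻ t in Ioc t₁ t₂, ∫⁻ x in ball (0 : Space d) 1, ENNReal.ofReal (f (x, t)) := by
  rw [ofReal_integral_eq_lintegral_ofReal (integrableOn_cyl hf.aestronglyMeasurable C hC)
    (Eventually.of_forall h0), Measure.volume_eq_prod, ← Measure.prod_restrict,
    lintegral_prod_symm _ hf.ennreal_ofReal.aemeasurable]

/-- The truncation `(k - u)_+`. -/
def trunc (k : ℝ) (u : Space d × ℝ → ℝ) (z : Space d × ℝ) : ℝ := max (k - u z) 0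

lemma trunc_nonneg (k : ℝ) (u : Space d × ℝ → ℝ) (z : Space d × ℝ) : 0 ≤ trunc k u z :=
  le_max_right _ _

lemma lipschitzWith_trunc {u : Space d × ℝ → ℝ} {K : NNReal} (hu : LipschitzWith K u) (k : ℝ) :
    LipschitzWith K (trunc k u) := by
  have : LipschitzWith (0 + K) fun z => k - u z := (LipschitzWith.const k).sub hu
  rw [zero_add] at this
  exact this.max_const 0

lemma trunc_mono {k k' : ℝ} (h : k' ≤ k) (u : Space d × ℝ → ℝ) (z : Space d × ℝ) :
    trunc k' u z ≤ trunc k u z := max_le_max (by linarith) le_rfl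

/-- On the level set `{u = k}` the truncation is at its minimum 0, so its gradient vanishes wherever
it exists; nothing has to be known about `∇u` there. The coefficient is written as minus a square to
match the hypothesis `ψ' = -θ ^ 2` of `Sol.energy`. -/
lemma ae_sg_trunc {u : Space d × ℝ → ℝ} {K : NNReal} (hu : LipschitzWith K u) (k : ℝ) :
    ∀ᵐ z, sg (trunc k u) z = (-((Iio k).indicator (fun _ => (1 : ℝ)) (u z) ^ 2)) • sg u z := by
  filter_upwards [hu.ae_differentiableAt (μ := volume),
    (lipschitzWith_trunc hu k).ae_differentiableAt (μ := volume)] with z hz hTz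
  rcases lt_trichotomy (u z) k with h | h | h
  · have hev : trunc k u =ᶠ[𝓝 z] fun y => (fun s => k - s) (u y) := by
      filter_upwards [hu.continuous.continuousAt.eventually (gt_mem_nhds h)] with y hy
      simp [trunc, hy.le]
    rw [sg_congr hev, sg_comp hz ((hasDerivAt_id' (u z)).const_sub k)]
    simp [h]
  · have hmin : IsLocalMin (trunc k u) z := Eventually.of_forall fun y => by
      simp [trunc, h]
    have : sg (trunc k u) z = 0 := by
      ext i
      simp [sg, hmin.fderiv_eq_zero]
    rw [this]
    simp [h]
  · have hev : trunc k u =ᶠ[𝓝 z] fun y => (fun _ => 0) (u y) := by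
      filter_upwards [hu.continuous.continuousAt.eventually (lt_mem_nhds h)] with y hy
      simp [trunc, hy.le]
    rw [sg_congr hev, sg_comp hz (hasDerivAt_const (u z) (0 : ℝ))]
    simp [h.le]

lemma integral_max_sub {s k : ℝ} (hs : s ≤ 1) (hk : k ≤ 1) :
    ∫ τ in s..1, max (k - τ) 0 = max (k - s) 0 ^ 2 / 2 := by
  have hc : Continuous fun τ : ℝ => max (k - τ) 0 := by fun_prop
  rcases le_or_gt k s with h | h
  · rw [intervalIntegral.integral_congr (g := fun _ => 0)]
    · simp [h]
    · intro τ hτ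
      rw [uIcc_of_le hs] at hτ
      simp [h.trans hτ.1]
  · rw [← intervalIntegral.integral_add_adjacent_intervals (b := k)
      (hc.intervalIntegrable _ _) (hc.intervalIntegrable _ _)]
    have h1 : ∫ τ in s..k, max (k - τ) 0 = ∫ τ in s..k, (k - τ) := by
      refine intervalIntegral.integral_congr fun τ hτ => ?_
      rw [uIcc_of_le h.le] at hτ
      simp [hτ.2]
    have h2 : ∫ τ in k..1, max (k - τ) 0 = ∫ τ in k..1, (0 : ℝ) := by
      refine intervalIntegral.integral_congr fun τ hτ => ?_
      rw [uIcc_of_le hk] at hτ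
      simp [hτ.1]
    have h3 : ∫ τ in s..k, (k - τ) = (k - s) ^ 2 / 2 := by
      rw [intervalIntegral.integral_comp_sub_left (fun x => x) k]
      simp
    rw [h1, h2, h3, max_eq_left (by linarith)]
    simp

namespace Sol

variable {L : ℝ} {q : ℕ} {g : Space d → ℝ} {b : Space d → Matrix (Fin (d + 1)) (Fin (d + 1)) ℝ}
  {c : ℝ → ℝ} {u : Space d × ℝ → ℝ}

lemma trunc_le_one (h : Sol L q g b c u) {k : ℝ} (hk : k ≤ 1) (z : Space d × ℝ) :
    trunc k u z ≤ 1 := max_le (by linarith [h.nonneg z]) zero_le_one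

lemma measurable_trunc (h : Sol L q g b c u) (k : ℝ) : Measurable (trunc k u) :=
  (measurable_const.sub h.measurable_u).max measurable_const

/-- A Caccioppoli inequality for the truncations `(k - u)_+`. -/
lemma caccioppoli (h : Sol L q g b c u) {k : ℝ} (hk : k ≤ 1)
    {η : Space d → ℝ} {Kη : NNReal} (hη : LipschitzWith Kη η)
    (hη0 : ∀ x, 0 ≤ η x) (hη1 : ∀ x, η x ≤ 1) {ρ : ℝ} (hρ : ρ < 1)
    (hηρ : ∀ x, ρ ≤ ‖x‖ → η x = 0) {t₁ t₂ : ℝ} (ht₁ : -1 ≤ t₁) (h12 : t₁ ≤ t₂) (ht₂ : t₂ ≤ 0) :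
    (∫⁻ x in ball (0 : Space d) 1, ENNReal.ofReal (xp x ^ q * (η x ^ 2 * trunc k u (x, t₂) ^ 2)))
      + ∫⁻ t in Ioc t₁ t₂, ∫⁻ x in ball (0 : Space d) 1, ENNReal.ofReal (xp x ^ 2 * η x ^ 2
          * ((Iio k).indicator (fun _ => (1 : ℝ)) (u (x, t)) ^ 2 * ‖sg u (x, t)‖ ^ 2))
      ≤ ENNReal.ofReal (4 * L ^ 5) * ((∫⁻ x in ball (0 : Space d) ρ,
          ENNReal.ofReal (xp x ^ 2 * trunc k u (x, t₁) ^ 2))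
        + ENNReal.ofReal (Kη ^ 2) * ∫⁻ t in Ioc t₁ t₂, ∫⁻ x in ball (0 : Space d) ρ,
          ENNReal.ofReal (xp x ^ 2 * trunc k u (x, t) ^ 2)) := by
  obtain ⟨Ku, hKu⟩ := h.lip
  have hL := h.L_pos
  have hum := h.measurable_u
  have hηm : Measurable η := hη.continuous.measurable
  have hTm := h.measurable_trunc k
  have hT1 := h.trunc_le_one hk
  have hT0 := trunc_nonneg k u
  have hind : ∀ s, |(Iio k).indicator (fun _ => (1 : ℝ)) s| ≤ 1 := fun s => by
    by_cases hs : s ∈ Iio k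
    · simp [indicator_of_mem hs]
    · simp [indicator_of_notMem hs]
  have hψ1 : ∀ s ∈ Icc (0 : ℝ) 1, |max (k - s) 0| ≤ 1 := fun s hs => by
    rw [abs_of_nonneg (le_max_right _ _)]
    exact max_le (by linarith [hs.1]) zero_le_one
  -- Here `ψ = ω = (k - s)_+` and `θ` is the indicator of `s < k`.
  have hE := h.energy hη hη0 hη1 hρ hηρ (ψ := fun s => max (k - s) 0)
    (θ := (Iio k).indicator fun _ => 1) (ω := fun s => max (k - s) 0) (by fun_prop)
    (measurable_const.indicator measurableSet_Iio) (by fun_prop) (lipschitzWith_trunc hKu k)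
    (C := 1) hψ1 (fun s _ => hind s) hψ1 (fun s _ => by
      by_cases hs : s ∈ Iio k
      · simp [indicator_of_mem hs]
      · simp [show k ≤ s from not_lt.1 hs]) (ae_sg_trunc hKu k) ht₁ h12 ht₂
  have hΨle : ∀ z, ∫ s in u z..1, c s * max (k - s) 0 ≤ L * (trunc k u z ^ 2 / 2) := by
    intro z
    rw [trunc, ← integral_max_sub (h.le_one z) hk, ← intervalIntegral.integral_const_mul]
    refine intervalIntegral.integral_mono_on (h.le_one z)
      ((h.c_cont.mul (by fun_prop)).intervalIntegrable _ _)
      (Continuous.intervalIntegrable (by fun_prop) _ _) fun s _ => ?_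
    exact mul_le_mul_of_nonneg_right (h.c_upper s) (le_max_right _ _)
  have hΨge : ∀ z, L⁻¹ * (trunc k u z ^ 2 / 2) ≤ ∫ s in u z..1, c s * max (k - s) 0 := by
    intro z
    rw [trunc, ← integral_max_sub (h.le_one z) hk, ← intervalIntegral.integral_const_mul]
    refine intervalIntegral.integral_mono_on (h.le_one z)
      (Continuous.intervalIntegrable (by fun_prop) _ _)
      ((h.c_cont.mul (by fun_prop)).intervalIntegrable _ _) fun s _ => ?_
    exact mul_le_mul_of_nonneg_right (h.c_lower s) (le_max_right _ _)
  have hΨc : Continuous fun s => ∫ τ in s..1, c τ * max (k - τ) 0 := by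
    have hcc : Continuous fun τ => c τ * max (k - τ) 0 := h.c_cont.mul (by fun_prop)
    exact continuous_iff_continuousAt.2 fun s =>
      (intervalIntegral.integral_hasDerivAt_left (hcc.intervalIntegrable _ _)
        (hcc.stronglyMeasurableAtFilter _ _) hcc.continuousAt).continuousAt
  have hη2 : ∀ x, η x ^ 2 ≤ 1 := fun x => pow_le_one₀ (hη0 x) (hη1 x)
  have hT2 : ∀ z, trunc k u z ^ 2 ≤ 1 := fun z => pow_le_one₀ (hT0 z) (hT1 z)
  have hΨ0 : ∀ z, 0 ≤ ∫ s in u z..1, c s * max (k - s) 0 := fun z =>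
    le_trans (by positivity) (hΨge z)
  have hxpq : ∀ x ∈ ball (0 : Space d) 1, ∀ m : ℕ, xp x ^ m ≤ 1 := fun x hx m =>
    pow_le_one₀ (xp_nonneg x) (xp_le_one hx)
  have hsl : ∀ t, Measurable fun x : Space d => trunc k u (x, t) := fun t =>
    hTm.comp (by fun_prop)
  -- bounded integrable functions on the slices
  have hslice : ∀ t, IntegrableOn (fun x => g x * η x ^ 2 * ∫ s in u (x, t)..1, c s * max (k - s) 0)
      (ball (0 : Space d) 1) := by
    intro t
    refine Measure.integrableOn_of_bounded (M := L * 1 * (L * (1 / 2))) measure_ball_lt_top.ne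
      (AEMeasurable.aestronglyMeasurable ?_)
      ((ae_restrict_iff' measurableSet_ball).2 (Eventually.of_forall fun x hx => ?_))
    · exact (h.g_meas.mul (hηm.pow_const 2).aemeasurable).mul
        (hΨc.measurable.comp (hum.comp (by fun_prop))).aemeasurable
    · rw [norm_mul, norm_mul, Real.norm_of_nonneg (hΨ0 _), Real.norm_of_nonneg (sq_nonneg _)]
      gcongr
      · exact hΨ0 _
      · exact h.abs_g_le hx
      · exact hη2 x
      · exact (hΨle _).trans (by gcongr; exact hT2 _)
  have hA : ∀ t, ∀ m : ℕ, IntegrableOn (fun x => xp x ^ m * (η x ^ 2 * trunc k u (x, t) ^ 2))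
      (ball (0 : Space d) 1) := by
    intro t m
    refine Measure.integrableOn_of_bounded (M := 1 * (1 * 1)) measure_ball_lt_top.ne
      (Measurable.aestronglyMeasurable ?_)
      ((ae_restrict_iff' measurableSet_ball).2 (Eventually.of_forall fun x hx => ?_))
    · exact (measurable_xp.pow_const m).mul ((hηm.pow_const 2).mul ((hsl t).pow_const 2))
    · have := xp_nonneg x
      rw [Real.norm_of_nonneg (by positivity)]
      gcongr
      · exact hxpq x hx m
      · exact hη2 x
      · exact hT2 _
  set a := ∫ x in ball (0 : Space d) 1, xp x ^ q * (η x ^ 2 * trunc k u (x, t₂) ^ 2) with ha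
  set f := ∫ x in ball (0 : Space d) 1, xp x ^ 2 * (η x ^ 2 * trunc k u (x, t₁) ^ 2) with hf
  -- The two time slices carry different weights: the lower bound for `g` leaves `xp ^ q` at the
  -- final time, while the upper bound gives `xp ^ 2` at the initial time.
  have ha' : L⁻¹ * (L⁻¹ / 2) * a
      ≤ ∫ x in ball (0 : Space d) 1, g x * η x ^ 2 * ∫ s in u (x, t₂)..1, c s * max (k - s) 0 := by
    rw [ha, ← integral_const_mul]
    refine setIntegral_mono_on ((hA t₂ q).const_mul _) (hslice t₂) measurableSet_ball fun x hx => ?_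
    have h1 := h.g_lower x hx
    have h2 := hΨge (x, t₂)
    have := xp_nonneg x
    calc L⁻¹ * (L⁻¹ / 2) * (xp x ^ q * (η x ^ 2 * trunc k u (x, t₂) ^ 2))
        = (L⁻¹ * xp x ^ q) * η x ^ 2 * (L⁻¹ * (trunc k u (x, t₂) ^ 2 / 2)) := by ring
      _ ≤ _ := by
          have := h.g_nonneg hx
          gcongr
  have hf' : ∫ x in ball (0 : Space d) 1, g x * η x ^ 2 * ∫ s in u (x, t₁)..1, c s * max (k - s) 0
      ≤ L * (L / 2) * f := by
    rw [hf, ← integral_const_mul]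
    refine setIntegral_mono_on (hslice t₁) ((hA t₁ 2).const_mul _) measurableSet_ball fun x hx => ?_
    have h1 := h.g_upper x hx
    have h2 := hΨle (x, t₁)
    calc g x * η x ^ 2 * ∫ s in u (x, t₁)..1, c s * max (k - s) 0
        ≤ (L * xp x ^ 2) * η x ^ 2 * (L * (trunc k u (x, t₁) ^ 2 / 2)) := by
          have := hΨ0 (x, t₁)
          gcongr
      _ = _ := by ring
  set D := ∫ z in ball (0 : Space d) 1 ×ˢ Ioc t₁ t₂,
    xp z.1 ^ 2 * η z.1 ^ 2 * ((Iio k).indicator (fun _ => (1 : ℝ)) (u z) ^ 2 * ‖sg u z‖ ^ 2) with hD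
  set I := ∫ z in ball (0 : Space d) 1 ×ˢ Ioc t₁ t₂,
    (ball (0 : Space d) ρ).indicator (fun _ => (1 : ℝ)) z.1 * (xp z.1 ^ 2 * max (k - u z) 0 ^ 2)
    with hI
  have hE2 : L⁻¹ * (L⁻¹ / 2) * a ≤ L * (L / 2) * f - 1 / (2 * L) * D + 2 * L ^ 3 * Kη ^ 2 * I :=
    ha'.trans (hE.trans (by gcongr))
  have hD0 : 0 ≤ D := setIntegral_nonneg (measurableSet_cyl _ _) fun z _ => by positivity
  have hI0 : 0 ≤ I := setIntegral_nonneg (measurableSet_cyl _ _) fun z _ =>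
    mul_nonneg (indicator_nonneg (fun _ _ => zero_le_one) _) (by positivity)
  have ha0 : 0 ≤ a := setIntegral_nonneg measurableSet_ball fun x _ => by
    have := xp_nonneg x
    positivity
  have hf0 : 0 ≤ f := setIntegral_nonneg measurableSet_ball fun x _ => by positivity
  have hreal : a + D ≤ 4 * L ^ 5 * (f + Kη ^ 2 * I) := by
    have h1 : a + L * D ≤ L ^ 4 * f + 4 * L ^ 5 * (Kη ^ 2 * I) := by
      -- The factor `2 L ^ 2` normalizes the coefficient of `a` to 1. The remaining powers of `L`
      -- are then rounded up using `1 ≤ L`.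
      have := mul_le_mul_of_nonneg_left hE2 (by positivity : 0 ≤ 2 * L ^ 2)
      field_simp at this
      nlinarith [this]
    have h2 : D ≤ L * D := le_mul_of_one_le_left hD0 h.one_le
    have h3 : L ^ 4 * f ≤ 4 * L ^ 5 * f := by
      have : L ^ 4 ≤ L ^ 5 := pow_le_pow_right₀ h.one_le (by norm_num)
      have h5 : 0 ≤ L ^ 5 := by positivity
      gcongr
      linarith
    linarith
  have hfin := ENNReal.ofReal_le_ofReal hreal
  rw [ENNReal.ofReal_add ha0 hD0, ENNReal.ofReal_mul (p := 4 * L ^ 5) (by positivity),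
    ENNReal.ofReal_add hf0 (by positivity),
    ENNReal.ofReal_mul (p := (Kη : ℝ) ^ 2) (by positivity)] at hfin
  have ea : ENNReal.ofReal a = ∫⁻ x in ball (0 : Space d) 1,
      ENNReal.ofReal (xp x ^ q * (η x ^ 2 * trunc k u (x, t₂) ^ 2)) := by
    refine ofReal_integral_eq_lintegral_ofReal (hA t₂ q) (Eventually.of_forall fun x => ?_)
    have := xp_nonneg x
    positivity
  have eD : ENNReal.ofReal D = ∫⁻ t in Ioc t₁ t₂, ∫⁻ x in ball (0 : Space d) 1,
      ENNReal.ofReal (xp x ^ 2 * η x ^ 2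
        * ((Iio k).indicator (fun _ => (1 : ℝ)) (u (x, t)) ^ 2 * ‖sg u (x, t)‖ ^ 2)) := by
    refine ofReal_setIntegral_cyl (f := fun z => xp z.1 ^ 2 * η z.1 ^ 2
        * ((Iio k).indicator (fun _ => (1 : ℝ)) (u z) ^ 2 * ‖sg u z‖ ^ 2))
        (C := 1 ^ 2 * 1 * (1 ^ 2 * Ku ^ 2)) ?_ (fun z hz => ?_) (fun z => by positivity)
    · exact (((measurable_xp.comp measurable_fst).pow_const 2).mul
        ((hηm.comp measurable_fst).pow_const 2)).mul
        ((((measurable_const.indicator measurableSet_Iio).comp hum).pow_const 2).mul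
          ((measurable_sg u).norm.pow_const 2))
    · rw [abs_of_nonneg (by positivity), ← sq_abs (indicator _ _ _)]
      gcongr
      · exact xp_nonneg _
      · exact xp_le_one hz
      · exact hη2 _
      · exact hind _
      · exact norm_sg_le hKu z
  have ef : ENNReal.ofReal f ≤ ∫⁻ x in ball (0 : Space d) ρ,
      ENNReal.ofReal (xp x ^ 2 * trunc k u (x, t₁) ^ 2) := by
    rw [hf, ofReal_integral_eq_lintegral_ofReal (hA t₁ 2) (Eventually.of_forall fun x => by
      positivity)]
    rw [← lintegral_indicator measurableSet_ball, ← lintegral_indicator measurableSet_ball]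
    refine lintegral_mono fun x => ?_
    by_cases hx : x ∈ ball (0 : Space d) ρ
    · have hx1 : x ∈ ball (0 : Space d) 1 := ball_subset_ball hρ.le hx
      rw [indicator_of_mem hx, indicator_of_mem hx1]
      refine ENNReal.ofReal_le_ofReal ?_
      have : η x ^ 2 * trunc k u (x, t₁) ^ 2 ≤ 1 * trunc k u (x, t₁) ^ 2 := by
        gcongr
        exact hη2 x
      rw [one_mul] at this
      gcongr
    · rw [indicator_of_notMem hx]
      have : η x = 0 := hηρ x (by simpa using hx)
      simp [indicator, this]
  have eI : ENNReal.ofReal I = ∫⁻ t in Ioc t₁ t₂, ∫⁻ x in ball (0 : Space d) ρ,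
      ENNReal.ofReal (xp x ^ 2 * trunc k u (x, t) ^ 2) := by
    rw [hI, ofReal_setIntegral_cyl (f := fun z => (ball (0 : Space d) ρ).indicator
      (fun _ => (1 : ℝ)) z.1 * (xp z.1 ^ 2 * max (k - u z) 0 ^ 2)) (C := 1 * (1 ^ 2 * 1))
      ?_ (fun z hz => ?_) (fun z => mul_nonneg (indicator_nonneg (fun _ _ => zero_le_one) _)
        (by positivity))]
    · congr 1; ext t
      rw [← lintegral_indicator measurableSet_ball, ← lintegral_indicator measurableSet_ball]
      congr 1; ext x
      by_cases hx : x ∈ ball (0 : Space d) ρ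
      · have hx1 : x ∈ ball (0 : Space d) 1 := ball_subset_ball hρ.le hx
        rw [indicator_of_mem hx, indicator_of_mem hx1, indicator_of_mem hx, one_mul]
        rfl
      · rw [indicator_of_notMem hx]
        simp [indicator, show ¬ ‖x‖ < ρ by simpa using hx]
    · exact ((measurable_const.indicator measurableSet_ball).comp measurable_fst).mul
        (((measurable_xp.comp measurable_fst).pow_const 2).mul (hTm.pow_const 2))
    · have h0 : 0 ≤ (ball (0 : Space d) ρ).indicator (fun _ => (1 : ℝ)) z.1 :=
        indicator_nonneg (fun _ _ => zero_le_one) _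
      rw [abs_of_nonneg (mul_nonneg h0 (by positivity))]
      gcongr
      · exact indicator_le_self' (fun _ _ => zero_le_one) _
      · exact xp_nonneg _
      · exact xp_le_one hz
      · exact hT2 z
  rw [ea, eD, eI] at hfin
  exact hfin.trans (by gcongr)

end Sol

/-! ### The De Giorgi iteration -/

/-- The weighted `L²` mass of `(k - u)_+` in the half cylinder `B_r^+ × (-r, 0]`. -/
def levelMass (u : Space d × ℝ → ℝ) (r k : ℝ) : ℝ≥0∞ :=
  ∫⁻ t in Ioc (-r) 0, ∫⁻ x in ball (0 : Space d) r, ENNReal.ofReal (xp x ^ 2 * trunc k u (x, t) ^ 2)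

lemma levelMass_mono (u : Space d × ℝ → ℝ) {r r' k k' : ℝ} (hr : r' ≤ r) (hk : k' ≤ k) :
    levelMass u r' k' ≤ levelMass u r k := by
  refine (lintegral_mono_set (Ioc_subset_Ioc_left (by linarith))).trans (lintegral_mono fun t => ?_)
  refine (lintegral_mono_set (ball_subset_ball hr)).trans (lintegral_mono fun x => ?_)
  have := trunc_nonneg k' u (x, t)
  have := trunc_mono hk u (x, t)
  dsimp only
  gcongr

namespace Sol

variable {L : ℝ} {q : ℕ} {g : Space d → ℝ} {b : Space d → Matrix (Fin (d + 1)) (Fin (d + 1)) ℝ}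
  {c : ℝ → ℝ} {u : Space d × ℝ → ℝ}

/-- The initial slice in the Caccioppoli inequality is removed by averaging over starting times in
`(-r, -r']`. Its integral is part of the mass, at the price of one factor `1 / (r - r')`; together
with the squared slope of the cutoff the total is of order `1 / (r - r') ^ 2`. -/
lemma energy_le_levelMass (h : Sol L q g b c u) {k r r' : ℝ} (hk : k ≤ 1) (hr' : 0 < r')
    (hrr : r' < r) (hr : r < 1) {t : ℝ} (ht : -r' ≤ t) (ht0 : t ≤ 0) :
    (∫⁻ x in ball (0 : Space d) 1,
        ENNReal.ofReal (xp x ^ q * (cutoff r' r x ^ 2 * trunc k u (x, t) ^ 2)))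
      + ∫⁻ s in Ioc (-r') t, ∫⁻ x in ball (0 : Space d) 1,
        ENNReal.ofReal (xp x ^ 2 * cutoff r' r x ^ 2
          * ((Iio k).indicator (fun _ => (1 : ℝ)) (u (x, s)) ^ 2 * ‖sg u (x, s)‖ ^ 2))
      ≤ ENNReal.ofReal (8 * L ^ 5 / (r - r') ^ 2) * levelMass u r k := by
  have hL := h.L_pos
  set δ := r - r' with hδ
  have hδ0 : 0 < δ := by linarith
  have hδ1 : δ ≤ 1 := by linarith
  set X := (∫⁻ x in ball (0 : Space d) 1,
        ENNReal.ofReal (xp x ^ q * (cutoff r' r x ^ 2 * trunc k u (x, t) ^ 2)))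
      + ∫⁻ s in Ioc (-r') t, ∫⁻ x in ball (0 : Space d) 1,
        ENNReal.ofReal (xp x ^ 2 * cutoff r' r x ^ 2
          * ((Iio k).indicator (fun _ => (1 : ℝ)) (u (x, s)) ^ 2 * ‖sg u (x, s)‖ ^ 2))
  set F : ℝ → ℝ≥0∞ := fun s =>
    ∫⁻ x in ball (0 : Space d) r, ENNReal.ofReal (xp x ^ 2 * trunc k u (x, s) ^ 2) with hF
  set Y := levelMass u r k with hY
  have hs : ∀ s ∈ Ioc (-r) (-r'), X ≤ ENNReal.ofReal (4 * L ^ 5)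
      * (F s + ENNReal.ofReal (1 / δ ^ 2) * Y) := by
    intro s hs
    have hc := h.caccioppoli hk (lipschitzWith_cutoff hrr) (cutoff_nonneg r' r)
      (cutoff_le_one r' r) hr (fun x hx => cutoff_eq_zero hrr hx) (t₁ := s) (t₂ := t)
      (by linarith [hs.1]) (hs.2.trans ht) ht0
    have hK : (((1 / (r - r')).toNNReal : NNReal) : ℝ) ^ 2 = 1 / δ ^ 2 := by
      rw [Real.coe_toNNReal _ (by positivity), div_pow, one_pow]
    rw [hK] at hc
    refine le_trans ?_ (hc.trans ?_)
    · refine add_le_add le_rfl (lintegral_mono_set (Ioc_subset_Ioc_left hs.2))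
    · gcongr
      exact lintegral_mono_set (Ioc_subset_Ioc hs.1.le ht0)
  have hint : ENNReal.ofReal δ * X ≤ ENNReal.ofReal δ * (ENNReal.ofReal (8 * L ^ 5 / δ ^ 2) * Y) := by
    calc ENNReal.ofReal δ * X = ∫⁻ s in Ioc (-r) (-r'), X := by
          rw [setLIntegral_const, Real.volume_Ioc, mul_comm]
          congr 2
          ring
      _ ≤ ∫⁻ s in Ioc (-r) (-r'), ENNReal.ofReal (4 * L ^ 5)
            * (F s + ENNReal.ofReal (1 / δ ^ 2) * Y) := setLIntegral_mono' measurableSet_Ioc hs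
      _ = ENNReal.ofReal (4 * L ^ 5) * ((∫⁻ s in Ioc (-r) (-r'), F s)
            + ENNReal.ofReal (1 / δ ^ 2) * Y * ENNReal.ofReal δ) := by
          rw [lintegral_const_mul' _ _ ENNReal.ofReal_ne_top, lintegral_add_right _ measurable_const,
            setLIntegral_const, Real.volume_Ioc]
          congr 4
          ring
      _ ≤ ENNReal.ofReal (4 * L ^ 5) * (Y + ENNReal.ofReal (1 / δ ^ 2) * Y * ENNReal.ofReal δ) := by
          gcongr
          exact lintegral_mono_set (Ioc_subset_Ioc_right (by linarith))
      _ = ENNReal.ofReal (4 * L ^ 5 * (1 + 1 / δ)) * Y := by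
          rw [ENNReal.ofReal_mul (p := 4 * L ^ 5) (by positivity),
            ENNReal.ofReal_add zero_le_one (by positivity), ENNReal.ofReal_one, show 1 / δ = 1 / δ ^ 2 * δ by field_simp,
            ENNReal.ofReal_mul (q := δ) (by positivity)]
          ring
      _ ≤ ENNReal.ofReal (δ * (8 * L ^ 5 / δ ^ 2)) * Y := by
          gcongr ENNReal.ofReal ?_ * _
          have h1 : 1 ≤ 1 / δ := by rw [le_div_iff₀ hδ0]; linarith
          have h5 : 0 ≤ L ^ 5 := by positivity
          rw [show δ * (8 * L ^ 5 / δ ^ 2) = 4 * L ^ 5 * (1 / δ + 1 / δ) by field_simp; ring]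
          gcongr
      _ = _ := by rw [ENNReal.ofReal_mul hδ0.le, mul_assoc]
  exact (ENNReal.mul_le_mul_iff_right (by simpa using hδ0) ENNReal.ofReal_ne_top).1 hint

/-- The product rule, prepared for use on single time slices: the identity for the gradient of the
truncation holds almost everywhere in space-time and Fubini transfers it to almost every slice.
Outside the ball the cutoff is at its minimum, so its gradient vanishes and the indicator is
justified. -/
lemma ae_fderiv_trunc_mul_cutoff (h : Sol L q g b c u) (k : ℝ) {r r' : ℝ} (hrr : r' < r) :
    ∀ᵐ t : ℝ, ∀ᵐ x : Space d,
      ‖fderiv ℝ (fun y => trunc k u (y, t) * cutoff r' r y) x‖ₑ ^ 2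
      ≤ 2 * ENNReal.ofReal (cutoff r' r x ^ 2
          * ((Iio k).indicator (fun _ => (1 : ℝ)) (u (x, t)) ^ 2 * ‖sg u (x, t)‖ ^ 2))
        + 2 * ENNReal.ofReal (1 / (r - r') ^ 2)
          * (ball (0 : Space d) r).indicator
            (fun x => ENNReal.ofReal (trunc k u (x, t) ^ 2)) x := by
  obtain ⟨Ku, hKu⟩ := h.lip
  have hδ0 : 0 < r - r' := by linarith
  have hmeas : MeasurableSet {z : Space d × ℝ | DifferentiableAt ℝ (trunc k u) z ∧
      sg (trunc k u) z = (-((Iio k).indicator (fun _ => (1 : ℝ)) (u z) ^ 2)) • sg u z} := by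
    refine (measurableSet_of_differentiableAt ℝ _).inter (measurableSet_eq_fun (measurable_sg _) ?_)
    exact Measurable.smul (f := fun z => -((Iio k).indicator (fun _ => (1 : ℝ)) (u z) ^ 2))
      (((measurable_const.indicator measurableSet_Iio).comp h.measurable_u).pow_const 2).neg
      (measurable_sg u)
  have hae : ∀ᵐ t : ℝ, ∀ᵐ x : Space d, DifferentiableAt ℝ (trunc k u) (x, t) ∧
      sg (trunc k u) (x, t)
        = (-((Iio k).indicator (fun _ => (1 : ℝ)) (u (x, t)) ^ 2)) • sg u (x, t) := by
    rw [← Measure.ae_ae_comm (p := fun x t => DifferentiableAt ℝ (trunc k u) (x, t) ∧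
      sg (trunc k u) (x, t)
        = (-((Iio k).indicator (fun _ => (1 : ℝ)) (u (x, t)) ^ 2)) • sg u (x, t)) hmeas]
    refine Measure.ae_ae_of_ae_prod (p := fun z => DifferentiableAt ℝ (trunc k u) z ∧
      sg (trunc k u) z = (-((Iio k).indicator (fun _ => (1 : ℝ)) (u z) ^ 2)) • sg u z) ?_
    exact ((lipschitzWith_trunc hKu k).ae_differentiableAt (μ := volume)).and (ae_sg_trunc hKu k)
  filter_upwards [hae] with t ht
  filter_upwards [ht, (lipschitzWith_cutoff (d := d) hrr).ae_differentiableAt (μ := volume)]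
    with x hx hcx
  obtain ⟨hdx, hsx⟩ := hx
  have hsl := hasFDerivAt_slice_space hdx
  have hmul : fderiv ℝ (fun y => trunc k u (y, t) * cutoff r' r y) x
      = trunc k u (x, t) • fderiv ℝ (cutoff r' r) x
        + cutoff r' r x • fderiv ℝ (fun y => trunc k u (y, t)) x :=
    fderiv_fun_mul hsl.differentiableAt hcx
  rw [hmul, add_comm (trunc k u (x, t) • fderiv ℝ (cutoff r' r) x)]
  refine (enorm_add_sq_le _ _).trans ?_
  rw [enorm_smul, enorm_smul, mul_pow, mul_pow]
  have h1 : ‖fderiv ℝ (fun y => trunc k u (y, t)) x‖ₑ ^ 2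
      ≤ ENNReal.ofReal ((Iio k).indicator (fun _ => (1 : ℝ)) (u (x, t)) ^ 2
        * ‖sg u (x, t)‖ ^ 2) := by
    rw [← ofReal_norm, ← ENNReal.ofReal_pow (norm_nonneg _)]
    refine ENNReal.ofReal_le_ofReal ?_
    have h2 := norm_fderiv_slice_le hdx
    rw [hsx, norm_smul, norm_neg, Real.norm_of_nonneg (sq_nonneg _)] at h2
    have h3 := pow_le_pow_left₀ (norm_nonneg _) h2 2
    refine h3.trans (le_of_eq ?_)
    by_cases hu : u (x, t) ∈ Iio k
    · simp only [indicator_of_mem hu]; ring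
    · simp only [indicator_of_notMem hu]; ring
  have h2 : ‖fderiv ℝ (cutoff r' r) x‖ₑ ^ 2 ≤ ENNReal.ofReal (1 / (r - r') ^ 2) := by
    rw [← ofReal_norm, ← ENNReal.ofReal_pow (norm_nonneg _)]
    refine ENNReal.ofReal_le_ofReal ?_
    have h3 := norm_fderiv_le_of_lipschitz ℝ (lipschitzWith_cutoff (d := d) hrr) (x₀ := x)
    rw [Real.coe_toNNReal _ (by positivity)] at h3
    calc _ ≤ (1 / (r - r')) ^ 2 := by gcongr
      _ = _ := by rw [div_pow, one_pow]
  refine add_le_add (mul_le_mul_right ?_ _) ?_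
  · rw [ENNReal.ofReal_mul (sq_nonneg _), ← enorm_sq_eq]
    gcongr
  · rw [mul_assoc]
    refine mul_le_mul_right ?_ _
    by_cases hxr : x ∈ ball (0 : Space d) r
    · rw [indicator_of_mem hxr, enorm_sq_eq, mul_comm]
      gcongr
    · have : fderiv ℝ (cutoff r' r) x = 0 := by
        have hx0 : cutoff r' r x = 0 := cutoff_eq_zero hrr (by simpa using hxr)
        have hmin : IsLocalMin (cutoff r' r) x := Eventually.of_forall fun y => by
          simpa [hx0] using cutoff_nonneg r' r y
        exact hmin.fderiv_eq_zero
      rw [this, enorm_eq_nnnorm (0 : Space d →L[ℝ] ℝ), nnnorm_zero]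
      simp

/-- One step of the De Giorgi iteration. -/
lemma deGiorgi_step (h : Sol L q g b c u) {N : ℕ} {c₀ : ℝ}
    (hvol : ∀ r : ℝ, 0 < r →
      ∀ S : Set (Space d), MeasurableSet S → S ⊆ halfBall 0 1 →
      ∫⁻ x in S, ENNReal.ofReal (xp x) ^ q ≤ ENNReal.ofReal (c₀ * r ^ N) →
      4 * volume S ≤ volume (ball (0 : Space d) r))
    {k k' r r' ϱ : ℝ} (hk : k ≤ 1) (hkk : k' < k) (hr' : 0 < r') (hrr : r' < r)
    (hr : r < 1) (hϱ : 0 < ϱ)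
    (hY : ENNReal.ofReal (32 * L ^ 5 / (r - r') ^ 2) * levelMass u r k
      ≤ ENNReal.ofReal ((k - k') ^ 2 * (c₀ * ϱ ^ N))) :
    levelMass u r' k' ≤ ENNReal.ofReal (1440 * L ^ 5 * ϱ ^ 2 / (r - r') ^ 2) * levelMass u r k := by
  obtain ⟨Ku, hKu⟩ := h.lip
  have hL := h.L_pos
  have hum := h.measurable_u
  -- Two gaps are needed. Between `m` and `r` the energy shows that the sublevel sets are small at
  -- every time; between `r'` and `m` the localized truncation is estimated by Faber–Krahn.
  set m := (r + r') / 2 with hm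
  have hm1 : r' < m := by rw [hm]; linarith
  have hm2 : m < r := by rw [hm]; linarith
  have hm0 : 0 < m := hr'.trans hm1
  set δ := r - r' with hδ
  have hδ0 : 0 < δ := by linarith
  have hrm : r - m = δ / 2 := by rw [hm, hδ]; ring
  have hmr : m - r' = δ / 2 := by rw [hm, hδ]; ring
  have hkk0 : 0 < k - k' := by linarith
  have hδ4 : 8 * L ^ 5 / (δ / 2) ^ 2 = 32 * L ^ 5 / δ ^ 2 := by field_simp; ring
  -- the sets where the next truncation lives are small
  have hS : ∀ t ∈ Ioc (-m) 0,
      4 * volume {x : Space d | x ∈ halfBall 0 m ∧ u (x, t) < k'} ≤ volume (ball (0 : Space d) ϱ) := by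
    intro t ht
    have hSm : MeasurableSet {x : Space d | x ∈ halfBall 0 m ∧ u (x, t) < k'} :=
      (measurableSet_halfBall 0 m).inter
        (measurableSet_lt (hum.comp (by fun_prop)) measurable_const)
    refine hvol ϱ hϱ _ hSm (fun x hx => ⟨ball_subset_ball (hm2.le.trans hr.le) hx.1.1, hx.1.2⟩) ?_
    have hen := h.energy_le_levelMass hk hm0 hm2 hr ht.1.le ht.2
    rw [hrm, hδ4] at hen
    -- Chebyshev: where `u < k'` the truncation at the higher level `k` is at least `k - k'`.
    have h1 : ENNReal.ofReal ((k - k') ^ 2)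
        * ∫⁻ x in {x : Space d | x ∈ halfBall 0 m ∧ u (x, t) < k'}, ENNReal.ofReal (xp x) ^ q
        ≤ ENNReal.ofReal ((k - k') ^ 2) * ENNReal.ofReal (c₀ * ϱ ^ N) := by
      rw [← ENNReal.ofReal_mul (sq_nonneg _)]
      refine le_trans ?_ ((le_self_add.trans hen).trans hY)
      rw [← lintegral_const_mul' _ _ ENNReal.ofReal_ne_top]
      refine le_trans ?_ (lintegral_mono_set (s := {x : Space d | x ∈ halfBall 0 m ∧ u (x, t) < k'})
        fun x hx => ball_subset_ball (hm2.le.trans hr.le) hx.1.1)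
      refine setLIntegral_mono' hSm fun x hx => ?_
      have hxm : ‖x‖ ≤ m := (mem_ball_zero_iff.1 hx.1.1).le
      rw [cutoff_eq_one hm2 hxm, one_pow, one_mul, mul_comm, ENNReal.ofReal_mul
        (pow_nonneg (xp_nonneg x) _), ENNReal.ofReal_pow (xp_nonneg x)]
      gcongr
      refine le_trans ?_ (le_max_left _ _)
      linarith [hx.2]
    exact (ENNReal.mul_le_mul_iff_right (by simpa using by positivity) ENNReal.ofReal_ne_top).1 h1
  -- Faber–Krahn on the slices
  set D : ℝ → ℝ≥0∞ := fun t => ∫⁻ x in ball (0 : Space d) 1,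
    ENNReal.ofReal (xp x ^ 2 * cutoff r' m x ^ 2
      * ((Iio k').indicator (fun _ => (1 : ℝ)) (u (x, t)) ^ 2 * ‖sg u (x, t)‖ ^ 2)) with hD
  set F : ℝ → ℝ → ℝ≥0∞ := fun r t =>
    ∫⁻ x in ball (0 : Space d) r, ENNReal.ofReal (xp x ^ 2 * trunc k' u (x, t) ^ 2) with hF
  have hTm := h.measurable_trunc k'
  have hηm : Measurable (cutoff r' m : Space d → ℝ) :=
    (lipschitzWith_cutoff hm1).continuous.measurable
  have hsl : ∀ᵐ t : ℝ, t ∈ Ioc (-r') 0 → F r' t ≤ 20 * ENNReal.ofReal ϱ ^ 2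
      * (2 * D t + 2 * ENNReal.ofReal (4 / δ ^ 2) * F m t) := by
    filter_upwards [h.ae_fderiv_trunc_mul_cutoff k' hm1] with t ht htmem
    set v : Space d → ℝ := fun y => trunc k' u (y, t) * cutoff r' m y with hv
    have hvL : ∃ K, LipschitzWith K v := by
      have hTL := lipschitzWith_slice_space (lipschitzWith_trunc hKu k') t
      exact ⟨_, lipschitzWith_mul_of_bounded hTL (lipschitzWith_cutoff hm1) 1 1
        (fun x => by
          rw [abs_of_nonneg (trunc_nonneg _ _ _)]
          simpa using h.trunc_le_one (hkk.le.trans hk) (x, t))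
        (fun x => by
          rw [abs_of_nonneg (cutoff_nonneg _ _ _)]
          simpa using cutoff_le_one r' m x)⟩
    obtain ⟨Kv, hKv⟩ := hvL
    have hvc : HasCompactSupport v := by
      refine HasCompactSupport.intro (isCompact_closedBall (0 : Space d) m) fun x hx => ?_
      have : m ≤ ‖x‖ := by
        simp only [mem_closedBall, dist_zero_right, not_le] at hx
        exact hx.le
      simp [hv, cutoff_eq_zero hm1 this]
    have hfk := weighted_faberKrahn hKv hvc
      (S := {x : Space d | x ∈ halfBall 0 m ∧ u (x, t) < k'})
      ((measurableSet_halfBall 0 m).inter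
        (measurableSet_lt (hum.comp (by fun_prop)) measurable_const))
      (fun x hx0 hxS => by
        by_cases hxm : ‖x‖ < m
        · have : ¬ u (x, t) < k' := fun hu => hxS ⟨⟨mem_ball_zero_iff.2 hxm, hx0⟩, hu⟩
          simp [hv, trunc, not_lt.1 this]
        · simp [hv, cutoff_eq_zero hm1 (not_lt.1 hxm)]) hϱ
      (hS t ⟨by linarith [htmem.1], htmem.2⟩)
    calc F r' t ≤ ∫⁻ x, ENNReal.ofReal (xp x) ^ 2 * ‖v x‖ₑ ^ 2 := by
          refine le_trans ?_ (setLIntegral_le_lintegral (ball (0 : Space d) r') _)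
          refine setLIntegral_mono' measurableSet_ball fun x hx => ?_
          rw [hv]
          dsimp only
          rw [cutoff_eq_one hm1 (mem_ball_zero_iff.1 hx).le, mul_one, enorm_sq_eq,
            ← ENNReal.ofReal_pow (xp_nonneg x), ← ENNReal.ofReal_mul (sq_nonneg _)]
      _ ≤ _ := hfk
      _ ≤ 20 * ENNReal.ofReal ϱ ^ 2 * (2 * D t + 2 * ENNReal.ofReal (4 / δ ^ 2) * F m t) := by
          gcongr
          have hsub : ball (0 : Space d) m ⊆ ball 0 1 := ball_subset_ball (hm2.le.trans hr.le)
          calc ∫⁻ x, ENNReal.ofReal (xp x) ^ 2 * ‖fderiv ℝ v x‖ₑ ^ 2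
              ≤ ∫⁻ x, (2 * (ball (0 : Space d) 1).indicator (fun x =>
                  ENNReal.ofReal (xp x ^ 2 * cutoff r' m x ^ 2
                  * ((Iio k').indicator (fun _ => (1 : ℝ)) (u (x, t)) ^ 2 * ‖sg u (x, t)‖ ^ 2))) x
                + 2 * ENNReal.ofReal (4 / δ ^ 2) * (ball (0 : Space d) m).indicator
                  (fun x => ENNReal.ofReal (xp x ^ 2 * trunc k' u (x, t) ^ 2)) x) := by
                refine lintegral_mono_ae ?_
                filter_upwards [ht] with x hx
                rw [hmr, show 1 / (δ / 2) ^ 2 = 4 / δ ^ 2 by field_simp; norm_num] at hx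
                refine (mul_le_mul_right hx _).trans ?_
                rw [mul_add]
                refine add_le_add ?_ ?_
                · by_cases hx1 : x ∈ ball (0 : Space d) 1
                  · rw [indicator_of_mem hx1, mul_assoc (xp x ^ 2),
                      ENNReal.ofReal_mul (p := xp x ^ 2) (sq_nonneg _),
                      ENNReal.ofReal_pow (xp_nonneg x), mul_left_comm]
                  · have : cutoff r' m x = 0 := by
                      refine cutoff_eq_zero hm1 ?_
                      simp only [mem_ball, dist_zero_right, not_lt] at hx1
                      linarith
                    simp [this]
                · by_cases hxm : x ∈ ball (0 : Space d) m
                  · rw [indicator_of_mem hxm, indicator_of_mem hxm,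
                      ENNReal.ofReal_mul (p := xp x ^ 2) (sq_nonneg _),
                      ENNReal.ofReal_pow (xp_nonneg x), mul_left_comm]
                  · simp [indicator_of_notMem hxm]
            _ = 2 * D t + 2 * ENNReal.ofReal (4 / δ ^ 2) * F m t := by
                have hTs : Measurable fun x : Space d => trunc k' u (x, t) := hTm.comp (by fun_prop)
                have hm1' : Measurable fun x : Space d => ENNReal.ofReal (xp x ^ 2 * cutoff r' m x ^ 2
                    * ((Iio k').indicator (fun _ => (1 : ℝ)) (u (x, t)) ^ 2
                      * ‖sg u (x, t)‖ ^ 2)) := by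
                  refine Measurable.ennreal_ofReal (((measurable_xp.pow_const 2).mul
                    (hηm.pow_const 2)).mul (Measurable.mul ?_ ?_))
                  · exact ((measurable_const.indicator measurableSet_Iio).comp
                      (hum.comp (by fun_prop))).pow_const 2
                  · exact (((measurable_sg u).comp (by fun_prop)).norm).pow_const 2
                have hm2' : Measurable fun x : Space d =>
                    ENNReal.ofReal (xp x ^ 2 * trunc k' u (x, t) ^ 2) :=
                  ((measurable_xp.pow_const 2).mul (hTs.pow_const 2)).ennreal_ofReal
                rw [lintegral_add_left ((hm1'.indicator measurableSet_ball).const_mul 2),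
                  lintegral_const_mul _ (hm1'.indicator measurableSet_ball),
                  lintegral_const_mul _ (hm2'.indicator measurableSet_ball),
                  lintegral_indicator measurableSet_ball,
                  lintegral_indicator measurableSet_ball]
  -- integration in time
  have hen := h.energy_le_levelMass (hkk.le.trans hk) hr' hm1 (hm2.trans hr)
    (neg_nonpos.2 hr'.le) le_rfl
  rw [hmr, hδ4] at hen
  have hDY : ∫⁻ t in Ioc (-r') 0, D t ≤ ENNReal.ofReal (32 * L ^ 5 / δ ^ 2) * levelMass u r k :=
    (le_add_self.trans hen).trans (by gcongr; exact levelMass_mono u hm2.le hkk.le)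
  have hFY : ∫⁻ t in Ioc (-r') 0, F m t ≤ levelMass u r k :=
    (lintegral_mono_set (Ioc_subset_Ioc_left (by linarith))).trans
      (levelMass_mono u hm2.le hkk.le)
  have hFm : Measurable fun t => F m t := by
    refine Measurable.lintegral_prod_left' (f := fun z : Space d × ℝ =>
      ENNReal.ofReal (xp z.1 ^ 2 * trunc k' u z ^ 2)) ?_
    exact (((measurable_xp.comp measurable_fst).pow_const 2).mul (hTm.pow_const 2)).ennreal_ofReal
  calc levelMass u r' k' = ∫⁻ t in Ioc (-r') 0, F r' t := rfl
    _ ≤ ∫⁻ t in Ioc (-r') 0, 20 * ENNReal.ofReal ϱ ^ 2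
          * (2 * D t + 2 * ENNReal.ofReal (4 / δ ^ 2) * F m t) :=
        lintegral_mono_ae ((ae_restrict_iff' measurableSet_Ioc).2 hsl)
    _ = 20 * ENNReal.ofReal ϱ ^ 2 * (2 * (∫⁻ t in Ioc (-r') 0, D t)
          + 2 * ENNReal.ofReal (4 / δ ^ 2) * ∫⁻ t in Ioc (-r') 0, F m t) := by
        rw [lintegral_const_mul' _ _ (by finiteness), lintegral_add_right _ (hFm.const_mul _),
          lintegral_const_mul' _ _ (by finiteness), lintegral_const_mul' _ _ (by finiteness)]
    _ ≤ 20 * ENNReal.ofReal ϱ ^ 2 * (2 * (ENNReal.ofReal (32 * L ^ 5 / δ ^ 2) * levelMass u r k)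
          + 2 * ENNReal.ofReal (4 / δ ^ 2) * levelMass u r k) := by gcongr
    _ = ENNReal.ofReal (20 * ϱ ^ 2 * (2 * (32 * L ^ 5 / δ ^ 2) + 2 * (4 / δ ^ 2)))
          * levelMass u r k := by
        rw [ENNReal.ofReal_mul (by positivity), ENNReal.ofReal_mul (by norm_num),
          ENNReal.ofReal_pow hϱ.le, ENNReal.ofReal_add (by positivity) (by positivity),
          ENNReal.ofReal_mul zero_le_two, ENNReal.ofReal_mul (p := 2) (q := 4 / δ ^ 2) zero_le_two]
        norm_num
        ring
    _ ≤ _ := by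
        gcongr
        -- The constant is `1440 = 20 * (64 + 8)`, after bounding the gradient-free contribution by
        -- `L ^ 5`.
        have h5 : 1 ≤ L ^ 5 := one_le_pow₀ h.one_le
        rw [show 20 * ϱ ^ 2 * (2 * (32 * L ^ 5 / δ ^ 2) + 2 * (4 / δ ^ 2))
          = 20 * ϱ ^ 2 * (64 * L ^ 5 + 8) / δ ^ 2 by ring]
        gcongr ?_ / _
        nlinarith [sq_nonneg ϱ, mul_nonneg (sq_nonneg ϱ) (sub_nonneg.2 h5)]

end Sol

/-- The De Giorgi lemma: if `u` is below the level `k` only on a small set, then it is not below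
`k / 2` in a smaller cylinder. -/
lemma exists_deGiorgi (d q : ℕ) {L : ℝ} (hL : 1 ≤ L) : ∃ ε : ℝ, 0 < ε ∧
    ∀ (g : Space d → ℝ) (b : Space d → Matrix (Fin (d + 1)) (Fin (d + 1)) ℝ) (c : ℝ → ℝ)
      (u : Space d × ℝ → ℝ), Sol L q g b c u → ∀ k : ℝ, 0 < k → k ≤ 1 →
      levelMass u (1 / 2) k ≤ ENNReal.ofReal (ε * k ^ 2) →
      ∀ x ∈ halfBall (0 : Space d) (1 / 4), ∀ t ∈ Ioc (-1 / 4 : ℝ) 0, k / 2 ≤ u (x, t) := by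
  obtain ⟨N, c₀, hc₀, hvol⟩ := exists_volume_le_ball d q
  have hL0 : 0 < L := by linarith
  -- With gaps in radius and level proportional to `2 ^ (-j)` and a Faber–Krahn radius `ϱ₀ 2 ^
  -- (-j)`, the smallness required at step `j` scales like `2 ^ (-(N + 4) j)`, that is `B ^ (-j)`.
  -- The mass has to decay at this rate for the induction to close.
  set B : ℝ := 16 * 2 ^ N with hB
  have hB0 : 0 < B := by positivity
  have hN1 : (1 : ℝ) ≤ 2 ^ N := one_le_pow₀ (by norm_num)
  have hL5 : 1 ≤ L ^ 5 := one_le_pow₀ hL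
  -- One step multiplies the mass by `1440 * 64 * L ^ 5 * ϱ₀ ^ 2`, since the gap in the radius is `w
  -- j / 8`. The choice makes this at most `1 / B`.
  set ϱ₀ : ℝ := 1 / (92160 * L ^ 5 * B) with hϱ₀
  have hϱ0 : 0 < ϱ₀ := by positivity
  have hϱ1 : ϱ₀ ≤ 1 := by
    rw [hϱ₀, div_le_one (by positivity)]
    nlinarith [mul_le_mul hL5 hN1 zero_le_one (by positivity)]
  -- This makes the smallness hypothesis of `deGiorgi_step` an equality at every step: `32768 = 32 *
  -- 64 * 16` collects the gaps `w j / 8` and `k w j / 4`.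
  set ε : ℝ := c₀ * ϱ₀ ^ N / (32768 * L ^ 5) with hε
  have hε0 : 0 < ε := by positivity
  refine ⟨ε, hε0, fun g b c u h k hk0 hk1 hY => ?_⟩
  have hum := h.measurable_u
  obtain ⟨Ku, hKu⟩ := h.lip
  set w : ℕ → ℝ := fun j => (1 / 2 : ℝ) ^ j with hw
  have hw0 : ∀ j, 0 < w j := fun j => by positivity
  have hw1 : ∀ j, w j ≤ 1 := fun j => pow_le_one₀ (by norm_num) (by norm_num)
  have hws : ∀ j, w (j + 1) = w j / 2 := fun j => by simp only [hw, pow_succ]; ring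
  have hind : ∀ j : ℕ, levelMass u (1 / 4 + 1 / 4 * w j) (k / 2 + k / 2 * w j)
      ≤ ENNReal.ofReal (ε * k ^ 2 * (1 / B) ^ j) := by
    intro j
    induction j with
    | zero =>
      simp only [hw, pow_zero, mul_one]
      convert hY using 2 <;> norm_num
    | succ j ih =>
      have hwj := hw0 j
      have e1 : 1 / 4 + 1 / 4 * w j - (1 / 4 + 1 / 4 * w (j + 1)) = w j / 8 := by
        rw [hws]; ring
      have e2 : k / 2 + k / 2 * w j - (k / 2 + k / 2 * w (j + 1)) = k * w j / 4 := by
        rw [hws]; ring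
      have hwB : w j ^ 2 * w j ^ 2 * w j ^ N = (1 / B) ^ j := by
        simp only [hw, hB]
        rw [← pow_mul, ← pow_mul, ← pow_add, ← pow_add, show (16 : ℝ) = 2 ^ 4 by norm_num,
          ← pow_add, one_div, inv_pow, one_div, inv_pow, ← pow_mul]
        congr 2
        ring
      have hstep := h.deGiorgi_step hvol (k := k / 2 + k / 2 * w j)
        (k' := k / 2 + k / 2 * w (j + 1)) (r := 1 / 4 + 1 / 4 * w j)
        (r' := 1 / 4 + 1 / 4 * w (j + 1)) (ϱ := ϱ₀ * w j) (by nlinarith [hw1 j])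
        (by rw [← sub_pos, e2]; positivity) (by have := hw0 (j + 1); positivity)
        (by rw [← sub_pos, e1]; positivity) (by linarith [hw1 j]) (by positivity) ?_
      · rw [e1] at hstep
        refine hstep.trans ?_
        calc _ ≤ ENNReal.ofReal (1440 * L ^ 5 * (ϱ₀ * w j) ^ 2 / (w j / 8) ^ 2)
              * ENNReal.ofReal (ε * k ^ 2 * (1 / B) ^ j) := by gcongr
          _ ≤ _ := by
              rw [← ENNReal.ofReal_mul (by positivity)]
              refine ENNReal.ofReal_le_ofReal ?_
              have e3 : 1440 * L ^ 5 * (ϱ₀ * w j) ^ 2 / (w j / 8) ^ 2 = 92160 * L ^ 5 * ϱ₀ ^ 2 := by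
                field_simp
                ring
              have e4 : 92160 * L ^ 5 * ϱ₀ ^ 2 ≤ 1 / B := by
                calc 92160 * L ^ 5 * ϱ₀ ^ 2 = 92160 * L ^ 5 * ϱ₀ * ϱ₀ := by ring
                  _ ≤ 92160 * L ^ 5 * ϱ₀ * 1 := by gcongr
                  _ = 1 / B := by rw [hϱ₀]; field_simp
              rw [e3]
              calc _ ≤ 1 / B * (ε * k ^ 2 * (1 / B) ^ j) := by gcongr
                _ = _ := by ring
      · rw [e1, e2]
        refine (mul_le_mul_right ih _).trans ?_
        rw [← ENNReal.ofReal_mul (by positivity)]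
        refine ENNReal.ofReal_le_ofReal (le_of_eq ?_)
        rw [← hwB, hε]
        field_simp
        ring
  have hzero : levelMass u (1 / 4) (k / 2) = 0 := by
    have hle : ∀ j : ℕ, levelMass u (1 / 4) (k / 2) ≤ ENNReal.ofReal (ε * k ^ 2 * (1 / B) ^ j) :=
      fun j => (levelMass_mono u (by linarith [hw0 j]) (by nlinarith [hw0 j])).trans (hind j)
    have hlim : Tendsto (fun j : ℕ => ENNReal.ofReal (ε * k ^ 2 * (1 / B) ^ j)) atTop (𝓝 0) := by
      have hB1 : 1 / B < 1 := by
        rw [div_lt_one hB0]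
        linarith
      have := (tendsto_pow_atTop_nhds_zero_of_lt_one (by positivity) hB1).const_mul (ε * k ^ 2)
      simpa using ENNReal.tendsto_ofReal this
    exact le_antisymm (ge_of_tendsto' hlim hle) bot_le
  -- conclusion by continuity
  intro x hx t ht
  by_contra hlt
  push Not at hlt
  have hxo : IsOpen (halfBall (0 : Space d) (1 / 4)) :=
    isOpen_ball.inter (isOpen_lt continuous_const (by fun_prop))
  set O : Set (Space d × ℝ) :=
    (halfBall (0 : Space d) (1 / 4) ×ˢ Ioo (-(1 / 4 : ℝ)) 0) ∩ {z | u z < k / 2} with hO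
  have hOo : IsOpen O := (hxo.prod isOpen_Ioo).inter (isOpen_lt hKu.continuous continuous_const)
  -- Since `t = 0` is allowed, one moves slightly back in time to land in the open cylinder.
  have hOne : O.Nonempty := by
    have hev : ∀ᶠ s in 𝓝[<] t, u (x, s) < k / 2 := by
      have hc : ContinuousAt (fun s => u (x, s)) t :=
        (lipschitzWith_slice_time hKu x).continuous.continuousAt
      exact (hc.eventually (gt_mem_nhds hlt)).filter_mono nhdsWithin_le_nhds
    have hev2 : ∀ᶠ s in 𝓝[<] t, s ∈ Ioo (-(1 / 4 : ℝ)) t :=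
      Ioo_mem_nhdsLT (by have := ht.1; linarith)
    obtain ⟨s, hs1, hs2⟩ := (hev.and hev2).exists
    exact ⟨(x, s), ⟨hx, hs2.1, hs2.2.trans_le ht.2⟩, hs1⟩
  have hpos : 0 < volume O := hOo.measure_pos volume hOne
  have hTm := h.measurable_trunc (k / 2)
  have hfm : Measurable fun z : Space d × ℝ => ENNReal.ofReal (xp z.1 ^ 2 * trunc (k / 2) u z ^ 2) :=
    (((measurable_xp.comp measurable_fst).pow_const 2).mul (hTm.pow_const 2)).ennreal_ofReal
  have hz2 : ∫⁻ z in ball (0 : Space d) (1 / 4) ×ˢ Ioc (-(1 / 4 : ℝ)) 0,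
      ENNReal.ofReal (xp z.1 ^ 2 * trunc (k / 2) u z ^ 2) = 0 := by
    rw [Measure.volume_eq_prod, ← Measure.prod_restrict, lintegral_prod_symm _ hfm.aemeasurable]
    exact hzero
  rw [lintegral_eq_zero_iff hfm, Filter.EventuallyEq,
    ae_restrict_iff' (measurableSet_ball.prod measurableSet_Ioc)] at hz2
  refine hpos.ne' (measure_mono_null (fun z hz => ?_) (ae_iff.1 hz2))
  obtain ⟨⟨hz1, hz2⟩, hz3⟩ := hz
  simp only [mem_ofPred_eq, Classical.not_imp]
  refine ⟨⟨hz1.1, hz2.1, hz2.2.le⟩, ?_⟩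
  have hxpos : 0 < xp z.1 := lt_max_of_lt_left hz1.2
  have hTpos : 0 < trunc (k / 2) u z := lt_max_of_lt_left (by
    have : u z < k / 2 := hz3
    linarith)
  simpa using by positivity

/-! ### The logarithmic estimate and propagation of positivity -/

/-- The primitive of the time coefficient in the logarithmic estimate. -/
def logPrim (c : ℝ → ℝ) (h s : ℝ) : ℝ := ∫ τ in s..1, c τ * (max τ 0 + h)⁻¹

/-- The maximum with 0 only serves to define a continuous integrand on the whole line; the values of
`u` lie in `[0, 1]`. -/
lemma continuous_inv_max_add {h : ℝ} (hh : 0 < h) : Continuous fun τ : ℝ => (max τ 0 + h)⁻¹ := by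
  refine Continuous.inv₀ (by fun_prop) fun τ => ?_
  have := le_max_right τ 0
  linarith

lemma integral_inv_max_add {h s : ℝ} (hh : 0 < h) (hs : 0 ≤ s) (hs1 : s ≤ 1) :
    ∫ τ in s..1, (max τ 0 + h)⁻¹ = Real.log ((1 + h) / (s + h)) := by
  have h1 : ∫ τ in s..1, (max τ 0 + h)⁻¹ = ∫ τ in s..1, (τ + h)⁻¹ := by
    refine intervalIntegral.integral_congr fun τ hτ => ?_
    rw [uIcc_of_le hs1] at hτ
    simp [hs.trans hτ.1]
  rw [h1, intervalIntegral.integral_comp_add_right (fun x => x⁻¹) h,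
    integral_inv_of_pos (by linarith) (by linarith)]

namespace Sol

variable {L : ℝ} {q : ℕ} {g : Space d → ℝ} {b : Space d → Matrix (Fin (d + 1)) (Fin (d + 1)) ℝ}
  {c : ℝ → ℝ} {u : Space d × ℝ → ℝ}

lemma logPrim_le (h : Sol L q g b c u) {a s : ℝ} (ha : 0 < a) (hs : s ∈ Icc (0 : ℝ) 1) :
    logPrim c a s ≤ L * Real.log ((1 + a) / (s + a)) := by
  rw [logPrim, ← integral_inv_max_add ha hs.1 hs.2, ← intervalIntegral.integral_const_mul]
  have hc := continuous_inv_max_add ha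
  refine intervalIntegral.integral_mono_on hs.2 ((h.c_cont.mul hc).intervalIntegrable _ _)
    ((continuous_const.mul hc).intervalIntegrable _ _) fun τ _ => ?_
  have : 0 ≤ (max τ 0 + a)⁻¹ := inv_nonneg.2 (by have := le_max_right τ 0; linarith)
  exact mul_le_mul_of_nonneg_right (h.c_upper τ) this

lemma le_logPrim (h : Sol L q g b c u) {a s : ℝ} (ha : 0 < a) (hs : s ∈ Icc (0 : ℝ) 1) :
    L⁻¹ * Real.log ((1 + a) / (s + a)) ≤ logPrim c a s := by
  rw [logPrim, ← integral_inv_max_add ha hs.1 hs.2, ← intervalIntegral.integral_const_mul]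
  have hc := continuous_inv_max_add ha
  refine intervalIntegral.integral_mono_on hs.2 ((continuous_const.mul hc).intervalIntegrable _ _)
    ((h.c_cont.mul hc).intervalIntegrable _ _) fun τ _ => ?_
  have : 0 ≤ (max τ 0 + a)⁻¹ := inv_nonneg.2 (by have := le_max_right τ 0; linarith)
  exact mul_le_mul_of_nonneg_right (h.c_lower τ) this

lemma logPrim_nonneg (h : Sol L q g b c u) {a s : ℝ} (ha : 0 < a) (hs : s ∈ Icc (0 : ℝ) 1) :
    0 ≤ logPrim c a s := by
  refine le_trans (mul_nonneg (inv_nonneg.2 h.L_pos.le) (Real.log_nonneg ?_)) (h.le_logPrim ha hs)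
  rw [le_div_iff₀ (by linarith [hs.1])]
  linarith [hs.2]

lemma logPrim_sub (h : Sol L q g b c u) {a s s' : ℝ} (ha : 0 < a) :
    logPrim c a s - logPrim c a s' = ∫ τ in s..s', c τ * (max τ 0 + a)⁻¹ := by
  have hc : Continuous fun τ => c τ * (max τ 0 + a)⁻¹ :=
    h.c_cont.mul (continuous_inv_max_add ha)
  rw [logPrim, logPrim]
  have := intervalIntegral.integral_add_adjacent_intervals
    (hc.intervalIntegrable (μ := volume) s s') (hc.intervalIntegrable s' 1)
  linarith

lemma logPrim_anti (h : Sol L q g b c u) {a s s' : ℝ} (ha : 0 < a) (hss : s ≤ s') :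
    logPrim c a s' ≤ logPrim c a s := by
  rw [← sub_nonneg, h.logPrim_sub ha]
  refine intervalIntegral.integral_nonneg hss fun τ _ => mul_nonneg (h.c_nonneg τ)
    (inv_nonneg.2 ?_)
  have := le_max_right τ 0
  linarith

lemma continuous_logPrim (h : Sol L q g b c u) {a : ℝ} (ha : 0 < a) : Continuous (logPrim c a) := by
  have hcc := h.c_cont.mul (continuous_inv_max_add ha)
  exact continuous_iff_continuousAt.2 fun s =>
    (intervalIntegral.integral_hasDerivAt_left (hcc.intervalIntegrable _ _)
      (hcc.stronglyMeasurableAtFilter _ _) hcc.continuousAt).continuousAt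

lemma integrableOn_weight (h : Sol L q g b c u) {η F : Space d → ℝ} (hη : Measurable η)
    (hη0 : ∀ x, 0 ≤ η x) (hη1 : ∀ x, η x ≤ 1) (hF : Measurable F) {C : ℝ} (hC : ∀ x, |F x| ≤ C) :
    IntegrableOn (fun x => g x * η x ^ 2 * F x) (ball (0 : Space d) 1) := by
  refine Measure.integrableOn_of_bounded (M := L * 1 * C) measure_ball_lt_top.ne
    (AEMeasurable.aestronglyMeasurable ?_)
    ((ae_restrict_iff' measurableSet_ball).2 (Eventually.of_forall fun x hx => ?_))
  · exact (h.g_meas.mul (hη.pow_const 2).aemeasurable).mul hF.aemeasurable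
  · rw [norm_mul, norm_mul, Real.norm_of_nonneg (sq_nonneg _)]
    have hL := h.L_pos
    gcongr
    · exact h.abs_g_le hx
    · exact pow_le_one₀ (hη0 x) (hη1 x)
    · exact hC x

/-- The logarithmic energy estimate. -/
lemma log_energy (h : Sol L q g b c u) {a : ℝ} (ha : 0 < a) (ha1 : a ≤ 1)
    {η : Space d → ℝ} {Kη : NNReal} (hη : LipschitzWith Kη η)
    (hη0 : ∀ x, 0 ≤ η x) (hη1 : ∀ x, η x ≤ 1) {ρ : ℝ} (hρ : ρ < 1)
    (hηρ : ∀ x, ρ ≤ ‖x‖ → η x = 0) {t₁ t₂ : ℝ} (ht₁ : -1 ≤ t₁) (h12 : t₁ ≤ t₂) (ht₂ : t₂ ≤ 0) :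
    (∫ x in ball (0 : Space d) 1, g x * η x ^ 2 * logPrim c a (u (x, t₂)))
      + 1 / (2 * L) * (∫ z in ball (0 : Space d) 1 ×ˢ Ioc t₁ t₂,
          xp z.1 ^ 2 * η z.1 ^ 2 * ((max (u z) 0 + a)⁻¹ ^ 2 * ‖sg u z‖ ^ 2))
      ≤ (∫ x in ball (0 : Space d) 1, g x * η x ^ 2 * logPrim c a (u (x, t₁)))
      + 2 * L ^ 3 * Kη ^ 2 * (volume (ball (0 : Space d) 1)).toReal := by
  obtain ⟨Ku, hKu⟩ := h.lip
  have hL := h.L_pos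
  have hmax : ∀ z, max (u z) 0 = u z := fun z => max_eq_left (h.nonneg z)
  have hψa : ∀ s : ℝ, |(max s 0 + a)⁻¹| ≤ a⁻¹ := fun s => by
    have := le_max_right s 0
    rw [abs_of_nonneg (inv_nonneg.2 (by linarith))]
    exact inv_anti₀ ha (by linarith)
  have hψL : LipschitzWith ((a ^ 2)⁻¹.toNNReal * Ku) fun z => (max (u z) 0 + a)⁻¹ := by
    have h1 : LipschitzWith ((a ^ 2)⁻¹.toNNReal) fun s : ℝ => (max s 0 + a)⁻¹ := by
      refine LipschitzWith.of_dist_le_mul fun s s' => ?_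
      have h2 := le_max_right s 0
      have h3 := le_max_right s' 0
      rw [Real.coe_toNNReal _ (by positivity), Real.dist_eq, Real.dist_eq,
        inv_sub_inv (by linarith) (by linarith), abs_div, inv_mul_eq_div]
      have e1 : |max s' 0 + a - (max s 0 + a)| ≤ |s - s'| := by
        rw [add_sub_add_right_eq_sub, abs_sub_comm s s']
        exact (abs_max_sub_max_le_abs _ _ _)
      have e2 : a ^ 2 ≤ |(max s 0 + a) * (max s' 0 + a)| := by
        rw [abs_of_nonneg (by positivity), sq]
        gcongr <;> linarith
      gcongr
    exact h1.comp hKu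
  -- For `ψ = θ = 1 / (s + a)` one has `ψ' = -θ ^ 2`, and `ψ = ω θ` with `ω = 1`. So the error term
  -- does not involve `u` or `a`, and the dissipation is that of `log (u + a)`.
  have hE := h.energy hη hη0 hη1 hρ hηρ (ψ := fun s => (max s 0 + a)⁻¹)
    (θ := fun s => (max s 0 + a)⁻¹) (ω := fun _ => 1) (continuous_inv_max_add ha)
    (continuous_inv_max_add ha).measurable measurable_const hψL (C := a⁻¹)
    (fun s _ => hψa s) (fun s _ => hψa s)
    (fun s _ => by rw [abs_one]; exact (one_le_inv₀ ha).2 ha1) (fun s _ => by rw [one_mul])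
    (by
      filter_upwards [hKu.ae_differentiableAt (μ := volume)] with z hz
      have hne : u z + a ≠ 0 := by have := h.nonneg z; linarith
      have e : (fun y => (max (u y) 0 + a)⁻¹) = fun y => (fun s => (s + a)⁻¹) (u y) := by
        ext y; rw [hmax]
      have hd : HasDerivAt (fun s : ℝ => (s + a)⁻¹) (-1 / (u z + a) ^ 2) (u z) :=
        ((hasDerivAt_id' (u z)).add_const a).fun_inv hne
      rw [e, sg_comp hz hd, hmax]
      congr 1
      field_simp) ht₁ h12 ht₂
  have hind : ∫ z in ball (0 : Space d) 1 ×ˢ Ioc t₁ t₂,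
      (ball (0 : Space d) ρ).indicator (fun _ => (1 : ℝ)) z.1 * (xp z.1 ^ 2 * 1 ^ 2)
      ≤ (volume (ball (0 : Space d) 1)).toReal := by
    have hV : ∫ z in ball (0 : Space d) 1 ×ˢ Ioc t₁ t₂, (1 : ℝ)
        = (volume (ball (0 : Space d) 1)).toReal * (t₂ - t₁) := by
      rw [setIntegral_const, smul_eq_mul, mul_one, measureReal_def, Measure.volume_eq_prod,
        Measure.prod_prod, ENNReal.toReal_mul, Real.volume_Ioc, ENNReal.toReal_ofReal (by linarith)]
    have hmono : ∫ z in ball (0 : Space d) 1 ×ˢ Ioc t₁ t₂,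
        (ball (0 : Space d) ρ).indicator (fun _ => (1 : ℝ)) z.1 * (xp z.1 ^ 2 * 1 ^ 2)
        ≤ ∫ z in ball (0 : Space d) 1 ×ˢ Ioc t₁ t₂, (1 : ℝ) := by
      have hle : ∀ z : Space d × ℝ, z.1 ∈ ball (0 : Space d) 1 →
          (ball (0 : Space d) ρ).indicator (fun _ => (1 : ℝ)) z.1 * (xp z.1 ^ 2 * 1 ^ 2) ≤ 1 := by
        intro z hz
        rw [one_pow, mul_one]
        exact mul_le_one₀ (indicator_le_self' (fun _ _ => zero_le_one) _) (sq_nonneg _)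
          (pow_le_one₀ (xp_nonneg _) (xp_le_one hz))
      refine setIntegral_mono_on (integrableOn_cyl (Measurable.aestronglyMeasurable ?_) 1
        fun z hz => ?_) (integrableOn_cyl aestronglyMeasurable_const 1 (by simp))
        (measurableSet_cyl _ _) fun z hz => hle z hz.1
      · exact ((measurable_const.indicator measurableSet_ball).comp measurable_fst).mul
          (((measurable_xp.comp measurable_fst).pow_const 2).mul measurable_const)
      · rw [abs_of_nonneg (mul_nonneg (indicator_nonneg (fun _ _ => zero_le_one) _)
          (by positivity))]
        exact hle z hz
    refine hmono.trans (hV.le.trans (mul_le_of_le_one_right ENNReal.toReal_nonneg (by linarith)))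
  have hind' : 2 * L ^ 3 * Kη ^ 2 * (∫ z in ball (0 : Space d) 1 ×ˢ Ioc t₁ t₂,
      (ball (0 : Space d) ρ).indicator (fun _ => (1 : ℝ)) z.1 * (xp z.1 ^ 2 * 1 ^ 2))
      ≤ 2 * L ^ 3 * Kη ^ 2 * (volume (ball (0 : Space d) 1)).toReal := by gcongr
  change ∫ x in ball (0 : Space d) 1, g x * η x ^ 2 * logPrim c a (u (x, t₂))
    ≤ (∫ x in ball (0 : Space d) 1, g x * η x ^ 2 * logPrim c a (u (x, t₁))) - _ + _ at hE
  have h3 := hE.trans (add_le_add le_rfl hind')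
  linarith

set_option maxHeartbeats 400000 in
/-- The positivity set of `u` does not shrink in time, up to lowering the level. -/
lemma weight_superlevel_ge (h : Sol L q g b c u) {a n₀ : ℝ} (ha : 0 < a) (ha1 : a ≤ 1)
    {η : Space d → ℝ} {Kη : NNReal} (hη : LipschitzWith Kη η)
    (hη0 : ∀ x, 0 ≤ η x) (hη1 : ∀ x, η x ≤ 1) {ρ : ℝ} (hρ : ρ < 1)
    (hηρ : ∀ x, ρ ≤ ‖x‖ → η x = 0) {t₁ t₂ : ℝ} (ht₁ : -1 ≤ t₁) (h12 : t₁ ≤ t₂) (ht₂ : t₂ ≤ 0)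
    (hn₀ : 0 < n₀) (hN : n₀ ≤ ∫ x in ball (0 : Space d) 1, g x * η x ^ 2)
    (hhalf : (∫ x in ball (0 : Space d) 1, g x * η x ^ 2) / 2
      ≤ ∫ x in ball (0 : Space d) 1, g x * η x ^ 2
        * {x | 1 / 2 ≤ u (x, t₁)}.indicator (fun _ => 1) x)
    (hlog : 2 * L + 2 * L ^ 3 * Kη ^ 2 * (volume (ball (0 : Space d) 1)).toReal / n₀
      ≤ L⁻¹ * Real.log (1 / (2 * a)) / 4) :
    n₀ / 4 ≤ ∫ x in ball (0 : Space d) 1, g x * η x ^ 2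
        * {x | a ≤ u (x, t₂)}.indicator (fun _ => 1) x := by
  have hL := h.L_pos
  have hum := h.measurable_u
  have hηm : Measurable η := hη.continuous.measurable
  set V := (volume (ball (0 : Space d) 1)).toReal with hV
  have hV0 : 0 ≤ V := ENNReal.toReal_nonneg
  have hE := h.log_energy ha ha1 hη hη0 hη1 hρ hηρ ht₁ h12 ht₂
  have hgrad : 0 ≤ 1 / (2 * L) * (∫ z in ball (0 : Space d) 1 ×ˢ Ioc t₁ t₂,
      xp z.1 ^ 2 * η z.1 ^ 2 * ((max (u z) 0 + a)⁻¹ ^ 2 * ‖sg u z‖ ^ 2)) :=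
    mul_nonneg (by positivity)
      (setIntegral_nonneg (measurableSet_cyl _ _) fun z _ => by positivity)
  set N := ∫ x in ball (0 : Space d) 1, g x * η x ^ 2 with hNdef
  set Λ₀ := logPrim c a 0 with hΛ₀
  set Λa := logPrim c a a with hΛa
  have ha01 : a ∈ Icc (0 : ℝ) 1 := ⟨ha.le, ha1⟩
  have h001 : (0 : ℝ) ∈ Icc (0 : ℝ) 1 := ⟨le_rfl, zero_le_one⟩
  have hlog2 : Real.log 2 ≤ 1 := by linarith [Real.log_two_lt_d9]
  have hsm : ∀ t, Measurable fun x : Space d => u (x, t) := fun t => hum.comp (by fun_prop)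
  have hset : ∀ t s : ℝ, MeasurableSet {x : Space d | s ≤ u (x, t)} := fun t s =>
    measurableSet_le measurable_const (hsm t)
  have hindm : ∀ t s : ℝ, Measurable
      ({x : Space d | s ≤ u (x, t)}.indicator fun _ => (1 : ℝ)) := fun t s =>
    measurable_const.indicator (hset t s)
  have hindb : ∀ t s : ℝ, ∀ x, |{x : Space d | s ≤ u (x, t)}.indicator (fun _ => (1 : ℝ)) x| ≤ 1 := by
    intro t s x
    by_cases hx : x ∈ {x : Space d | s ≤ u (x, t)}
    · rw [indicator_of_mem hx, abs_one]
    · rw [indicator_of_notMem hx, abs_zero]; exact zero_le_one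
  have hiN : IntegrableOn (fun x => g x * η x ^ 2) (ball (0 : Space d) 1) := by
    simpa using h.integrableOn_weight hηm hη0 hη1 (F := fun _ => 1) measurable_const (C := 1)
      (by simp)
  have hiI : ∀ t s : ℝ, IntegrableOn (fun x => g x * η x ^ 2
      * {x : Space d | s ≤ u (x, t)}.indicator (fun _ => 1) x) (ball (0 : Space d) 1) := fun t s =>
    h.integrableOn_weight hηm hη0 hη1 (hindm t s) (hindb t s)
  have hiΛ : ∀ t, IntegrableOn (fun x => g x * η x ^ 2 * logPrim c a (u (x, t)))
      (ball (0 : Space d) 1) := fun t =>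
    h.integrableOn_weight hηm hη0 hη1 ((h.continuous_logPrim ha).measurable.comp (hsm t))
      (C := Λ₀) (fun x => by
        rw [abs_of_nonneg (h.logPrim_nonneg ha (h.mem_Icc _))]
        exact h.logPrim_anti ha (h.nonneg _))
  set P := ∫ x in ball (0 : Space d) 1, g x * η x ^ 2
        * {x | 1 / 2 ≤ u (x, t₁)}.indicator (fun _ => 1) x with hP
  set m := ∫ x in ball (0 : Space d) 1, g x * η x ^ 2
        * {x | a ≤ u (x, t₂)}.indicator (fun _ => 1) x with hm
  -- At the initial time the primitive is at most `L` where `u ≥ 1/2`, because the logarithm there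
  -- is at most `log 2 ≤ 1`; elsewhere it is at most its value `Λ₀` at 0.
  have hup : ∫ x in ball (0 : Space d) 1, g x * η x ^ 2 * logPrim c a (u (x, t₁))
      ≤ Λ₀ * N - Λ₀ * P + L * N := by
    have hsub := integral_sub (hiN.const_mul Λ₀) ((hiI t₁ (1 / 2)).const_mul Λ₀)
    have hadd := integral_add ((hiN.const_mul Λ₀).sub ((hiI t₁ (1 / 2)).const_mul Λ₀))
      (hiN.const_mul L)
    simp only [Pi.sub_apply] at hadd hsub
    rw [hNdef, hP, ← integral_const_mul, ← integral_const_mul, ← integral_const_mul,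
      ← hsub, ← hadd]
    refine setIntegral_mono_on (hiΛ t₁)
      (((hiN.const_mul _).sub ((hiI t₁ (1 / 2)).const_mul _)).add (hiN.const_mul _))
      measurableSet_ball fun x hx => ?_
    have hw : 0 ≤ g x * η x ^ 2 := mul_nonneg (h.g_nonneg hx) (sq_nonneg _)
    by_cases hx2 : x ∈ {x : Space d | 1 / 2 ≤ u (x, t₁)}
    · rw [indicator_of_mem hx2]
      have h2 : (1 / 2 : ℝ) ≤ u (x, t₁) := hx2
      have h1 : logPrim c a (u (x, t₁)) ≤ L := by
        refine (h.logPrim_le ha (h.mem_Icc _)).trans ?_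
        have : Real.log ((1 + a) / (u (x, t₁) + a)) ≤ Real.log 2 := by
          refine Real.log_le_log (by positivity) ?_
          rw [div_le_iff₀ (by linarith)]
          linarith
        nlinarith
      nlinarith [mul_le_mul_of_nonneg_left h1 hw]
    · rw [indicator_of_notMem hx2]
      have h1 : logPrim c a (u (x, t₁)) ≤ Λ₀ := h.logPrim_anti ha (h.nonneg _)
      nlinarith [mul_le_mul_of_nonneg_left h1 hw, mul_nonneg hL.le hw]
  -- At the final time the primitive is at least `Λa` wherever `u < a`.
  have hlow : Λa * N - Λa * m
      ≤ ∫ x in ball (0 : Space d) 1, g x * η x ^ 2 * logPrim c a (u (x, t₂)) := by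
    rw [hNdef, hm, ← integral_const_mul, ← integral_const_mul,
      ← integral_sub (hiN.const_mul _) ((hiI t₂ a).const_mul _)]
    refine setIntegral_mono_on ((hiN.const_mul _).sub ((hiI t₂ a).const_mul _)) (hiΛ t₂)
      measurableSet_ball fun x hx => ?_
    have hw : 0 ≤ g x * η x ^ 2 := mul_nonneg (h.g_nonneg hx) (sq_nonneg _)
    by_cases hx2 : x ∈ {x : Space d | a ≤ u (x, t₂)}
    · rw [indicator_of_mem hx2]
      have h1 := mul_nonneg hw (h.logPrim_nonneg ha (h.mem_Icc (x, t₂)))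
      linarith
    · rw [indicator_of_notMem hx2]
      have h2 : ¬ a ≤ u (x, t₂) := hx2
      have h1 : Λa ≤ logPrim c a (u (x, t₂)) := h.logPrim_anti ha (not_le.1 h2).le
      nlinarith [mul_le_mul_of_nonneg_left h1 hw]
  -- Between 0 and `a` the integrand is at most `L / a`. So the two extreme values differ by a
  -- bounded amount, although both grow like `log (1 / a)`.
  have hΛdiff : Λ₀ - Λa ≤ L := by
    rw [hΛ₀, hΛa, h.logPrim_sub ha]
    calc ∫ τ in (0 : ℝ)..a, c τ * (max τ 0 + a)⁻¹ ≤ ∫ τ in (0 : ℝ)..a, L * a⁻¹ := by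
          refine intervalIntegral.integral_mono_on ha.le
            ((h.c_cont.mul (continuous_inv_max_add ha)).intervalIntegrable _ _)
            (continuous_const.intervalIntegrable _ _) fun τ hτ => ?_
          have h1 : (max τ 0 + a)⁻¹ ≤ a⁻¹ := inv_anti₀ ha (by have := le_max_right τ 0; linarith)
          have h2 : 0 ≤ (max τ 0 + a)⁻¹ := inv_nonneg.2 (by have := le_max_right τ 0; linarith)
          exact mul_le_mul (h.c_upper τ) h1 h2 hL.le
      _ = L := by
          rw [intervalIntegral.integral_const, smul_eq_mul]
          field_simp
          ring
  have hΛage : L⁻¹ * Real.log (1 / (2 * a)) ≤ Λa := by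
    refine le_trans ?_ (h.le_logPrim ha ha01)
    gcongr
    · linarith
    · linarith
  set W := 2 * L ^ 3 * (Kη : ℝ) ^ 2 * V with hW
  have hW0 : 0 ≤ W := by positivity
  have hN0 : 0 < N := hn₀.trans_le hN
  have hlog' : 2 * L + W / n₀ ≤ Λa / 4 := by linarith only [hlog, hΛage]
  have hWN : W ≤ W / n₀ * N := by
    rw [div_mul_eq_mul_div, le_div_iff₀ hn₀]
    exact mul_le_mul_of_nonneg_left hN hW0
  have hΛa0 : 0 < Λa := by
    have : 0 ≤ W / n₀ := by positivity
    linarith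
  have hΛ₀0 : 0 ≤ Λ₀ := h.logPrim_nonneg ha h001
  have hPN : Λ₀ * (N / 2) ≤ Λ₀ * P := mul_le_mul_of_nonneg_left hhalf hΛ₀0
  have key : Λa * N - Λa * m ≤ Λ₀ * (N / 2) + L * N + W := by
    linarith only [hlow, hE, hup, hgrad, hPN]
  have key2 : Λ₀ * (N / 2) ≤ Λa * (N / 2) + L * (N / 2) := by
    have := mul_le_mul_of_nonneg_right hΛdiff (by positivity : 0 ≤ N / 2)
    linarith only [this]
  have key3 : (2 * L + W / n₀) * N ≤ Λa / 4 * N := mul_le_mul_of_nonneg_right hlog' hN0.le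
  -- The leading terms give `Λa (N - m) ≤ Λa N / 2` up to errors of order `L N + W`. By the choice
  -- of `a` these are at most `Λa N / 4`, and a quarter of the mass remains for `m`.
  have key4 : Λa * (N / 4) ≤ Λa * m := by
    have hLN : 0 ≤ L * N := by positivity
    have e : (2 * L + W / n₀) * N = 2 * (L * N) + W / n₀ * N := by ring
    rw [e] at key3
    linarith only [hLN, key, key2, key3, hWN]
  have := le_of_mul_le_mul_left key4 hΛa0
  linarith

end Sol

/-! ### From positivity in measure to a pointwise lower bound -/

/-- The volume of the unit ball, as a real number. -/
def unitVol (d : ℕ) : ℝ := (volume (ball (0 : Space d) 1)).toReal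

lemma unitVol_nonneg (d : ℕ) : 0 ≤ unitVol d := ENNReal.toReal_nonneg

lemma ofReal_unitVol (d : ℕ) : ENNReal.ofReal (unitVol d) = volume (ball (0 : Space d) 1) :=
  ENNReal.ofReal_toReal measure_ball_lt_top.ne

lemma unitVol_pos (d : ℕ) : 0 < unitVol d :=
  ENNReal.toReal_pos (measure_ball_pos _ _ one_pos).ne' measure_ball_lt_top.ne

lemma isOpen_halfBall (x₀ : Space d) (R : ℝ) : IsOpen (halfBall x₀ R) :=
  isOpen_ball.inter (isOpen_lt continuous_const (by fun_prop))

lemma halfBall_zero_nonempty {R : ℝ} (hR : 0 < R) : (halfBall (0 : Space d) R).Nonempty := by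
  refine ⟨EuclideanSpace.single (Fin.last d) (R / 2), ?_, ?_⟩
  · rw [mem_ball_zero_iff, PiLp.norm_single, Real.norm_of_nonneg (by linarith)]
    linarith
  · change 0 < (EuclideanSpace.single (Fin.last d) (R / 2)) (Fin.last d)
    simpa using hR

lemma xp_eq_zero_of_notMem_halfBall {x : Space d} {R : ℝ} (hx : x ∈ ball (0 : Space d) R)
    (hx' : x ∉ halfBall (0 : Space d) R) : xp x = 0 :=
  max_eq_right (not_lt.1 fun h => hx' ⟨hx, h⟩)

lemma integral_xp_pow_pos (d q : ℕ) {R : ℝ} (hR : 0 < R) (hR1 : R ≤ 1) :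
    0 < ∫ x in ball (0 : Space d) R, xp x ^ q := by
  have hi : IntegrableOn (fun x : Space d => xp x ^ q) (ball (0 : Space d) R) := by
    refine Measure.integrableOn_of_bounded (M := 1) measure_ball_lt_top.ne
      (measurable_xp.pow_const q).aestronglyMeasurable
      ((ae_restrict_iff' measurableSet_ball).2 (Eventually.of_forall fun x hx => ?_))
    rw [Real.norm_of_nonneg (pow_nonneg (xp_nonneg x) _)]
    exact pow_le_one₀ (xp_nonneg x) (xp_le_one (ball_subset_ball hR1 hx))
  rw [setIntegral_pos_iff_support_of_nonneg_ae
    (Eventually.of_forall fun x => pow_nonneg (xp_nonneg x) q) hi]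
  refine lt_of_lt_of_le ((isOpen_halfBall (0 : Space d) R).measure_pos volume
    (halfBall_zero_nonempty hR)) (measure_mono fun x hx => ⟨?_, hx.1⟩)
  have : 0 < xp x := lt_max_of_lt_left hx.2
  exact (pow_pos this q).ne'

lemma coe_toNNReal_sq_four : (((1 / ((1 / 2 : ℝ) - 1 / 4)).toNNReal : NNReal) : ℝ) ^ 2 = 16 := by
  rw [Real.coe_toNNReal _ (by norm_num)]
  norm_num

lemma coe_toNNReal_sq_four' : (((1 / ((3 / 4 : ℝ) - 1 / 2)).toNNReal : NNReal) : ℝ) ^ 2 = 16 := by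
  rw [Real.coe_toNNReal _ (by norm_num)]
  norm_num

namespace Sol

variable {L : ℝ} {q : ℕ} {g : Space d → ℝ} {b : Space d → Matrix (Fin (d + 1)) (Fin (d + 1)) ℝ}
  {c : ℝ → ℝ} {u : Space d × ℝ → ℝ}

lemma measurable_slice (h : Sol L q g b c u) (t : ℝ) : Measurable fun x : Space d => u (x, t) :=
  h.measurable_u.comp (by fun_prop)

lemma measurableSet_superlevel (h : Sol L q g b c u) (a t : ℝ) :
    MeasurableSet {x : Space d | a ≤ u (x, t)} :=
  measurableSet_le measurable_const (h.measurable_slice t)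

/-- The left side depends only on `d`, `q` and `L`. This makes the lower bound for the mass uniform
over all admissible `g`. -/
lemma le_integral_weight (h : Sol L q g b c u) :
    L⁻¹ * ∫ x in ball (0 : Space d) (1 / 4), xp x ^ q
      ≤ ∫ x in ball (0 : Space d) 1, g x * cutoff (1 / 4) (1 / 2) x ^ 2 := by
  have hi : IntegrableOn (fun x => g x * cutoff (1 / 4) (1 / 2) x ^ 2) (ball (0 : Space d) 1) := by
    simpa using h.integrableOn_weight
      (lipschitzWith_cutoff (d := d) (by norm_num : (1 / 4 : ℝ) < 1 / 2)).continuous.measurable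
      (cutoff_nonneg _ _) (cutoff_le_one _ _) (F := fun _ => 1) measurable_const (C := 1) (by simp)
  have hsub : ball (0 : Space d) (1 / 4) ⊆ ball (0 : Space d) 1 := ball_subset_ball (by norm_num)
  refine le_trans ?_ (setIntegral_mono_set hi ((ae_restrict_iff' measurableSet_ball).2
    (Eventually.of_forall fun x hx => mul_nonneg (h.g_nonneg hx) (sq_nonneg _)))
    (Eventually.of_forall hsub))
  rw [← integral_const_mul]
  refine setIntegral_mono_on ?_ (hi.mono_set hsub) measurableSet_ball fun x hx => ?_
  · refine Measure.integrableOn_of_bounded (M := L⁻¹ * 1) measure_ball_lt_top.ne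
      ((measurable_xp.pow_const q).const_mul _).aestronglyMeasurable
      ((ae_restrict_iff' measurableSet_ball).2 (Eventually.of_forall fun x hx => ?_))
    rw [norm_mul, Real.norm_of_nonneg (inv_nonneg.2 h.L_pos.le),
      Real.norm_of_nonneg (pow_nonneg (xp_nonneg x) _)]
    exact mul_le_mul_of_nonneg_left (pow_le_one₀ (xp_nonneg x) (xp_le_one (hsub hx)))
      (inv_nonneg.2 h.L_pos.le)
  · rw [cutoff_eq_one (by norm_num) (mem_ball_zero_iff.1 hx).le, one_pow, mul_one]
    exact h.g_lower x (hsub hx)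

/-- The weighted measure of a superlevel set stays bounded below. -/
lemma lintegral_superlevel_ge (h : Sol L q g b c u) {a n₀ : ℝ} (ha : 0 < a) (ha1 : a ≤ 1)
    (hn₀ : 0 < n₀)
    (hN : n₀ ≤ ∫ x in ball (0 : Space d) 1, g x * cutoff (1 / 4) (1 / 2) x ^ 2)
    (hhalf : (∫ x in ball (0 : Space d) 1, g x * cutoff (1 / 4) (1 / 2) x ^ 2) / 2
      ≤ ∫ x in ball (0 : Space d) 1, g x * cutoff (1 / 4) (1 / 2) x ^ 2
        * {x | 1 / 2 ≤ u (x, -1 / 2)}.indicator (fun _ => 1) x)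
    (hlog : 2 * L + 32 * L ^ 3 * unitVol d / n₀ ≤ L⁻¹ * Real.log (1 / (2 * a)) / 4)
    {t : ℝ} (ht : -1 / 2 ≤ t) (ht0 : t ≤ 0) :
    ENNReal.ofReal (n₀ / (4 * L)) ≤ ∫⁻ x in halfBall (0 : Space d) (1 / 2) ∩ {x | a ≤ u (x, t)},
      ENNReal.ofReal (xp x) ^ 2 := by
  have hL := h.L_pos
  set η : Space d → ℝ := cutoff (1 / 4) (1 / 2) with hη
  have hηL := lipschitzWith_cutoff (d := d) (by norm_num : (1 / 4 : ℝ) < 1 / 2)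
  have hm := h.weight_superlevel_ge ha ha1 hηL (cutoff_nonneg _ _) (cutoff_le_one _ _)
    (by norm_num : (1 / 2 : ℝ) < 1) (fun x hx => cutoff_eq_zero (by norm_num) hx)
    (by norm_num : (-1 : ℝ) ≤ -1 / 2) ht ht0 hn₀ hN hhalf (by
      rw [coe_toNNReal_sq_four]
      refine le_trans (le_of_eq ?_) hlog
      rw [unitVol]
      ring)
  set S := {x : Space d | a ≤ u (x, t)} with hS
  have hSm : MeasurableSet S := h.measurableSet_superlevel a t
  set Z := halfBall (0 : Space d) (1 / 2) ∩ S with hZ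
  have hZm : MeasurableSet Z := (measurableSet_halfBall _ _).inter hSm
  have hind0 : ∀ x, 0 ≤ S.indicator (fun _ => (1 : ℝ)) x := fun x =>
    indicator_nonneg (fun _ _ => zero_le_one) _
  have hind1 : ∀ x, S.indicator (fun _ => (1 : ℝ)) x ≤ 1 := fun x =>
    indicator_le_self' (fun _ _ => zero_le_one) _
  have h1 : ENNReal.ofReal (n₀ / 4) ≤ ENNReal.ofReal L * ∫⁻ x in Z, ENNReal.ofReal (xp x) ^ 2 := by
    refine (ENNReal.ofReal_le_ofReal hm).trans ?_
    rw [ofReal_setIntegral_ball (C := L * 1 * 1)]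
    · rw [← lintegral_const_mul' _ _ ENNReal.ofReal_ne_top]
      calc _ ≤ ∫⁻ x in ball (0 : Space d) 1,
            Z.indicator (fun x => ENNReal.ofReal L * ENNReal.ofReal (xp x) ^ 2) x := by
            refine setLIntegral_mono' measurableSet_ball fun x hx => ?_
            by_cases hxZ : x ∈ Z
            · rw [indicator_of_mem hxZ, ← ENNReal.ofReal_pow (xp_nonneg x), ← ENNReal.ofReal_mul hL.le]
              refine ENNReal.ofReal_le_ofReal ?_
              calc g x * η x ^ 2 * S.indicator (fun _ => (1 : ℝ)) x
                  ≤ (L * xp x ^ 2) * 1 * 1 := by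
                    have h1 := h.g_upper x hx
                    have h2 := h.g_nonneg hx
                    have h3 : η x ^ 2 ≤ 1 := pow_le_one₀ (cutoff_nonneg _ _ x) (cutoff_le_one _ _ x)
                    have h4 := hind0 x
                    have h5 := hind1 x
                    gcongr
                _ = _ := by ring
            · rw [indicator_of_notMem hxZ, nonpos_iff_eq_zero, ENNReal.ofReal_eq_zero]
              refine le_of_eq ?_
              -- Off `Z` the integrand vanishes: the indicator is zero, or the cutoff is, or `xp =
              -- 0`, and then the upper bound forces `g = 0`.
              by_cases hxS : x ∈ S
              · by_cases hxr : x ∈ ball (0 : Space d) (1 / 2)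
                · have hx0 : xp x = 0 := xp_eq_zero_of_notMem_halfBall hxr fun h => hxZ ⟨h, hxS⟩
                  have h1 := h.g_upper x hx
                  have h2 := h.g_nonneg hx
                  rw [hx0] at h1
                  have : g x = 0 := le_antisymm (by simpa using h1) h2
                  rw [this]; ring
                · rw [cutoff_eq_zero (by norm_num) (by simpa using hxr)]; ring
              · rw [indicator_of_notMem hxS, mul_zero]
        _ ≤ ∫⁻ x, Z.indicator (fun x => ENNReal.ofReal L * ENNReal.ofReal (xp x) ^ 2) x :=
            setLIntegral_le_lintegral _ _
        _ = _ := lintegral_indicator hZm _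
    · exact (h.g_meas.mul (hηL.continuous.measurable.pow_const 2).aemeasurable).mul
        (measurable_const.indicator hSm).aemeasurable
    · intro x hx
      rw [abs_mul, abs_mul, abs_of_nonneg (sq_nonneg (η x)), abs_of_nonneg (hind0 x)]
      have h1 := h.abs_g_le hx
      have h3 : η x ^ 2 ≤ 1 := pow_le_one₀ (cutoff_nonneg _ _ x) (cutoff_le_one _ _ x)
      have h5 := hind1 x
      have h6 := hind0 x
      gcongr
    · exact fun x hx => mul_nonneg (mul_nonneg (h.g_nonneg hx) (sq_nonneg _)) (hind0 x)
  have hL0 : ENNReal.ofReal L ≠ 0 := by simpa using hL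
  refine (ENNReal.mul_le_mul_iff_right hL0 ENNReal.ofReal_ne_top).1 (le_trans (le_of_eq ?_) h1)
  rw [← ENNReal.ofReal_mul hL.le]
  congr 1
  field_simp

/-- The gradient of `log (u + a)` is controlled in `L²` by a constant times `1 + log (1 / a)`. -/
lemma lintegral_log_gradient_le (h : Sol L q g b c u) {a : ℝ} (ha : 0 < a) (ha1 : a ≤ 1) :
    ∫⁻ t in Ioc (-1 / 2 : ℝ) 0, ∫⁻ x in halfBall (0 : Space d) (1 / 2), ENNReal.ofReal (xp x) ^ 2
        * ENNReal.ofReal ((max (u (x, t)) 0 + a)⁻¹ ^ 2 * ‖sg u (x, t)‖ ^ 2)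
      ≤ ENNReal.ofReal (66 * L ^ 4 * unitVol d * (1 + Real.log (1 / a))) := by
  have hL := h.L_pos
  have hL1 := h.one_le
  obtain ⟨Ku, hKu⟩ := h.lip
  set η : Space d → ℝ := cutoff (1 / 2) (3 / 4) with hη
  have hηL := lipschitzWith_cutoff (d := d) (by norm_num : (1 / 2 : ℝ) < 3 / 4)
  have hηm : Measurable η := hηL.continuous.measurable
  -- The cutoff between `1/2` and `3/4` has squared slope 16. The slice at time 0 is nonnegative and
  -- is dropped, so the dissipation is bounded by the slice at `-1/2`, which is of order `1 + log (1
  -- / a)`.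
  have hE := h.log_energy ha ha1 hηL (cutoff_nonneg _ _) (cutoff_le_one _ _)
    (by norm_num : (3 / 4 : ℝ) < 1) (fun x hx => cutoff_eq_zero (by norm_num) hx)
    (by norm_num : (-1 : ℝ) ≤ -1 / 2) (by norm_num) le_rfl
  rw [coe_toNNReal_sq_four', ← unitVol] at hE
  set V := unitVol d
  have hV := unitVol_nonneg d
  set ℓ := Real.log (1 / a) with hℓ
  have hℓ0 : 0 ≤ ℓ := Real.log_nonneg (by rw [le_div_iff₀ ha]; linarith)
  set I := ∫ z in ball (0 : Space d) 1 ×ˢ Ioc (-1 / 2) 0,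
          xp z.1 ^ 2 * η z.1 ^ 2 * ((max (u z) 0 + a)⁻¹ ^ 2 * ‖sg u z‖ ^ 2) with hI
  have h0 : 0 ≤ ∫ x in ball (0 : Space d) 1, g x * η x ^ 2 * logPrim c a (u (x, 0)) :=
    setIntegral_nonneg measurableSet_ball fun x hx =>
      mul_nonneg (mul_nonneg (h.g_nonneg hx) (sq_nonneg _)) (h.logPrim_nonneg ha (h.mem_Icc _))
  have hlogle : ∀ s ∈ Icc (0 : ℝ) 1, logPrim c a s ≤ L * (1 + ℓ) := by
    intro s hs
    refine (h.logPrim_le ha hs).trans (mul_le_mul_of_nonneg_left ?_ hL.le)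
    calc Real.log ((1 + a) / (s + a)) ≤ Real.log (2 * (1 / a)) := by
          refine Real.log_le_log (div_pos (by linarith) (by linarith [hs.1])) ?_
          rw [div_le_iff₀ (by linarith [hs.1])]
          have : 1 ≤ 1 / a * (s + a) := by
            rw [one_div, inv_mul_eq_div, le_div_iff₀ ha]; linarith [hs.1]
          linarith
      _ = Real.log 2 + ℓ := Real.log_mul two_ne_zero (by positivity)
      _ ≤ 1 + ℓ := by linarith [Real.log_two_lt_d9]
  have h1 : ∫ x in ball (0 : Space d) 1, g x * η x ^ 2 * logPrim c a (u (x, -1 / 2))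
      ≤ L * 1 * (L * (1 + ℓ)) * V := by
    calc _ ≤ ∫ x in ball (0 : Space d) 1, L * 1 * (L * (1 + ℓ)) := by
          refine setIntegral_mono_on (h.integrableOn_weight hηm (cutoff_nonneg _ _)
            (cutoff_le_one _ _) (C := L * (1 + ℓ)) ((h.continuous_logPrim ha).measurable.comp
              (h.measurable_slice _)) fun x => ?_) ?_ measurableSet_ball fun x hx => ?_
          · rw [abs_of_nonneg (h.logPrim_nonneg ha (h.mem_Icc _))]
            exact hlogle _ (h.mem_Icc _)
          · exact integrableOn_const measure_ball_lt_top.ne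
          · have h1 := h.g_le hx
            have h2 := h.g_nonneg hx
            have h3 : η x ^ 2 ≤ 1 := pow_le_one₀ (cutoff_nonneg _ _ x) (cutoff_le_one _ _ x)
            have h4 := hlogle _ (h.mem_Icc (x, -1 / 2))
            have h5 := h.logPrim_nonneg ha (h.mem_Icc (x, -1 / 2))
            gcongr
      _ = _ := by
          rw [setIntegral_const, smul_eq_mul, measureReal_def, mul_comm]
          rfl
  have hIle : I ≤ 66 * L ^ 4 * V * (1 + ℓ) := by
    have e : 1 / (2 * L) * I ≤ L * 1 * (L * (1 + ℓ)) * V + 2 * L ^ 3 * 16 * V := by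
      linarith only [hE, h0, h1]
    have e2 : I = 2 * L * (1 / (2 * L) * I) := by field_simp
    rw [e2]
    calc _ ≤ 2 * L * (L * 1 * (L * (1 + ℓ)) * V + 2 * L ^ 3 * 16 * V) := by gcongr
      _ = 2 * L ^ 3 * 1 * V * (1 + ℓ) + 64 * L ^ 4 * V * 1 := by ring
      _ ≤ 2 * L ^ 3 * L * V * (1 + ℓ) + 64 * L ^ 4 * V * (1 + ℓ) := by
          gcongr
          linarith
      _ = _ := by ring
  have hinv : ∀ z, |(max (u z) 0 + a)⁻¹| ≤ a⁻¹ := fun z => by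
    have := le_max_right (u z) 0
    rw [abs_of_nonneg (inv_nonneg.2 (by linarith))]
    exact inv_anti₀ ha (by linarith)
  have hcyl := ofReal_setIntegral_cyl (d := d) (t₁ := -1 / 2) (t₂ := 0)
    (f := fun z => xp z.1 ^ 2 * η z.1 ^ 2 * ((max (u z) 0 + a)⁻¹ ^ 2 * ‖sg u z‖ ^ 2))
    ((((measurable_xp.comp measurable_fst).pow_const 2).mul
        ((hηm.comp measurable_fst).pow_const 2)).mul
        (((((h.measurable_u.max measurable_const).add_const a).inv).pow_const 2).mul
          ((measurable_sg u).norm.pow_const 2))) (C := 1 ^ 2 * 1 ^ 2 * (a⁻¹ ^ 2 * Ku ^ 2))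
    (fun z hz => by
      rw [abs_mul, abs_mul, abs_mul, abs_pow, abs_pow, abs_pow, abs_pow, abs_norm,
        abs_of_nonneg (xp_nonneg _), abs_of_nonneg (cutoff_nonneg _ _ _)]
      have h1 := xp_nonneg z.1
      have h2 := xp_le_one hz
      have h3 : 0 ≤ η z.1 := cutoff_nonneg _ _ _
      have h4 : η z.1 ≤ 1 := cutoff_le_one _ _ _
      have h5 := hinv z
      have h6 := norm_sg_le hKu z
      gcongr)
    (fun z => by positivity)
  refine le_trans ?_ (ENNReal.ofReal_le_ofReal hIle)
  rw [hI, hcyl]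
  refine lintegral_mono fun t => ?_
  refine le_trans ?_ (lintegral_mono_set (s := halfBall (0 : Space d) (1 / 2))
    fun x hx => ball_subset_ball (by norm_num) hx.1)
  refine setLIntegral_mono' (measurableSet_halfBall _ _) fun x hx => ?_
  have : η x = 1 := cutoff_eq_one (by norm_num) (mem_ball_zero_iff.1 hx.1).le
  simp only [this]
  rw [one_pow, mul_one, ENNReal.ofReal_mul (sq_nonneg (xp x)), ENNReal.ofReal_pow (xp_nonneg _)]

/-- Only qualitative: it makes the Poincaré inequality applicable. The constant, which blows up as
`a → 0`, enters no estimate. -/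
lemma lipschitzWith_log_slice (h : Sol L q g b c u) {a : ℝ} (ha : 0 < a) {Ku : NNReal}
    (hKu : LipschitzWith Ku u) (k t : ℝ) :
    LipschitzWith (a⁻¹.toNNReal * Ku)
      fun x : Space d => max (k - Real.log (u (x, t) + a)) 0 := by
  have h1 : LipschitzOnWith a⁻¹.toNNReal (fun s : ℝ => k - Real.log (s + a)) (Ici 0) := by
    refine (convex_Ici (0 : ℝ)).lipschitzOnWith_of_nnnorm_hasDerivWithin_le
      (f' := fun s => -(1 / (s + a))) (fun s hs => ?_) fun s hs => ?_
    · have hs0 : s + a ≠ 0 := by have : 0 ≤ s := hs; positivity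
      exact ((((hasDerivAt_id' s).add_const a).log hs0).const_sub k).hasDerivWithinAt
    · have hs0 : 0 ≤ s := hs
      rw [← NNReal.coe_le_coe, coe_nnnorm, norm_neg, Real.norm_of_nonneg (by positivity),
        Real.coe_toNNReal _ (by positivity), one_div]
      exact inv_anti₀ ha (by linarith)
  have h2 : LipschitzWith (a⁻¹.toNNReal * Ku) fun x : Space d => k - Real.log (u (x, t) + a) := by
    have h3 := lipschitzWith_slice_space hKu t
    rw [← lipschitzOnWith_univ] at h3 ⊢
    exact h1.comp h3 fun x _ => h.nonneg _
  exact h2.max_const 0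

/-- Where the truncation is active the function is at its minimum and the derivative vanishes;
elsewhere the chain rule gives equality with the slice gradient of `u` divided by `u + a`. -/
lemma enorm_fderiv_log_slice_le (h : Sol L q g b c u) {a : ℝ} (ha : 0 < a) (k : ℝ) {x : Space d}
    {t : ℝ} (hd : DifferentiableAt ℝ u (x, t)) :
    ‖fderiv ℝ (fun x : Space d => max (k - Real.log (u (x, t) + a)) 0) x‖ₑ ^ 2
      ≤ ENNReal.ofReal ((max (u (x, t)) 0 + a)⁻¹ ^ 2 * ‖sg u (x, t)‖ ^ 2) := by
  have hu0 := h.nonneg (x, t)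
  have hpos : u (x, t) + a ≠ 0 := by positivity
  have hsl := (hasFDerivAt_slice_space hd).differentiableAt.hasFDerivAt
  have hlog := ((hsl.add_const a).log hpos).const_sub k
  rcases le_or_gt (k - Real.log (u (x, t) + a)) 0 with hle | hlt
  · have hmin : IsLocalMin (fun x : Space d => max (k - Real.log (u (x, t) + a)) 0) x :=
      Eventually.of_forall fun y => by
        change max (k - Real.log (u (x, t) + a)) 0 ≤ max (k - Real.log (u (y, t) + a)) 0
        rw [max_eq_right hle]
        exact le_max_right _ _
    rw [hmin.fderiv_eq_zero, enorm_eq_nnnorm (0 : Space d →L[ℝ] ℝ), nnnorm_zero]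
    simp
  · have hev : (fun x : Space d => max (k - Real.log (u (x, t) + a)) 0)
        =ᶠ[𝓝 x] fun x => k - Real.log (u (x, t) + a) := by
      filter_upwards [hlog.continuousAt.eventually (lt_mem_nhds hlt)] with y hy
      exact max_eq_left hy.le
    rw [hev.fderiv_eq, hlog.fderiv, max_eq_left hu0, ← ofReal_norm,
      ← ENNReal.ofReal_pow (norm_nonneg _), norm_neg, norm_smul, mul_pow,
      Real.norm_of_nonneg (by positivity)]
    refine ENNReal.ofReal_le_ofReal ?_
    have := norm_fderiv_slice_le hd
    gcongr

/-- The measure-to-point step: the sublevel sets of `u` have small mass. -/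
lemma levelMass_le (h : Sol L q g b c u) {a k n₁ : ℝ} (ha : 0 < a) (hak : 2 * a < k) (hk : k ≤ 1)
    (hZ : ∀ t ∈ Ioc (-1 / 2 : ℝ) 0, ENNReal.ofReal n₁
      ≤ ∫⁻ x in halfBall (0 : Space d) (1 / 2) ∩ {x | k ≤ u (x, t)}, ENNReal.ofReal (xp x) ^ 2) :
    ENNReal.ofReal n₁ * levelMass u (1 / 2) a
      ≤ ENNReal.ofReal (a ^ 2 / Real.log (k / (2 * a)) ^ 2 * (4 * unitVol d
        * (66 * L ^ 4 * unitVol d * (1 + Real.log (1 / a))))) := by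
  obtain ⟨Ku, hKu⟩ := h.lip
  have hL := h.L_pos
  have hV := unitVol_nonneg d
  have hk0 : 0 < k := by linarith
  set ℓ := Real.log (k / (2 * a)) with hℓ
  have hℓ0 : 0 < ℓ := Real.log_pos (by rw [lt_div_iff₀ (by positivity)]; linarith)
  set D := halfBall (0 : Space d) (1 / 2) with hD
  set v : ℝ → Space d → ℝ := fun t x => max (Real.log k - Real.log (u (x, t) + a)) 0 with hv
  -- Where `u < a` one has `u + a < 2 a`, so `v` is at least `ℓ = log (k / (2 a))` there, while the
  -- truncation is at most `a`. Poincaré's inequality applies to `v` because it vanishes on `{u ≥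
  -- k}`.
  have hpt : ∀ t x, trunc a u (x, t) ^ 2 ≤ a ^ 2 / ℓ ^ 2 * v t x ^ 2 := by
    intro t x
    have hu0 := h.nonneg (x, t)
    rcases lt_or_ge (u (x, t)) a with hlt | hge
    · have h1 : ℓ ≤ v t x := by
        refine le_max_of_le_left ?_
        rw [hℓ, Real.log_div hk0.ne' (by positivity)]
        gcongr
        linarith
      have h2 : trunc a u (x, t) ≤ a := max_le (by linarith) ha.le
      have h3 := trunc_nonneg a u (x, t)
      calc trunc a u (x, t) ^ 2 ≤ a ^ 2 := by gcongr
        _ = a ^ 2 / ℓ ^ 2 * ℓ ^ 2 := by field_simp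
        _ ≤ _ := by gcongr
    · have : trunc a u (x, t) = 0 := max_eq_right (by linarith)
      rw [this, zero_pow two_ne_zero]
      positivity
  have hslice : ∀ᵐ t : ℝ, t ∈ Ioc (-1 / 2 : ℝ) 0 →
      ENNReal.ofReal n₁ * ∫⁻ x in ball (0 : Space d) (1 / 2),
        ENNReal.ofReal (xp x ^ 2 * trunc a u (x, t) ^ 2)
      ≤ ENNReal.ofReal (a ^ 2 / ℓ ^ 2 * (4 * unitVol d)) * ∫⁻ x in D, ENNReal.ofReal (xp x) ^ 2
        * ENNReal.ofReal ((max (u (x, t)) 0 + a)⁻¹ ^ 2 * ‖sg u (x, t)‖ ^ 2) := by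
    filter_upwards [ae_ae_differentiableAt' hKu] with t hdt ht
    have hDm : MeasurableSet D := measurableSet_halfBall _ _
    have hpo := weighted_poincare (h.lipschitzWith_log_slice ha hKu (Real.log k) t)
      (hDm.inter (h.measurableSet_superlevel k t)) inter_subset_left (fun x hx => by
        have hx2 : k ≤ u (x, t) := hx.2
        refine max_eq_right ?_
        rw [sub_nonpos]
        gcongr
        linarith)
    calc _ ≤ ENNReal.ofReal n₁ * (ENNReal.ofReal (a ^ 2 / ℓ ^ 2)
          * ∫⁻ x in D, ENNReal.ofReal (xp x) ^ 2 * ‖v t x‖ₑ ^ 2) := by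
          gcongr
          rw [← lintegral_const_mul' _ _ ENNReal.ofReal_ne_top, ← lintegral_indicator hDm,
            ← lintegral_indicator measurableSet_ball]
          refine lintegral_mono fun x => ?_
          by_cases hx : x ∈ ball (0 : Space d) (1 / 2)
          · rw [indicator_of_mem hx]
            by_cases hxD : x ∈ D
            · rw [indicator_of_mem hxD, enorm_sq_eq, ← ENNReal.ofReal_pow (xp_nonneg x),
                ← ENNReal.ofReal_mul (sq_nonneg _), ← ENNReal.ofReal_mul (by positivity)]
              refine ENNReal.ofReal_le_ofReal ?_
              calc _ ≤ xp x ^ 2 * (a ^ 2 / ℓ ^ 2 * v t x ^ 2) := by gcongr; exact hpt t x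
                _ = _ := by ring
            · rw [xp_eq_zero_of_notMem_halfBall hx hxD]
              simp
          · rw [indicator_of_notMem hx]
            exact bot_le
      _ = ENNReal.ofReal (a ^ 2 / ℓ ^ 2) * (ENNReal.ofReal n₁
          * ∫⁻ x in D, ENNReal.ofReal (xp x) ^ 2 * ‖v t x‖ₑ ^ 2) := by ring
      _ ≤ ENNReal.ofReal (a ^ 2 / ℓ ^ 2) * (4 * volume (ball (0 : Space d) 1)
          * ∫⁻ x in D, ENNReal.ofReal (xp x) ^ 2 * ‖fderiv ℝ (v t) x‖ₑ ^ 2) := by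
          refine mul_le_mul_right ((mul_le_mul_left (hZ t ht) _).trans hpo) _
      _ ≤ ENNReal.ofReal (a ^ 2 / ℓ ^ 2) * (4 * volume (ball (0 : Space d) 1)
          * ∫⁻ x in D, ENNReal.ofReal (xp x) ^ 2
            * ENNReal.ofReal ((max (u (x, t)) 0 + a)⁻¹ ^ 2 * ‖sg u (x, t)‖ ^ 2)) := by
          refine mul_le_mul_right (mul_le_mul_right (lintegral_mono_ae (ae_restrict_of_ae ?_)) _) _
          filter_upwards [hdt] with x hx
          exact mul_le_mul_right (h.enorm_fderiv_log_slice_le ha _ hx) _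
      _ = _ := by
          rw [ENNReal.ofReal_mul (by positivity), ENNReal.ofReal_mul (p := 4) (by norm_num),
            ofReal_unitVol]
          norm_num
          ring
  calc ENNReal.ofReal n₁ * levelMass u (1 / 2) a
      = ∫⁻ t in Ioc (-1 / 2 : ℝ) 0, ENNReal.ofReal n₁ * ∫⁻ x in ball (0 : Space d) (1 / 2),
          ENNReal.ofReal (xp x ^ 2 * trunc a u (x, t) ^ 2) := by
        rw [lintegral_const_mul' _ _ ENNReal.ofReal_ne_top, levelMass]
        norm_num
    _ ≤ ∫⁻ t in Ioc (-1 / 2 : ℝ) 0, ENNReal.ofReal (a ^ 2 / ℓ ^ 2 * (4 * unitVol d))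
          * ∫⁻ x in D, ENNReal.ofReal (xp x) ^ 2
            * ENNReal.ofReal ((max (u (x, t)) 0 + a)⁻¹ ^ 2 * ‖sg u (x, t)‖ ^ 2) :=
        lintegral_mono_ae ((ae_restrict_iff' measurableSet_Ioc).2 hslice)
    _ ≤ _ := by
        rw [lintegral_const_mul' _ _ ENNReal.ofReal_ne_top]
        refine (mul_le_mul_right (h.lintegral_log_gradient_le ha (by linarith)) _).trans ?_
        rw [← ENNReal.ofReal_mul (by positivity)]
        refine ENNReal.ofReal_le_ofReal (le_of_eq (by ring))

/-- If `u` solves the equation, so does `1 - u`. -/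
lemma one_sub (h : Sol L q g b c u) : Sol L q g b (fun s => c (1 - s)) (fun z => 1 - u z) where
  one_le := h.one_le
  g_meas := h.g_meas
  g_lower := h.g_lower
  g_upper := h.g_upper
  b_meas := h.b_meas
  b_lower := h.b_lower
  b_upper := h.b_upper
  c_cont := h.c_cont.comp (by fun_prop)
  c_lower := fun s => h.c_lower _
  c_upper := fun s => h.c_upper _
  lip := by
    obtain ⟨K, hK⟩ := h.lip
    exact ⟨0 + K, (LipschitzWith.const 1).sub hK⟩
  nonneg := fun z => by linarith [h.le_one z]
  le_one := fun z => by linarith [h.nonneg z]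
  eqn := fun φ hφ ρ hρ h0 t₁ t₂ ht₁ h12 ht₂ => by
    have e1 : ∀ z, td (fun z => 1 - u z) z = -td u z := fun z => by simp [td, fderiv_const_sub]
    have e2 : ∀ z, sg (fun z => 1 - u z) z = (-1 : ℝ) • sg u z := fun z => by
      ext i
      simp [sg, fderiv_const_sub]
    have := h.eqn φ hφ ρ hρ h0 t₁ t₂ ht₁ h12 ht₂
    rw [← neg_eq_zero, ← integral_neg] at this
    rw [← this]
    congr 1
    ext z
    rw [e1, e2, bil_smul_left, _root_.sub_sub_cancel]
    ring

end Sol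

/-- If `u ≥ 1/2` on half of the mass at an early time, then `u` is bounded below later on. -/
lemma exists_lower_bound (d q : ℕ) {L : ℝ} (hL : 1 ≤ L) : ∃ ε : ℝ, 0 < ε ∧ ε ≤ 1 / 2 ∧
    ∀ (g : Space d → ℝ) (b : Space d → Matrix (Fin (d + 1)) (Fin (d + 1)) ℝ) (c : ℝ → ℝ)
      (u : Space d × ℝ → ℝ), Sol L q g b c u →
      (∫ x in ball (0 : Space d) 1, g x * cutoff (1 / 4) (1 / 2) x ^ 2) / 2
      ≤ (∫ x in ball (0 : Space d) 1, g x * cutoff (1 / 4) (1 / 2) x ^ 2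
        * {x | 1 / 2 ≤ u (x, -1 / 2)}.indicator (fun _ => 1) x) →
      ∀ x ∈ halfBall (0 : Space d) (1 / 4), ∀ t ∈ Ioc (-1 / 4 : ℝ) 0, ε ≤ u (x, t) := by
  obtain ⟨ε, hε, hDG⟩ := exists_deGiorgi d q hL
  have hL0 : 0 < L := by linarith
  set V := unitVol d with hV
  have hV0 : 0 < V := unitVol_pos d
  set n₀ : ℝ := L⁻¹ * ∫ x in ball (0 : Space d) (1 / 4), xp x ^ q with hn₀
  have hn0 : 0 < n₀ := mul_pos (by positivity) (integral_xp_pow_pos d q (by norm_num) (by norm_num))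
  set W : ℝ := 2 * L + 32 * L ^ 3 * V / n₀ with hW
  have hW0 : 0 < W := by positivity
  -- Chosen so that `log (1 / (2 k)) / (4 L) = W`, the exact threshold of the propagation estimate.
  set k : ℝ := 1 / 2 * Real.exp (-(4 * L * W)) with hk
  have hk0 : 0 < k := by positivity
  have hk1 : k ≤ 1 / 2 := by
    have : Real.exp (-(4 * L * W)) ≤ 1 := Real.exp_le_one_iff.2 (by
      have : 0 < 4 * L * W := by positivity
      linarith)
    linarith
  set A := Real.log (2 / k) with hA
  have hA0 : 0 < A := Real.log_pos (by rw [lt_div_iff₀ hk0]; linarith)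
  set K : ℝ := 4 * V * (66 * L ^ 4 * V) / (n₀ / (4 * L)) with hK
  have hK0 : 0 < K := by positivity
  -- `y` is `log (1 / a)`. The mass bound falls below the De Giorgi threshold when `K (1 + y) ≤ ε (y
  -- - A) ^ 2`. The summand `1 + 2 A` ensures `1 + y ≤ 2 (y - A)` and the summand `2 K / ε` ensures
  -- `2 K ≤ ε (y - A)`.
  set y : ℝ := 1 + 2 * A + 2 * K / ε with hy
  set a : ℝ := Real.exp (-y) with ha
  have hy0 : 0 < 2 * K / ε := by positivity
  have ha0 : 0 < a := Real.exp_pos _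
  have hla : Real.log (1 / a) = y := by rw [ha, one_div, Real.log_inv, Real.log_exp, neg_neg]
  have hℓ : Real.log (k / (2 * a)) = y - A := by
    rw [hA, Real.log_div hk0.ne' (by positivity), Real.log_mul two_ne_zero ha0.ne',
      Real.log_div two_ne_zero hk0.ne', ha, Real.log_exp]
    ring
  have hak : 2 * a < k := by
    have : 0 < Real.log (k / (2 * a)) := by rw [hℓ]; linarith
    rw [Real.log_pos_iff (by positivity), lt_div_iff₀ (by positivity)] at this
    linarith
  refine ⟨a / 2, by positivity, by linarith, fun g b c u h hhalf => ?_⟩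
  refine hDG g b c u h a ha0 (by linarith) ?_
  have hlog : 2 * L + 32 * L ^ 3 * unitVol d / n₀ ≤ L⁻¹ * Real.log (1 / (2 * k)) / 4 := by
    have e : 2 * k = Real.exp (-(4 * L * W)) := by rw [hk]; ring
    rw [e, one_div, Real.log_inv, Real.log_exp, neg_neg, ← hV, ← hW]
    refine le_of_eq ?_
    field_simp
  have hZ : ∀ t ∈ Ioc (-1 / 2 : ℝ) 0, ENNReal.ofReal (n₀ / (4 * L))
      ≤ ∫⁻ x in halfBall (0 : Space d) (1 / 2) ∩ {x | k ≤ u (x, t)}, ENNReal.ofReal (xp x) ^ 2 :=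
    fun t ht => h.lintegral_superlevel_ge hk0 (by linarith) hn0 h.le_integral_weight hhalf hlog
      ht.1.le ht.2
  have hM := h.levelMass_le ha0 hak (by linarith) hZ
  have hn1 : 0 < n₀ / (4 * L) := by positivity
  refine (ENNReal.mul_le_mul_iff_right (by simpa using hn1) ENNReal.ofReal_ne_top).1
    (hM.trans ?_)
  rw [← ENNReal.ofReal_mul hn1.le, hla, hℓ]
  refine ENNReal.ofReal_le_ofReal ?_
  have hyA : 0 < y - A := by linarith
  have e1 : 1 + y ≤ 2 * (y - A) := by linarith
  have e2 : 2 * K ≤ ε * (y - A) := by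
    have : ε * (2 * K / ε) = 2 * K := by field_simp
    nlinarith
  have e3 : K * (1 + y) ≤ ε * (y - A) ^ 2 := by nlinarith
  have e4 : 4 * V * (66 * L ^ 4 * V) = K * (n₀ / (4 * L)) := by rw [hK]; field_simp
  calc a ^ 2 / (y - A) ^ 2 * (4 * V * (66 * L ^ 4 * V * (1 + y)))
      = a ^ 2 / (y - A) ^ 2 * ((4 * V * (66 * L ^ 4 * V)) * (1 + y)) := by ring
    _ = a ^ 2 / (y - A) ^ 2 * ((n₀ / (4 * L)) * (K * (1 + y))) := by rw [e4]; ring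
    _ ≤ a ^ 2 / (y - A) ^ 2 * ((n₀ / (4 * L)) * (ε * (y - A) ^ 2)) := by gcongr
    _ = _ := by field_simp

/-- Oscillation decay for the normalized equation. -/
lemma exists_decay (d q : ℕ) {L : ℝ} (hL : 1 ≤ L) : ∃ ε : ℝ, 0 < ε ∧ ε ≤ 1 / 2 ∧
    ∀ (g : Space d → ℝ) (b : Space d → Matrix (Fin (d + 1)) (Fin (d + 1)) ℝ) (c : ℝ → ℝ)
      (u : Space d × ℝ → ℝ), Sol L q g b c u →
      (∀ x ∈ halfBall (0 : Space d) (1 / 4), ∀ t ∈ Ioc (-1 / 4 : ℝ) 0, ε ≤ u (x, t)) ∨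
      (∀ x ∈ halfBall (0 : Space d) (1 / 4), ∀ t ∈ Ioc (-1 / 4 : ℝ) 0, u (x, t) ≤ 1 - ε) := by
  obtain ⟨ε, hε, hε1, hlow⟩ := exists_lower_bound d q hL
  refine ⟨ε, hε, hε1, fun g b c u h => ?_⟩
  set η : Space d → ℝ := cutoff (1 / 4) (1 / 2) with hη
  have hηm : Measurable η :=
    (lipschitzWith_cutoff (d := d) (by norm_num : (1 / 4 : ℝ) < 1 / 2)).continuous.measurable
  -- At each point `u ≥ 1/2` or `1 - u ≥ 1/2`, so at time `-1/2` one of these sets has at least half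
  -- of the mass, and `1 - u` solves an equation of the same class.
  by_cases hhalf : (∫ x in ball (0 : Space d) 1, g x * η x ^ 2) / 2
      ≤ (∫ x in ball (0 : Space d) 1, g x * η x ^ 2
        * {x | 1 / 2 ≤ u (x, -1 / 2)}.indicator (fun _ => 1) x)
  · exact Or.inl (hlow g b c u h hhalf)
  · refine Or.inr fun x hx t ht => ?_
    have hind : ∀ S : Set (Space d), ∀ x, |S.indicator (fun _ => (1 : ℝ)) x| ≤ 1 := fun S x => by
      by_cases hx : x ∈ S <;> simp [hx]
    have hi : ∀ S : Set (Space d), MeasurableSet S → IntegrableOn (fun x => g x * η x ^ 2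
        * S.indicator (fun _ => 1) x) (ball (0 : Space d) 1) := fun S hS =>
      h.integrableOn_weight hηm (cutoff_nonneg _ _) (cutoff_le_one _ _)
        (measurable_const.indicator hS) (hind S)
    have hiN : IntegrableOn (fun x => g x * η x ^ 2) (ball (0 : Space d) 1) := by
      simpa using h.integrableOn_weight hηm (cutoff_nonneg _ _) (cutoff_le_one _ _)
        (F := fun _ => 1) measurable_const (C := 1) (by simp)
    have hi1 := hi _ (h.measurableSet_superlevel (1 / 2) (-1 / 2))
    have hi2 := hi _ (h.one_sub.measurableSet_superlevel (1 / 2) (-1 / 2))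
    have hsum := integral_add hi1 hi2
    have hle : ∫ x in ball (0 : Space d) 1, g x * η x ^ 2 ≤ ∫ x in ball (0 : Space d) 1,
        (g x * η x ^ 2 * {x | 1 / 2 ≤ u (x, -1 / 2)}.indicator (fun _ => 1) x
        + g x * η x ^ 2 * {x | 1 / 2 ≤ 1 - u (x, -1 / 2)}.indicator (fun _ => 1) x) := by
      refine setIntegral_mono_on hiN (hi1.add hi2) measurableSet_ball fun x hx => ?_
      have hw : 0 ≤ g x * η x ^ 2 := mul_nonneg (h.g_nonneg hx) (sq_nonneg _)
      rw [← mul_add]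
      refine le_mul_of_one_le_right hw ?_
      rcases le_total (1 / 2) (u (x, -1 / 2)) with hu | hu
      · rw [indicator_of_mem (show x ∈ {x | 1 / 2 ≤ u (x, -1 / 2)} from hu)]
        exact le_add_of_nonneg_right (indicator_nonneg (fun _ _ => zero_le_one) _)
      · rw [indicator_of_mem (show x ∈ {x | 1 / 2 ≤ 1 - u (x, -1 / 2)} by
          change 1 / 2 ≤ 1 - u (x, -1 / 2); linarith)]
        exact le_add_of_nonneg_left (indicator_nonneg (fun _ _ => zero_le_one) _)
    have := hlow g b _ _ h.one_sub (by linarith only [hsum, hle, hhalf]) x hx t ht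
    linarith

/-! ### Approximation of Lipschitz functions by test functions -/

section Mollification

open ContinuousLinearMap
open scoped Convolution

variable {E : Type*} [NormedAddCommGroup E] [NormedSpace ℝ E] [FiniteDimensional ℝ E]
  [MeasurableSpace E] [BorelSpace E] (μ : Measure E) [μ.IsAddHaarMeasure]

/-- Differentiation under the integral needs differentiability of `φ (· - y)` at `z` only for almost
every `y`, which Rademacher's theorem provides. The Lipschitz bound dominates the difference
quotients. -/
lemma fderiv_normed_convolution {φ : E → ℝ} {K : NNReal} (hφ : LipschitzWith K φ)
    (ρ : ContDiffBump (0 : E)) (z : E) :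
    HasFDerivAt (ρ.normed μ ⋆[lsmul ℝ ℝ, μ] φ : E → ℝ)
      ((ρ.normed μ ⋆[lsmul ℝ ℝ, μ] (fderiv ℝ φ) : E → E →L[ℝ] ℝ) z) z := by
  have hcont := hφ.continuous
  have hρ : Continuous (ρ.normed μ) := ρ.contDiff_normed (n := 0).continuous
  have hρs := ρ.hasCompactSupport_normed (μ := μ)
  refine (hasFDerivAt_integral_of_dominated_loc_of_lip (s := univ)
    (F := fun x y => ρ.normed μ y • φ (x - y)) (F' := fun y => ρ.normed μ y • fderiv ℝ φ (z - y))
    (bound := fun y => ρ.normed μ y * K) univ_mem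
    (Eventually.of_forall fun x => (by fun_prop : Continuous _).aestronglyMeasurable) ?_ ?_ ?_ ?_ ?_).2
  · exact (by fun_prop : Continuous _).integrable_of_hasCompactSupport hρs.smul_right
  · refine hρ.aestronglyMeasurable.smul ?_
    exact ((measurable_fderiv ℝ φ).comp (by fun_prop)).aestronglyMeasurable
  · refine Eventually.of_forall fun y => LipschitzWith.lipschitzOnWith ?_
    refine LipschitzWith.of_dist_le_mul fun x x' => ?_
    rw [Real.coe_nnabs, abs_mul, NNReal.abs_eq, dist_smul₀, mul_assoc, Real.norm_eq_abs]
    gcongr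
    simpa using hφ.dist_le_mul (x - y) (x' - y)
  · exact (hρ.integrable_of_hasCompactSupport hρs).mul_const _
  · have hae : ∀ᵐ y ∂μ, DifferentiableAt ℝ φ (z - y) :=
      (quasiMeasurePreserving_sub_left μ z).ae hφ.ae_differentiableAt
    filter_upwards [hae] with y hy
    have h1 : HasFDerivAt (fun x => φ (x - y)) (fderiv ℝ φ (z - y)) z := by
      simpa [Function.comp_def] using hy.hasFDerivAt.comp z ((hasFDerivAt_id z).sub_const y)
    exact h1.fun_const_smul _

/-- Lipschitz functions with compact support in an open set are limits of test functions. -/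
lemma exists_smooth_approx {φ : E → ℝ} {K : NNReal} (hφ : LipschitzWith K φ)
    (hc : HasCompactSupport φ) {U : Set E} (hU : IsOpen U) (hsub : tsupport φ ⊆ U) :
    ∃ f : ℕ → E → ℝ, (∀ n, ContDiff ℝ (⊤ : ℕ∞) (f n)) ∧ (∀ n, HasCompactSupport (f n)) ∧
      (∀ n, tsupport (f n) ⊆ U) ∧ (∀ n, LipschitzWith K (f n)) ∧
      (∀ z, Tendsto (fun n => f n z) atTop (𝓝 (φ z))) ∧
      (∀ᵐ z ∂μ, Tendsto (fun n => fderiv ℝ (f n) z) atTop (𝓝 (fderiv ℝ φ z))) := by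
  have hcont := hφ.continuous
  obtain ⟨δ, hδ, hδU⟩ := IsCompact.exists_cthickening_subset_open hc hU hsub
  set r : ℕ → ℝ := fun n => δ / 2 * (1 / (n + 1)) with hr
  have hr0 : ∀ n, 0 < r n := fun n => by positivity
  have hrδ : ∀ n, 2 * r n ≤ δ := fun n => by
    have : (1 : ℝ) / (n + 1) ≤ 1 := by
      rw [div_le_one (by positivity)]
      linarith [(Nat.cast_nonneg n : (0 : ℝ) ≤ n)]
    simp only [hr]
    nlinarith
  -- The fixed ratio 2 of outer to inner radius is what Lebesgue differentiation requires for the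
  -- almost everywhere convergence of the mollified gradients.
  set ρ : ℕ → ContDiffBump (0 : E) := fun n => ⟨r n, 2 * r n, hr0 n, by linarith [hr0 n]⟩ with hρ
  have hrlim : Tendsto (fun n => (ρ n).rOut) atTop (𝓝 0) := by
    have := ((tendsto_one_div_add_atTop_nhds_zero_nat (𝕜 := ℝ)).const_mul (δ / 2)).const_mul 2
    simpa [hρ, hr] using this
  have hsupp : ∀ n, tsupport ((ρ n).normed μ ⋆[lsmul ℝ ℝ, μ] φ : E → ℝ)
      ⊆ cthickening δ (tsupport φ) := fun n => by
    refine closure_minimal (fun z hz => ?_) isClosed_cthickening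
    by_contra hzn
    refine hz ?_
    have h0 : ∀ x ∈ ball z (ρ n).rOut, φ x = 0 := fun x hx => by
      by_contra hx0
      refine hzn (mem_cthickening_of_dist_le z x δ _ (subset_tsupport _ hx0) ?_)
      rw [dist_comm]
      exact (mem_ball.1 hx).le.trans (hrδ n)
    have hz0 := h0 z (mem_ball_self (ρ n).rOut_pos)
    -- With `ε = 0`: where `φ` vanishes on the whole averaging ball, so does its mollification.
    have := ContDiffBump.dist_normed_convolution_le (φ := ρ n) (μ := μ) (x₀ := z) (ε := 0)
      hcont.aestronglyMeasurable (fun x hx => by rw [h0 x hx, hz0, dist_self])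
    rw [hz0, dist_le_zero] at this
    exact this
  have hli : LocallyIntegrable (fderiv ℝ φ) μ := by
    refine LocallyIntegrable.mono (f := fun _ : E => (K : ℝ)) continuous_const.locallyIntegrable
      (measurable_fderiv ℝ φ).aestronglyMeasurable (Eventually.of_forall fun z => ?_)
    rw [Real.norm_of_nonneg K.coe_nonneg]
    exact norm_fderiv_le_of_lipschitz ℝ hφ
  refine ⟨fun n => (ρ n).normed μ ⋆[lsmul ℝ ℝ, μ] φ, fun n => ?_, fun n => ?_, fun n => ?_,
    fun n => ?_, fun z => ?_, ?_⟩
  · exact (ρ n).hasCompactSupport_normed.contDiff_convolution_left _ (ρ n).contDiff_normed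
      hcont.locallyIntegrable
  · exact HasCompactSupport.of_support_subset_isCompact (IsCompact.cthickening hc)
      ((subset_tsupport _).trans (hsupp n))
  · exact (hsupp n).trans hδU
  · refine LipschitzWith.of_dist_le_mul fun x x' => ?_
    have hρc : Continuous ((ρ n).normed μ) := (ρ n).contDiff_normed (n := 0).continuous
    have hρs := (ρ n).hasCompactSupport_normed (μ := μ)
    have hi : ∀ x, Integrable (fun y => (ρ n).normed μ y • φ (x - y)) μ := fun x =>
      (by fun_prop : Continuous _).integrable_of_hasCompactSupport hρs.smul_right
    have hρi := hρc.integrable_of_hasCompactSupport (μ := μ) hρs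
    dsimp only
    rw [convolution_lsmul, convolution_lsmul, dist_eq_norm, ← integral_sub (hi x) (hi x')]
    calc _ ≤ ∫ y, (ρ n).normed μ y * (K * dist x x') ∂μ := by
          refine norm_integral_le_of_norm_le (hρi.mul_const _) (Eventually.of_forall fun y => ?_)
          rw [← smul_sub, norm_smul, Real.norm_of_nonneg ((ρ n).nonneg_normed y)]
          refine mul_le_mul_of_nonneg_left ?_ ((ρ n).nonneg_normed y)
          simpa [dist_eq_norm] using hφ.dist_le_mul (x - y) (x' - y)
      _ = _ := by rw [integral_mul_const, (ρ n).integral_normed, one_mul]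
  · exact ContDiffBump.convolution_tendsto_right_of_continuous hrlim hcont z
  · have hae := ContDiffBump.ae_convolution_tendsto_right_of_locallyIntegrable (μ := μ) (φ := ρ)
      (K := 2) hrlim (Eventually.of_forall fun n => le_rfl) hli
    filter_upwards [hae] with z hz
    refine hz.congr fun n => ?_
    exact (fderiv_normed_convolution μ hφ (ρ n) z).fderiv.symm

end Mollification

/-! ### The weak equation up to the flat boundary -/

lemma td_mul {f g : Space d × ℝ → ℝ} {z : Space d × ℝ} (hf : DifferentiableAt ℝ f z)
    (hg : DifferentiableAt ℝ g z) :
    td (fun y => f y * g y) z = f z * td g z + g z * td f z := by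
  simp [td, fderiv_fun_mul hf hg]

lemma sg_fun_snd {f : ℝ → ℝ} {z : Space d × ℝ}
    (hf : DifferentiableAt ℝ (fun y : Space d × ℝ => f y.2) z) :
    sg (fun y : Space d × ℝ => f y.2) z = 0 := by
  ext i
  change fderiv ℝ (fun y : Space d × ℝ => f y.2) z (EuclideanSpace.single i 1, 0) = 0
  rw [← hf.lineDeriv_eq_fderiv, lineDeriv]
  simp

lemma continuous_bil_right (B : Matrix (Fin (d + 1)) (Fin (d + 1)) ℝ) (ξ : Space d) :
    Continuous fun η : Space d => bil B ξ η := by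
  unfold bil matForm
  fun_prop

lemma tendsto_sg {f : ℕ → Space d × ℝ → ℝ} {φ : Space d × ℝ → ℝ} {z : Space d × ℝ}
    (h : Tendsto (fun n => fderiv ℝ (f n) z) atTop (𝓝 (fderiv ℝ φ z))) :
    Tendsto (fun n => sg (f n) z) atTop (𝓝 (sg φ z)) := by
  refine ((PiLp.continuous_toLp 2 _).tendsto _).comp (tendsto_pi_nhds.2 fun i => ?_)
  exact ((ContinuousLinearMap.apply ℝ ℝ
    ((EuclideanSpace.single i 1 : Space d), (0 : ℝ))).continuous.tendsto _).comp h

lemma tendsto_td {f : ℕ → Space d × ℝ → ℝ} {φ : Space d × ℝ → ℝ} {z : Space d × ℝ}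
    (h : Tendsto (fun n => fderiv ℝ (f n) z) atTop (𝓝 (fderiv ℝ φ z))) :
    Tendsto (fun n => td (f n) z) atTop (𝓝 (td φ z)) :=
  ((ContinuousLinearMap.apply ℝ ℝ ((0 : Space d), (1 : ℝ))).continuous.tendsto _).comp h

/-- The open half cylinder `B_1^+ × (-1, 0)`. -/
def halfCyl (d : ℕ) : Set (Space d × ℝ) := halfBall 0 1 ×ˢ Ioo (-1 : ℝ) 0

lemma isOpen_halfCyl : IsOpen (halfCyl d) := (isOpen_halfBall _ _).prod isOpen_Ioo

lemma halfCyl_subset : halfCyl d ⊆ ball (0 : Space d) 1 ×ˢ Ioc (-1 : ℝ) 0 :=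
  prod_mono inter_subset_left Ioo_subset_Ioc_self

lemma volume_halfCyl_ne_top : volume (halfCyl d) ≠ ∞ :=
  measure_ne_top_of_subset halfCyl_subset (volume_cyl_ne_top _ _)

/-- The coefficients of the weak equation: bounded, measurable, and degenerating at `x_n = 0`. -/
structure Coeff (C : ℝ) (γ : Space d → ℝ)
    (β : Space d → Matrix (Fin (d + 1)) (Fin (d + 1)) ℝ) : Prop where
  nonneg : 0 ≤ C
  γ_meas : AEMeasurable γ
  γ_le : ∀ x, |γ x| ≤ C
  β_meas : ∀ i j, AEMeasurable (fun x => β x i j)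
  β_le : ∀ x ∈ halfBall (0 : Space d) 1, ∀ ξ η, |bil (β x) ξ η| ≤ C * xp x ^ 2 * ‖ξ‖ * ‖η‖
  γ_zero : ∀ x, x ∉ halfBall (0 : Space d) 1 → γ x = 0
  β_zero : ∀ x, x ∉ halfBall (0 : Space d) 1 → β x = 0

namespace Coeff

variable {C : ℝ} {γ : Space d → ℝ} {β : Space d → Matrix (Fin (d + 1)) (Fin (d + 1)) ℝ}
  {F W : Space d × ℝ → ℝ} {KF KW : NNReal} {CF : ℝ}

lemma bil_le (h : Coeff C γ β) (x ξ η : Space d) : |bil (β x) ξ η| ≤ C * ‖ξ‖ * ‖η‖ := by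
  have hC := h.nonneg
  by_cases hx : x ∈ halfBall (0 : Space d) 1
  · refine (h.β_le x hx ξ η).trans ?_
    have : C * xp x ^ 2 ≤ C := mul_le_of_le_one_right hC
      (pow_le_one₀ (xp_nonneg x) (xp_le_one hx.1))
    gcongr
  · have : bil (β x) ξ η = 0 := by simp [h.β_zero x hx, bil, matForm]
    rw [this, abs_zero]
    positivity

lemma bil_aemeas (h : Coeff C γ β) (f g : Space d × ℝ → ℝ) :
    AEMeasurable fun z : Space d × ℝ => bil (β z.1) (sg f z) (sg g z) :=
  aemeasurable_bil (fun i j => (h.β_meas i j).comp_fst) (measurable_sg f) (measurable_sg g)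

/-- The weak equation extends from smooth to Lipschitz test functions with compact support. -/
lemma weak_lipschitz (h : Coeff C γ β) (hF : LipschitzWith KF F) (hCF : ∀ z, |F z| ≤ CF)
    (hW : LipschitzWith KW W)
    (heq : ∀ φ : Space d × ℝ → ℝ, ContDiff ℝ (⊤ : ℕ∞) φ → HasCompactSupport φ →
      tsupport φ ⊆ halfCyl d →
      ∫ z in halfCyl d, (γ z.1 * F z * td φ z - bil (β z.1) (sg W z) (sg φ z)) = 0)
    {φ : Space d × ℝ → ℝ} {K : NNReal} (hφ : LipschitzWith K φ) (hc : HasCompactSupport φ)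
    (hsub : tsupport φ ⊆ halfCyl d) :
    ∫ z in halfCyl d, (γ z.1 * F z * td φ z - bil (β z.1) (sg W z) (sg φ z)) = 0 := by
  obtain ⟨f, hf1, hf2, hf3, hf4, -, hf6⟩ :=
    exists_smooth_approx (volume : Measure (Space d × ℝ)) hφ hc isOpen_halfCyl hsub
  have hC := h.nonneg
  have hCF0 : 0 ≤ CF := (abs_nonneg _).trans (hCF 0)
  have hlim : Tendsto (fun n => ∫ z in halfCyl d,
      (γ z.1 * F z * td (f n) z - bil (β z.1) (sg W z) (sg (f n) z))) atTop
      (𝓝 (∫ z in halfCyl d, (γ z.1 * F z * td φ z - bil (β z.1) (sg W z) (sg φ z)))) := by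
    refine tendsto_integral_of_dominated_convergence (fun _ => C * CF * K + C * KW * K)
      (fun n => ?_) (integrableOn_const volume_halfCyl_ne_top) (fun n => ?_) ?_
    · exact (((h.γ_meas.comp_fst.mul hF.continuous.aemeasurable).mul
        (measurable_td _).aemeasurable).sub (h.bil_aemeas W (f n))).aestronglyMeasurable.restrict
    · refine Eventually.of_forall fun z => ?_
      refine (norm_sub_le _ _).trans (add_le_add ?_ ?_)
      · rw [norm_mul, norm_mul]
        gcongr
        · exact h.γ_le _
        · exact hCF z
        · exact abs_td_le (hf4 n) z
      · refine (h.bil_le _ _ _).trans ?_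
        gcongr
        · exact norm_sg_le hW z
        · exact norm_sg_le (hf4 n) z
    · refine ae_restrict_of_ae ?_
      filter_upwards [hf6] with z hz
      exact ((tendsto_td hz).const_mul _).sub
        (((continuous_bil_right _ _).tendsto _).comp (tendsto_sg hz))
  refine tendsto_nhds_unique hlim ?_
  simp_rw [fun n => heq (f n) (hf1 n) (hf2 n) (hf3 n)]
  exact tendsto_const_nhds

/-- Integration by parts in time in the weak equation. -/
lemma weak_td (h : Coeff C γ β) (hF : LipschitzWith KF F) (hCF : ∀ z, |F z| ≤ CF)
    (hW : LipschitzWith KW W)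
    (heq : ∀ φ : Space d × ℝ → ℝ, ContDiff ℝ (⊤ : ℕ∞) φ → HasCompactSupport φ →
      tsupport φ ⊆ halfCyl d →
      ∫ z in halfCyl d, (γ z.1 * F z * td φ z - bil (β z.1) (sg W z) (sg φ z)) = 0)
    {φ : Space d × ℝ → ℝ} {K : NNReal} (hφ : LipschitzWith K φ) (hc : HasCompactSupport φ)
    (hsub : tsupport φ ⊆ halfCyl d) :
    ∫ z in halfCyl d, (γ z.1 * td F z * φ z + bil (β z.1) (sg W z) (sg φ z)) = 0 := by
  have hC := h.nonneg
  have hCF0 : 0 ≤ CF := (abs_nonneg _).trans (hCF 0)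
  have h1 := h.weak_lipschitz hF hCF hW heq hφ hc hsub
  obtain ⟨Cφ, hCφ⟩ : ∃ Cφ, ∀ z, ‖φ z‖ ≤ Cφ := hφ.continuous.bounded_above_of_compact_support hc
  have hCφ0 : 0 ≤ Cφ := (norm_nonneg _).trans (hCφ 0)
  have hprod := lipschitzWith_mul_of_bounded hF hφ ⟨CF, hCF0⟩ ⟨Cφ, hCφ0⟩ hCF hCφ
  obtain ⟨KP, hprod⟩ : ∃ KP, LipschitzWith KP fun z => F z * φ z := ⟨_, hprod⟩
  have hfin : IsFiniteMeasure (volume.restrict (halfCyl d)) :=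
    ⟨by rw [Measure.restrict_apply_univ]; exact volume_halfCyl_ne_top.lt_top⟩
  have hint : ∀ f : Space d × ℝ → ℝ, AEMeasurable f → ∀ c : ℝ, (∀ z, |f z| ≤ c) →
      IntegrableOn f (halfCyl d) := fun f hf c hfc =>
    Integrable.of_bound hf.aestronglyMeasurable.restrict c (Eventually.of_forall hfc)
  have hγ := h.γ_meas.comp_fst (ν := (volume : Measure ℝ))
  have i1 : IntegrableOn (fun z => γ z.1 * td (fun z => F z * φ z) z) (halfCyl d) :=
    hint _ (hγ.mul (measurable_td _).aemeasurable) (C * KP) fun z => by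
      rw [abs_mul]
      gcongr
      · exact h.γ_le _
      · exact abs_td_le hprod z
  have i2 : IntegrableOn (fun z => γ z.1 * F z * td φ z - bil (β z.1) (sg W z) (sg φ z))
      (halfCyl d) :=
    hint _ (((hγ.mul hF.continuous.aemeasurable).mul (measurable_td _).aemeasurable).sub
      (h.bil_aemeas W φ)) (C * CF * K + C * KW * K) fun z => by
      refine (abs_sub _ _).trans (add_le_add ?_ ?_)
      · rw [abs_mul, abs_mul]
        gcongr
        · exact h.γ_le _
        · exact hCF z
        · exact abs_td_le hφ z
      · refine (h.bil_le _ _ _).trans ?_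
        gcongr
        · exact norm_sg_le hW z
        · exact norm_sg_le hφ z
  -- `γ` does not depend on time, so for almost every `x` the time integral of `∂ₜ (F φ)`
  -- telescopes, and `φ` vanishes at both ends.
  have hzero : ∫ z in halfCyl d, γ z.1 * td (fun z => F z * φ z) z = 0 := by
    have i1' := i1
    rw [halfCyl, Measure.volume_eq_prod] at i1' ⊢
    rw [setIntegral_prod _ i1']
    refine integral_eq_zero_of_ae (ae_restrict_of_ae ?_)
    filter_upwards [ae_integral_td hprod (by norm_num : (-1 : ℝ) ≤ 0)] with x hx
    have hφ0 : ∀ t, t ∉ Ioo (-1 : ℝ) 0 → φ (x, t) = 0 := fun t ht => by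
      by_contra hne
      exact ht (hsub (subset_tsupport _ hne)).2
    rw [integral_const_mul, ← integral_Ioc_eq_integral_Ioo, hx, hφ0 0 (by simp),
      hφ0 (-1) (by simp)]
    simp
  have hsubt := integral_sub i1 i2
  rw [h1, hzero, sub_zero] at hsubt
  rw [← hsubt]
  refine integral_congr_ae (ae_restrict_of_ae ?_)
  filter_upwards [hF.ae_differentiableAt (μ := volume), hφ.ae_differentiableAt (μ := volume)]
    with z hz1 hz2
  rw [td_mul hz1 hz2]
  ring

end Coeff

/-- The ramp function, vanishing below `1` and equal to `1` above `2`. -/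
def ramp (s : ℝ) : ℝ := max 0 (min 1 (s - 1))

lemma ramp_nonneg (s : ℝ) : 0 ≤ ramp s := le_max_left _ _

lemma ramp_le_one (s : ℝ) : ramp s ≤ 1 := max_le zero_le_one (min_le_left _ _)

lemma abs_ramp_le_one (s : ℝ) : |ramp s| ≤ 1 := by
  rw [abs_of_nonneg (ramp_nonneg s)]
  exact ramp_le_one s

lemma ramp_eq_zero {s : ℝ} (h : s ≤ 1) : ramp s = 0 := by
  have : min 1 (s - 1) ≤ 0 := (min_le_right _ _).trans (by linarith)
  exact max_eq_left this

lemma ramp_eq_one {s : ℝ} (h : 2 ≤ s) : ramp s = 1 := by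
  rw [ramp, min_eq_left (by linarith), max_eq_right zero_le_one]

lemma lipschitzWith_ramp : LipschitzWith 1 ramp := by
  have h1 : LipschitzWith (1 + 0) fun s : ℝ => s - 1 := LipschitzWith.id.sub (LipschitzWith.const 1)
  rw [add_zero] at h1
  exact (h1.const_min 1).const_max 0

lemma tendsto_ramp {s : ℝ} (hs : 0 < s) :
    Tendsto (fun n : ℕ => ramp ((n + 1) * s)) atTop (𝓝 1) := by
  obtain ⟨N, hN⟩ := exists_nat_gt (2 / s)
  refine tendsto_const_nhds.congr' ?_
  filter_upwards [eventually_ge_atTop N] with n hn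
  rw [ramp_eq_one]
  have h1 : (N : ℝ) ≤ n := by exact_mod_cast hn
  rw [div_lt_iff₀ hs] at hN
  nlinarith

/-- The spatial cutoff away from the degenerate boundary. -/
def spaceRamp (n : ℕ) (z : Space d × ℝ) : ℝ := ramp ((n + 1) * xp z.1)

/-- The cutoff of the time interval. -/
def timeRamp (t₁ t₂ : ℝ) (n : ℕ) (t : ℝ) : ℝ :=
  ramp ((n + 1) * (t - t₁)) * ramp ((n + 1) * (t₂ - t))

lemma abs_spaceRamp_le (n : ℕ) (z : Space d × ℝ) : |spaceRamp n z| ≤ 1 := abs_ramp_le_one _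

lemma abs_timeRamp_le (t₁ t₂ : ℝ) (n : ℕ) (t : ℝ) : |timeRamp t₁ t₂ n t| ≤ 1 := by
  rw [timeRamp, abs_mul]
  exact mul_le_one₀ (abs_ramp_le_one _) (abs_nonneg _) (abs_ramp_le_one _)

lemma lipschitzWith_const_mul (c : NNReal) : LipschitzWith c fun s : ℝ => c * s := by
  refine LipschitzWith.of_dist_le_mul fun x y => ?_
  rw [Real.dist_eq, Real.dist_eq, ← mul_sub, abs_mul, NNReal.abs_eq]

lemma lipschitzWith_spaceRamp (n : ℕ) :
    LipschitzWith (n + 1) (spaceRamp n : Space d × ℝ → ℝ) := by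
  change LipschitzWith (n + 1) fun z : Space d × ℝ => ramp ((n + 1) * xp z.1)
  have := lipschitzWith_ramp.comp ((lipschitzWith_const_mul (n + 1)).comp
    ((lipschitzWith_xp (d := d)).comp (LipschitzWith.prod_fst (β := ℝ))))
  simpa [Function.comp_def] using this

lemma lipschitzWith_timeRamp (t₁ t₂ : ℝ) (n : ℕ) :
    ∃ K, LipschitzWith K fun z : Space d × ℝ => timeRamp t₁ t₂ n z.2 := by
  have h1 : LipschitzWith (1 + 0) fun z : Space d × ℝ => z.2 - t₁ :=
    LipschitzWith.prod_snd.sub (LipschitzWith.const t₁)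
  have h2 : LipschitzWith (0 + 1) fun z : Space d × ℝ => t₂ - z.2 :=
    (LipschitzWith.const t₂).sub LipschitzWith.prod_snd
  have h3 := lipschitzWith_ramp.comp ((lipschitzWith_const_mul (n + 1)).comp h1)
  have h4 := lipschitzWith_ramp.comp ((lipschitzWith_const_mul (n + 1)).comp h2)
  have := lipschitzWith_mul_of_bounded h3 h4 1 1 (fun z => by simpa using abs_ramp_le_one _)
    (fun z => by simpa using abs_ramp_le_one _)
  exact ⟨_, by simpa [Function.comp_def, timeRamp] using this⟩

/-- The slope is at most `n + 1` and lives where `xp ≤ 2 / (n + 1)`, where the weight is at most `4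
/ (n + 1) ^ 2`. The product tends to zero, which is why no condition on the flat boundary is needed.
-/
lemma xp_sq_mul_norm_sg_spaceRamp_le (n : ℕ) (z : Space d × ℝ) :
    xp z.1 ^ 2 * ‖sg (spaceRamp n) z‖ ≤ 4 / (n + 1) := by
  have hn : (0 : ℝ) < n + 1 := by positivity
  rcases le_or_gt ((n + 1) * xp z.1) 2 with h | h
  · have h1 : ‖sg (spaceRamp n) z‖ ≤ n + 1 := by
      have := norm_sg_le (lipschitzWith_spaceRamp (d := d) n) z
      simpa using this
    have h2 : xp z.1 ≤ 2 / (n + 1) := by rw [le_div_iff₀ hn]; linarith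
    have h3 := xp_nonneg z.1
    calc _ ≤ (2 / (n + 1 : ℝ)) ^ 2 * (n + 1) := by gcongr
      _ = _ := by field_simp; norm_num
  · have hev : (spaceRamp n : Space d × ℝ → ℝ) =ᶠ[𝓝 z] fun _ => 1 := by
      have hc : ContinuousAt (fun y : Space d × ℝ => (n + 1 : ℝ) * xp y.1) z :=
        (continuous_const.mul (continuous_xp.comp continuous_fst)).continuousAt
      filter_upwards [hc.eventually (lt_mem_nhds h)] with y hy
      exact ramp_eq_one hy.le
    have : sg (fun _ : Space d × ℝ => (1 : ℝ)) z = 0 := by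
      ext i
      simp [sg]
    rw [sg_congr hev, this, norm_zero, mul_zero]
    positivity

/-- Boundedness without compact support in time: each point is compared, at the same time, with a
unit vector, where the function vanishes. -/
lemma abs_le_of_lipschitz_of_zero {φ : Space d × ℝ → ℝ} {K : NNReal} (hφ : LipschitzWith K φ)
    {ρ : ℝ} (hρ : ρ ≤ 1) (h0 : ∀ x t, ρ ≤ ‖x‖ → φ (x, t) = 0) (z : Space d × ℝ) :
    |φ z| ≤ 2 * K := by
  obtain ⟨x, t⟩ := z
  rcases le_or_gt ρ ‖x‖ with h | h
  · rw [h0 x t h, abs_zero]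
    positivity
  · set e : Space d := EuclideanSpace.single 0 1 with he
    have hen : ‖e‖ = 1 := by simp [he]
    have h1 := hφ.dist_le_mul (x, t) (e, t)
    rw [h0 e t (by rw [hen]; exact hρ), Real.dist_eq, sub_zero, Prod.dist_eq, dist_self,
      max_eq_left dist_nonneg] at h1
    refine h1.trans ?_
    have h2 : dist x e ≤ 2 := by
      rw [dist_eq_norm]
      refine (norm_sub_le _ _).trans ?_
      rw [hen]
      linarith
    rw [mul_comm]
    gcongr

namespace Coeff

variable {C : ℝ} {γ : Space d → ℝ} {β : Space d → Matrix (Fin (d + 1)) (Fin (d + 1)) ℝ}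
  {F W : Space d × ℝ → ℝ} {KF KW : NNReal} {CF : ℝ}

/-- The weak equation with Lipschitz test functions that need not vanish on the flat boundary nor
at the ends of the time interval. -/
lemma weak_up_to_boundary (h : Coeff C γ β) (hF : LipschitzWith KF F) (hCF : ∀ z, |F z| ≤ CF)
    (hW : LipschitzWith KW W)
    (heq : ∀ φ : Space d × ℝ → ℝ, ContDiff ℝ (⊤ : ℕ∞) φ → HasCompactSupport φ →
      tsupport φ ⊆ halfCyl d →
      ∫ z in halfCyl d, (γ z.1 * F z * td φ z - bil (β z.1) (sg W z) (sg φ z)) = 0)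
    {φ : Space d × ℝ → ℝ} {K : NNReal} (hφ : LipschitzWith K φ) {ρ : ℝ} (hρ : ρ < 1)
    (h0 : ∀ x t, ρ ≤ ‖x‖ → φ (x, t) = 0) {t₁ t₂ : ℝ} (ht₁ : -1 ≤ t₁) (ht₂ : t₂ ≤ 0) :
    ∫ z in ball (0 : Space d) 1 ×ˢ Ioc t₁ t₂,
      (γ z.1 * td F z * φ z + bil (β z.1) (sg W z) (sg φ z)) = 0 := by
  have hC := h.nonneg
  have hCF0 : 0 ≤ CF := (abs_nonneg _).trans (hCF 0)
  have hCφ := abs_le_of_lipschitz_of_zero hφ hρ.le h0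
  set τ := timeRamp t₁ t₂ with hτ
  -- The equation is used in the form where the time derivative falls on `F`, so the steep time
  -- ramps are never differentiated; only the spatial ramp contributes an error.
  set f : ℕ → Space d × ℝ → ℝ := fun n z => spaceRamp n z * φ z * τ n z.2 with hf
  have hsφ : ∀ n, ∃ K', LipschitzWith K' fun z => spaceRamp n z * φ z := fun n =>
    ⟨_, lipschitzWith_mul_of_bounded (lipschitzWith_spaceRamp n) hφ 1 (2 * K)
      (fun z => by simpa using abs_spaceRamp_le n z) (fun z => by simpa using hCφ z)⟩
  have hsφb : ∀ n z, |spaceRamp n z * φ z| ≤ 2 * K := fun n z => by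
    rw [abs_mul]
    calc _ ≤ 1 * (2 * (K : ℝ)) := mul_le_mul (abs_spaceRamp_le n z) (hCφ z) (abs_nonneg _) zero_le_one
      _ = _ := one_mul _
  have hfL : ∀ n, ∃ K', LipschitzWith K' (f n) := fun n => by
    obtain ⟨K1, h1⟩ := hsφ n
    obtain ⟨K2, h2⟩ := lipschitzWith_timeRamp (d := d) t₁ t₂ n
    exact ⟨_, lipschitzWith_mul_of_bounded h1 h2 (2 * K) 1 (fun z => by simpa using hsφb n z)
      (fun z => by simpa using abs_timeRamp_le t₁ t₂ n z.2)⟩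
  -- supports
  have hsupp : ∀ n : ℕ, ∃ S : Set (Space d × ℝ), IsCompact S ∧ S ⊆ halfCyl d ∧
      Function.support (f n) ⊆ S := fun n => by
    have hn : (0 : ℝ) < n + 1 := by positivity
    refine ⟨(closedBall 0 ρ ×ˢ Icc (t₁ + 1 / (n + 1)) (t₂ - 1 / (n + 1))) ∩
      {z | 1 ≤ (n + 1) * xp z.1}, ?_, ?_, ?_⟩
    · exact ((isCompact_closedBall _ _).prod isCompact_Icc).inter_right
        (isClosed_le continuous_const (continuous_const.mul (continuous_xp.comp continuous_fst)))
    · rintro ⟨x, t⟩ ⟨⟨hx, ht⟩, hxp⟩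
      have hpos : 0 < 1 / (n + 1 : ℝ) := by positivity
      have hxp' : 1 ≤ (n + 1 : ℝ) * xp x := hxp
      refine ⟨⟨mem_ball_zero_iff.2 ((mem_closedBall_zero_iff.1 hx).trans_lt hρ), ?_⟩,
        by linarith [ht.1], by linarith [ht.2]⟩
      by_contra hneg
      have : xp x = 0 := max_eq_right (not_lt.1 hneg)
      rw [this] at hxp'
      linarith
    · rintro ⟨x, t⟩ hz
      have hz1 : spaceRamp n (x, t) ≠ 0 := fun e => hz (by simp [hf, e])
      have hz2 : φ (x, t) ≠ 0 := fun e => hz (by simp [hf, e])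
      have hz3 : τ n t ≠ 0 := fun e => hz (by simp [hf, e])
      have hz4 : ramp ((n + 1) * (t - t₁)) ≠ 0 := fun e => hz3 (by simp [hτ, timeRamp, e])
      have hz5 : ramp ((n + 1) * (t₂ - t)) ≠ 0 := fun e => hz3 (by simp [hτ, timeRamp, e])
      have e1 : 1 < (n + 1 : ℝ) * xp x := not_le.1 fun e => hz1 (ramp_eq_zero e)
      have e2 : 1 < (n + 1 : ℝ) * (t - t₁) := not_le.1 fun e => hz4 (ramp_eq_zero e)
      have e3 : 1 < (n + 1 : ℝ) * (t₂ - t) := not_le.1 fun e => hz5 (ramp_eq_zero e)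
      have e4 : ‖x‖ < ρ := not_le.1 fun e => hz2 (h0 x t e)
      have e5 : 1 / (n + 1 : ℝ) < t - t₁ := by rw [div_lt_iff₀ hn]; linarith
      have e6 : 1 / (n + 1 : ℝ) < t₂ - t := by rw [div_lt_iff₀ hn]; linarith
      exact ⟨⟨mem_closedBall_zero_iff.2 e4.le, by linarith, by linarith⟩, e1.le⟩
  have hzero : ∀ n, ∫ z in halfCyl d,
      (γ z.1 * td F z * f n z + bil (β z.1) (sg W z) (sg (f n) z)) = 0 := fun n => by
    obtain ⟨S, hS1, hS2, hS3⟩ := hsupp n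
    obtain ⟨K', hK'⟩ := hfL n
    exact h.weak_td hF hCF hW heq hK' (HasCompactSupport.of_support_subset_isCompact hS1 hS3)
      ((closure_minimal hS3 hS1.isClosed).trans hS2)
  -- the limit
  set T : Set (Space d × ℝ) := {z | z.2 ∈ Ioo t₁ t₂} with hT
  have hTm : MeasurableSet T := measurable_snd measurableSet_Ioo
  have hsg : ∀ n, ∀ᵐ z, sg (f n) z
      = (τ n z.2 * spaceRamp n z) • sg φ z + (τ n z.2 * φ z) • sg (spaceRamp n) z := fun n => by
    obtain ⟨K1, h1⟩ := hsφ n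
    obtain ⟨K2, h2⟩ := lipschitzWith_timeRamp (d := d) t₁ t₂ n
    filter_upwards [h1.ae_differentiableAt (μ := volume), h2.ae_differentiableAt (μ := volume),
      hφ.ae_differentiableAt (μ := volume),
      (lipschitzWith_spaceRamp n).ae_differentiableAt (μ := volume)] with z d1 d2 d3 d4
    rw [sg_mul d1 d2, sg_fun_snd (f := timeRamp t₁ t₂ n) d2, sg_mul d4 d3]
    module
  have hbil : ∀ n, ∀ᵐ z, bil (β z.1) (sg W z) (sg (f n) z)
      = spaceRamp n z * τ n z.2 * bil (β z.1) (sg W z) (sg φ z)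
        + τ n z.2 * φ z * bil (β z.1) (sg W z) (sg (spaceRamp n) z) := fun n => by
    filter_upwards [hsg n] with z hz
    rw [hz, bil_add_right, bil_smul_right, bil_smul_right]
    ring
  -- The only term in which the gradient falls on the spatial ramp; the weight `xp ^ 2` in `β` makes
  -- it `O(1 / n)`.
  have hsmall : ∀ n : ℕ, ∀ z, |τ n z.2 * φ z * bil (β z.1) (sg W z) (sg (spaceRamp n) z)|
      ≤ 2 * K * C * KW * 4 * (1 / (n + 1)) := fun n z => by
    rw [abs_mul, abs_mul]
    have hb : |bil (β z.1) (sg W z) (sg (spaceRamp n) z)| ≤ C * KW * (4 / (n + 1)) := by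
      by_cases hx : z.1 ∈ halfBall (0 : Space d) 1
      · refine (h.β_le _ hx _ _).trans ?_
        calc _ = C * ‖sg W z‖ * (xp z.1 ^ 2 * ‖sg (spaceRamp n) z‖) := by ring
          _ ≤ _ := by
              have := norm_sg_le hW z
              have := xp_sq_mul_norm_sg_spaceRamp_le n z
              gcongr
      · have : bil (β z.1) (sg W z) (sg (spaceRamp n) z) = 0 := by
          simp [h.β_zero _ hx, bil, matForm]
        rw [this, abs_zero]
        positivity
    calc _ ≤ 1 * (2 * K) * (C * KW * (4 / (n + 1))) := by
          have := abs_timeRamp_le t₁ t₂ n z.2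
          have := hCφ z
          gcongr
      _ = _ := by ring
  have hlim : Tendsto (fun n => ∫ z in halfCyl d,
      (γ z.1 * td F z * f n z + bil (β z.1) (sg W z) (sg (f n) z))) atTop
      (𝓝 (∫ z in halfCyl d, T.indicator
        (fun z => γ z.1 * td F z * φ z + bil (β z.1) (sg W z) (sg φ z)) z)) := by
    refine tendsto_integral_of_dominated_convergence
      (fun _ => C * KF * (2 * K) + (C * KW * K + 2 * K * C * KW * 4 * 1))
      (fun n => ?_) (integrableOn_const volume_halfCyl_ne_top) (fun n => ?_) ?_
    · obtain ⟨K', hK'⟩ := hfL n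
      exact (((h.γ_meas.comp_fst.mul (measurable_td _).aemeasurable).mul
        hK'.continuous.aemeasurable).add (h.bil_aemeas W (f n))).aestronglyMeasurable.restrict
    · refine ae_restrict_of_ae ?_
      filter_upwards [hbil n] with z hz
      have hτn := abs_timeRamp_le t₁ t₂ n z.2
      have hsn := abs_spaceRamp_le n z
      refine (norm_add_le _ _).trans (add_le_add ?_ ?_)
      · rw [norm_mul, norm_mul]
        gcongr
        · exact h.γ_le _
        · exact abs_td_le hF z
        · rw [hf, norm_mul]
          calc _ ≤ 2 * (K : ℝ) * 1 := mul_le_mul (hsφb n z) hτn (abs_nonneg _) (by positivity)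
            _ = _ := mul_one _
      · rw [hz]
        refine (norm_add_le _ _).trans (add_le_add ?_ ((hsmall n z).trans ?_))
        · rw [norm_mul, norm_mul]
          calc _ ≤ 1 * 1 * (C * KW * K) := by
                gcongr
                · exact hsn
                · exact hτn
                · refine (h.bil_le _ _ _).trans ?_
                  gcongr
                  · exact norm_sg_le hW z
                  · exact norm_sg_le hφ z
            _ = _ := by ring
        · gcongr
          rw [div_le_one (by positivity)]
          linarith [(Nat.cast_nonneg n : (0 : ℝ) ≤ n)]
    · rw [ae_restrict_iff' isOpen_halfCyl.measurableSet]
      filter_upwards [ae_all_iff.2 hbil] with z hz hzΩ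
      have hxpos : 0 < xp z.1 := lt_max_of_lt_left hzΩ.1.2
      have hs : Tendsto (fun n => spaceRamp n z) atTop (𝓝 1) := tendsto_ramp hxpos
      have hsm : Tendsto (fun n : ℕ => τ n z.2 * φ z * bil (β z.1) (sg W z) (sg (spaceRamp n) z))
          atTop (𝓝 0) := by
        refine squeeze_zero_norm (fun n => hsmall n z) ?_
        have := (tendsto_one_div_add_atTop_nhds_zero_nat (𝕜 := ℝ)).const_mul (2 * K * C * KW * 4)
        simpa using this
      simp_rw [hz]
      have hτlim : Tendsto (fun n => τ n z.2) atTop (𝓝 (T.indicator (fun _ => 1) z)) := by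
        by_cases hzT : z ∈ T
        · rw [indicator_of_mem hzT]
          have h1 := tendsto_ramp (sub_pos.2 hzT.1)
          have h2 := tendsto_ramp (sub_pos.2 hzT.2)
          simpa [hτ, timeRamp] using h1.mul h2
        · rw [indicator_of_notMem hzT]
          refine tendsto_const_nhds.congr fun n => ?_
          have hn : (0 : ℝ) < n + 1 := by positivity
          rw [hτ, timeRamp]
          rcases le_or_gt z.2 t₁ with hle | hgt
          · rw [ramp_eq_zero (s := (n + 1) * (z.2 - t₁)) (by nlinarith), zero_mul]
          · have : t₂ ≤ z.2 := not_lt.1 fun e => hzT ⟨hgt, e⟩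
            rw [ramp_eq_zero (s := (n + 1) * (t₂ - z.2)) (by nlinarith), mul_zero]
      have hmain := (((hs.mul_const (φ z)).mul hτlim).const_mul (γ z.1 * td F z)).add
        (((hs.mul hτlim).mul_const (bil (β z.1) (sg W z) (sg φ z))).add hsm)
      refine hmain.trans (le_of_eq ?_)
      congr 1
      by_cases hzT : z ∈ T
      · simp [indicator_of_mem hzT]
      · simp [indicator_of_notMem hzT]
  simp_rw [hzero] at hlim
  have h00 := tendsto_nhds_unique hlim tendsto_const_nhds
  rw [setIntegral_indicator hTm] at h00
  have hset : halfCyl d ∩ T = halfBall 0 1 ×ˢ Ioo t₁ t₂ := by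
    ext ⟨x, t⟩
    simp only [halfCyl, hT, mem_inter_iff, mem_prod, mem_ofPred_eq, mem_Ioo]
    constructor
    · rintro ⟨⟨a, -⟩, b⟩
      exact ⟨a, b⟩
    · rintro ⟨a, b, c⟩
      exact ⟨⟨a, by linarith, by linarith⟩, b, c⟩
  rw [hset] at h00
  have hae : (halfBall (0 : Space d) 1 ×ˢ Ioo t₁ t₂ : Set (Space d × ℝ))
      =ᵐ[volume] (halfBall (0 : Space d) 1 ×ˢ Ioc t₁ t₂ : Set (Space d × ℝ)) := by
    rw [Measure.volume_eq_prod]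
    exact Measure.set_prod_ae_eq (ae_eq_refl _) Ioo_ae_eq_Ioc
  rw [setIntegral_congr_set hae] at h00
  rw [← h00]
  -- The coefficients were extended by zero, so integrating over the full ball changes nothing.
  refine setIntegral_eq_of_subset_of_forall_sdiff_eq_zero (measurableSet_cyl _ _)
    (prod_mono inter_subset_left subset_rfl) fun z hz => ?_
  have hz1 : z.1 ∉ halfBall (0 : Space d) 1 := fun e => hz.2 ⟨e, hz.1.2⟩
  simp [h.γ_zero _ hz1, h.β_zero _ hz1, bil, matForm]

end Coeff

/-! ### Anisotropic affine changes of variables -/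

section Affine

/-- Anisotropic scaling of space-time. -/
def scaling (d : ℕ) {r σ : ℝ} (hr : r ≠ 0) (hσ : σ ≠ 0) : (Space d × ℝ) ≃L[ℝ] (Space d × ℝ) :=
  (ContinuousLinearEquiv.smulLeft (Units.mk0 r hr)).prodCongr
    (ContinuousLinearEquiv.smulLeft (Units.mk0 σ hσ))

lemma scaling_apply {r σ : ℝ} (hr : r ≠ 0) (hσ : σ ≠ 0) (z : Space d × ℝ) :
    scaling d hr hσ z = (r • z.1, σ * z.2) := rfl

lemma fderiv_affine {r σ : ℝ} (hr : r ≠ 0) (hσ : σ ≠ 0) (x₀ : Space d) (t₀ : ℝ)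
    (f : Space d × ℝ → ℝ) (z : Space d × ℝ) :
    fderiv ℝ (fun y : Space d × ℝ => f (x₀ + r • y.1, t₀ + σ * y.2)) z
      = (fderiv ℝ f (x₀ + r • z.1, t₀ + σ * z.2)).comp
        (scaling d hr hσ : (Space d × ℝ) →L[ℝ] (Space d × ℝ)) := by
  have h := (scaling d hr hσ).comp_right_fderiv (f := fun y => f ((x₀, t₀) + y)) (x := z)
  rw [fderiv_comp_add_left] at h
  exact h

lemma sg_affine {r σ : ℝ} (hr : r ≠ 0) (hσ : σ ≠ 0) (x₀ : Space d) (t₀ : ℝ)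
    (f : Space d × ℝ → ℝ) (z : Space d × ℝ) :
    sg (fun y : Space d × ℝ => f (x₀ + r • y.1, t₀ + σ * y.2)) z
      = r • sg f (x₀ + r • z.1, t₀ + σ * z.2) := by
  ext i
  change fderiv ℝ (fun y : Space d × ℝ => f (x₀ + r • y.1, t₀ + σ * y.2)) z
    (EuclideanSpace.single i 1, 0) = r * fderiv ℝ f (x₀ + r • z.1, t₀ + σ * z.2)
      (EuclideanSpace.single i 1, 0)
  rw [fderiv_affine hr hσ, ContinuousLinearMap.comp_apply, ContinuousLinearEquiv.coe_coe,
    scaling_apply, show (r • ((EuclideanSpace.single i 1 : Space d), (0 : ℝ)).1,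
      σ * ((EuclideanSpace.single i 1 : Space d), (0 : ℝ)).2)
      = r • ((EuclideanSpace.single i 1 : Space d), (0 : ℝ)) by ext1 <;> simp, map_smul,
    smul_eq_mul]

lemma td_affine {r σ : ℝ} (hr : r ≠ 0) (hσ : σ ≠ 0) (x₀ : Space d) (t₀ : ℝ)
    (f : Space d × ℝ → ℝ) (z : Space d × ℝ) :
    td (fun y : Space d × ℝ => f (x₀ + r • y.1, t₀ + σ * y.2)) z
      = σ * td f (x₀ + r • z.1, t₀ + σ * z.2) := by
  rw [td, td, fderiv_affine hr hσ, ContinuousLinearMap.comp_apply, ContinuousLinearEquiv.coe_coe,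
    scaling_apply, show (r • ((0 : Space d), (1 : ℝ)).1, σ * ((0 : Space d), (1 : ℝ)).2)
      = σ • ((0 : Space d), (1 : ℝ)) by ext1 <;> simp, map_smul, smul_eq_mul]

lemma image_affine_cyl {r σ : ℝ} (hr : 0 < r) (hσ : 0 < σ) (x₀ : Space d) (t₀ t₁ t₂ : ℝ) :
    (fun y : Space d × ℝ => (x₀ + r • y.1, t₀ + σ * y.2)) '' (ball 0 1 ×ˢ Ioc t₁ t₂)
      = ball x₀ r ×ˢ Ioc (t₀ + σ * t₁) (t₀ + σ * t₂) := by
  ext ⟨x, t⟩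
  constructor
  · rintro ⟨⟨y, s⟩, ⟨hy, hs⟩, he⟩
    simp only [Prod.mk.injEq] at he
    obtain ⟨rfl, rfl⟩ := he
    refine ⟨?_, ?_, ?_⟩
    · rw [mem_ball, dist_eq_norm, add_sub_cancel_left, norm_smul, Real.norm_of_nonneg hr.le]
      have := mem_ball_zero_iff.1 hy
      exact mul_lt_of_lt_one_right hr this
    · have := mul_lt_mul_of_pos_left hs.1 hσ
      change t₀ + σ * t₁ < t₀ + σ * s
      linarith
    · have := mul_le_mul_of_nonneg_left hs.2 hσ.le
      change t₀ + σ * s ≤ t₀ + σ * t₂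
      linarith
  · rintro ⟨hx, ht⟩
    refine ⟨(r⁻¹ • (x - x₀), σ⁻¹ * (t - t₀)), ⟨?_, ?_, ?_⟩, ?_⟩
    · rw [mem_ball_zero_iff, norm_smul, norm_inv, Real.norm_of_nonneg hr.le,
        inv_mul_lt_iff₀ hr, mul_one, ← dist_eq_norm]
      exact hx
    · have := ht.1
      rw [lt_inv_mul_iff₀ hσ]
      linarith
    · have := ht.2
      rw [inv_mul_le_iff₀ hσ]
      linarith
    · simp only [Prod.mk.injEq]
      refine ⟨?_, ?_⟩
      · rw [smul_smul, mul_inv_cancel₀ hr.ne', one_smul, add_sub_cancel]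
      · rw [mul_inv_cancel_left₀ hσ.ne', add_sub_cancel]

/-- The Jacobian is a nonzero constant, so the vanishing of an integral is transported without
computing the determinant. -/
lemma setIntegral_affine_eq_zero {r σ : ℝ} (hr : 0 < r) (hσ : 0 < σ) (x₀ : Space d)
    (t₀ t₁ t₂ : ℝ) (f : Space d × ℝ → ℝ)
    (h : ∫ y in ball x₀ r ×ˢ Ioc (t₀ + σ * t₁) (t₀ + σ * t₂), f y = 0) :
    ∫ z in ball (0 : Space d) 1 ×ˢ Ioc t₁ t₂, f (x₀ + r • z.1, t₀ + σ * z.2) = 0 := by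
  set e := scaling d hr.ne' hσ.ne' with he
  have hd : ∀ z : Space d × ℝ, HasFDerivAt
      (fun y : Space d × ℝ => (x₀ + r • y.1, t₀ + σ * y.2))
      (e : (Space d × ℝ) →L[ℝ] (Space d × ℝ)) z := fun z =>
    e.hasFDerivAt.const_add (x₀, t₀)
  have hinj : Function.Injective (fun y : Space d × ℝ => (x₀ + r • y.1, t₀ + σ * y.2)) := by
    intro y y' hyy
    have : (x₀, t₀) + e y = (x₀, t₀) + e y' := hyy
    exact e.injective (add_left_cancel this)
  have h1 := integral_image_eq_integral_abs_det_fderiv_smul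
    (f := fun y : Space d × ℝ => (x₀ + r • y.1, t₀ + σ * y.2))
    (f' := fun _ => (e : (Space d × ℝ) →L[ℝ] (Space d × ℝ)))
    (volume : Measure (Space d × ℝ)) (measurableSet_cyl t₁ t₂)
    (fun z _ => (hd z).hasFDerivWithinAt) hinj.injOn f
  rw [image_affine_cyl hr hσ, h, integral_smul] at h1
  have hdet : |(e : (Space d × ℝ) →L[ℝ] (Space d × ℝ)).det| ≠ 0 :=
    abs_ne_zero.2 (LinearEquiv.isUnit_det' e.toLinearEquiv).ne_zero
  exact (smul_eq_zero.1 h1.symm).resolve_left hdet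

lemma quasiMeasurePreserving_affine {r : ℝ} (hr : r ≠ 0) (x₀ : Space d) :
    Measure.QuasiMeasurePreserving (fun x : Space d => x₀ + r • x) volume volume :=
  (measurePreserving_add_left volume x₀).quasiMeasurePreserving.comp
    (Measure.quasiMeasurePreserving_smul volume hr)

end Affine

/-! ### The original equation and its rescalings -/

/-- A Lipschitz function on space-time, between `m` and `M`, which solves the equation. -/
structure WeakData (p Λ m M : ℝ) (G : Space d → ℝ)
    (A : Space d → Matrix (Fin (d + 1)) (Fin (d + 1)) ℝ) (W : Space d × ℝ → ℝ) : Prop where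
  one_le_p : 1 ≤ p
  one_le_Λ : 1 ≤ Λ
  m_pos : 0 < m
  m_le : m ≤ M
  G_meas : AEMeasurable G (volume.restrict (halfBall 0 1))
  G_bd : ∀ x ∈ halfBall (0 : Space d) 1,
    Λ⁻¹ * x (Fin.last d) ≤ G x ∧ G x ≤ Λ * x (Fin.last d)
  A_meas : ∀ i j, AEMeasurable (fun x => A x i j) (volume.restrict (halfBall 0 1))
  A_lower : ∀ x ∈ halfBall (0 : Space d) 1, ∀ ξ : Space d, Λ⁻¹ * ‖ξ‖ ^ 2 ≤ bil (A x) ξ ξ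
  A_upper : ∀ x ∈ halfBall (0 : Space d) 1, ∀ ξ η : Space d, |bil (A x) ξ η| ≤ Λ * ‖ξ‖ * ‖η‖
  lip : ∃ K, LipschitzWith K W
  mem : ∀ z, W z ∈ Icc m M
  eqn : IsDistribSolution p G A W

/-- The weight in front of the time derivative, extended by zero. -/
def timeWeight (p : ℝ) (G : Space d → ℝ) : Space d → ℝ :=
  (halfBall 0 1).indicator fun x => G x ^ (p + 1)

/-- The diffusion matrix, extended by zero. -/
def diffMatrix (G : Space d → ℝ) (A : Space d → Matrix (Fin (d + 1)) (Fin (d + 1)) ℝ) :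
    Space d → Matrix (Fin (d + 1)) (Fin (d + 1)) ℝ :=
  (halfBall 0 1).indicator fun x => G x ^ 2 • A x

namespace WeakData

variable {p Λ m M : ℝ} {G : Space d → ℝ} {A : Space d → Matrix (Fin (d + 1)) (Fin (d + 1)) ℝ}
  {W : Space d × ℝ → ℝ}

lemma Λ_pos (h : WeakData p Λ m M G A W) : 0 < Λ := one_pos.trans_le h.one_le_Λ

lemma xp_eq {x : Space d} (hx : 0 < x (Fin.last d)) : xp x = x (Fin.last d) := max_eq_left hx.le

lemma G_nonneg (h : WeakData p Λ m M G A W) {x : Space d} (hx : x ∈ halfBall (0 : Space d) 1) :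
    0 ≤ G x :=
  (mul_nonneg (inv_nonneg.2 h.Λ_pos.le) (le_of_lt hx.2)).trans (h.G_bd x hx).1

lemma coeff (h : WeakData p Λ m M G A W) :
    Coeff (Λ ^ (p + 1) + Λ ^ 3) (timeWeight p G) (diffMatrix G A) where
  nonneg := by
    have := h.Λ_pos
    positivity
  γ_meas := (aemeasurable_indicator_iff (measurableSet_halfBall _ _)).2 (h.G_meas.pow_const _)
  γ_le := fun x => by
    have hΛ := h.Λ_pos
    by_cases hx : x ∈ halfBall (0 : Space d) 1
    · rw [timeWeight, indicator_of_mem hx, abs_of_nonneg (Real.rpow_nonneg (h.G_nonneg hx) _)]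
      have hG : G x ≤ Λ := by
        refine (h.G_bd x hx).2.trans (mul_le_of_le_one_right hΛ.le ?_)
        rw [← xp_eq hx.2]
        exact xp_le_one hx.1
      have := Real.rpow_le_rpow (h.G_nonneg hx) hG (z := p + 1) (by linarith [h.one_le_p])
      have h3 : 0 ≤ Λ ^ 3 := by positivity
      linarith
    · rw [timeWeight, indicator_of_notMem hx, abs_zero]
      positivity
  β_meas := fun i j => by
    have e : (fun x => diffMatrix G A x i j)
        = (halfBall (0 : Space d) 1).indicator fun x => G x ^ 2 * A x i j := by
      ext x
      by_cases hx : x ∈ halfBall (0 : Space d) 1 <;> simp [diffMatrix, hx]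
    rw [e]
    exact (aemeasurable_indicator_iff (measurableSet_halfBall _ _)).2
      ((h.G_meas.pow_const _).mul (h.A_meas i j))
  β_le := fun x hx ξ η => by
    have hΛ := h.Λ_pos
    rw [diffMatrix, indicator_of_mem hx, bil_smul_matrix, abs_mul, abs_of_nonneg (sq_nonneg _)]
    have hG0 := h.G_nonneg hx
    have hG : G x ≤ Λ * xp x := by rw [xp_eq hx.2]; exact (h.G_bd x hx).2
    calc _ ≤ (Λ * xp x) ^ 2 * (Λ * ‖ξ‖ * ‖η‖) := by
          have := h.A_upper x hx ξ η
          gcongr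
      _ = Λ ^ 3 * xp x ^ 2 * ‖ξ‖ * ‖η‖ := by ring
      _ ≤ _ := by
          gcongr
          have : 0 ≤ Λ ^ (p + 1) := by positivity
          linarith
  γ_zero := fun x hx => indicator_of_notMem hx _
  β_zero := fun x hx => indicator_of_notMem hx _

lemma hasDerivAt_rpow (h : WeakData p Λ m M G A W) (z : Space d × ℝ) :
    HasDerivAt (fun s : ℝ => s ^ p) (p * W z ^ (p - 1)) (W z) :=
  Real.hasDerivAt_rpow_const (Or.inl (h.m_pos.trans_le (h.mem z).1).ne')

lemma lipschitzWith_rpow (h : WeakData p Λ m M G A W) {K : NNReal} (hK : LipschitzWith K W) :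
    LipschitzWith ((p * M ^ (p - 1)).toNNReal * K) fun z => W z ^ p := by
  have hp := h.one_le_p
  have hM : 0 < M := h.m_pos.trans_le h.m_le
  have h1 : LipschitzOnWith (p * M ^ (p - 1)).toNNReal (fun s : ℝ => s ^ p) (Icc m M) := by
    refine (convex_Icc m M).lipschitzOnWith_of_nnnorm_hasDerivWithin_le
      (f' := fun s => p * s ^ (p - 1)) (fun s hs => ?_) fun s hs => ?_
    · exact (Real.hasDerivAt_rpow_const
        (Or.inl (h.m_pos.trans_le hs.1).ne')).hasDerivWithinAt
    · have hs0 : 0 ≤ s := h.m_pos.le.trans hs.1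
      rw [← NNReal.coe_le_coe, coe_nnnorm, Real.norm_of_nonneg (by positivity),
        Real.coe_toNNReal _ (by positivity)]
      have := Real.rpow_le_rpow hs0 hs.2 (z := p - 1) (by linarith)
      gcongr
  rw [← lipschitzOnWith_univ] at hK ⊢
  exact h1.comp hK fun z _ => h.mem z

lemma abs_rpow_le (h : WeakData p Λ m M G A W) (z : Space d × ℝ) : |W z ^ p| ≤ M ^ p := by
  have h0 := h.m_pos.le.trans (h.mem z).1
  rw [abs_of_nonneg (Real.rpow_nonneg h0 _)]
  exact Real.rpow_le_rpow h0 (h.mem z).2 (by linarith [h.one_le_p])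

/-- The distributional formulation uses derivatives of slices, the later arguments those of the
total derivative. The two agree wherever `W` is differentiable, hence almost everywhere. -/
lemma weak_smooth (h : WeakData p Λ m M G A W) {φ : Space d × ℝ → ℝ}
    (hφ : ContDiff ℝ (⊤ : ℕ∞) φ) (hc : HasCompactSupport φ) (hsub : tsupport φ ⊆ halfCyl d) :
    ∫ z in halfCyl d, (timeWeight p G z.1 * W z ^ p * td φ z
      - bil (diffMatrix G A z.1) (sg W z) (sg φ z)) = 0 := by
  obtain ⟨K, hK⟩ := h.lip
  obtain ⟨Kφ, hKφ⟩ := hφ.lipschitzWith_of_hasCompactSupport hc (by simp)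
  have hF := h.lipschitzWith_rpow hK
  have hco := h.coeff
  set C := Λ ^ (p + 1) + Λ ^ 3
  have hC := hco.nonneg
  have hM0 : 0 ≤ M ^ p := (abs_nonneg _).trans (h.abs_rpow_le 0)
  have hfin : IsFiniteMeasure (volume.restrict (halfCyl d)) :=
    ⟨by rw [Measure.restrict_apply_univ]; exact volume_halfCyl_ne_top.lt_top⟩
  have i1 : IntegrableOn (fun z => timeWeight p G z.1 * W z ^ p * td φ z) (halfCyl d) :=
    Integrable.of_bound ((hco.γ_meas.comp_fst.mul hF.continuous.aemeasurable).mul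
      (measurable_td _).aemeasurable).aestronglyMeasurable.restrict (C * M ^ p * Kφ)
      (Eventually.of_forall fun z => by
        rw [norm_mul, norm_mul]
        gcongr
        · exact hco.γ_le _
        · exact h.abs_rpow_le z
        · exact abs_td_le hKφ z)
  have i2 : IntegrableOn (fun z => bil (diffMatrix G A z.1) (sg W z) (sg φ z)) (halfCyl d) :=
    Integrable.of_bound (hco.bil_aemeas W φ).aestronglyMeasurable.restrict (C * K * Kφ)
      (Eventually.of_forall fun z => by
        refine (hco.bil_le _ _ _).trans ?_
        gcongr
        · exact norm_sg_le hK z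
        · exact norm_sg_le hKφ z)
  rw [integral_sub i1 i2, sub_eq_zero]
  have hdist := h.eqn φ hφ hc hsub
  have hdφ : ∀ z, DifferentiableAt ℝ φ z := fun z => (hφ.differentiable (by simp)).differentiableAt
  have hsp : ∀ (f : Space d × ℝ → ℝ) z, DifferentiableAt ℝ f z → ∀ i,
      spacePartial f i z = sg f z i := fun f z hz i => by
    rw [spacePartial, (hasFDerivAt_slice_space (x := z.1) (t := z.2) hz).fderiv]
    rfl
  have e1 : ∫ z in halfCyl d, timeWeight p G z.1 * W z ^ p * td φ z
      = ∫ z in halfBall (0 : Space d) 1 ×ˢ Ioo (-1 : ℝ) 0,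
        G z.1 ^ (p + 1) * W z ^ p * timePartial φ z := by
    refine setIntegral_congr_fun isOpen_halfCyl.measurableSet fun z hz => ?_
    have : timePartial φ z = td φ z := (hasDerivAt_slice_time (x := z.1) (t := z.2) (hdφ z)).deriv
    simp only [this, timeWeight, indicator_of_mem hz.1]
  have e2 : ∫ z in halfCyl d, bil (diffMatrix G A z.1) (sg W z) (sg φ z)
      = ∫ z in halfBall (0 : Space d) 1 ×ˢ Ioo (-1 : ℝ) 0,
        G z.1 ^ 2 * matForm (A z.1) (fun j => spacePartial W j z) (fun i => spacePartial φ i z) := by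
    refine setIntegral_congr_ae isOpen_halfCyl.measurableSet ?_
    filter_upwards [hK.ae_differentiableAt (μ := volume)] with z hz hzΩ
    rw [diffMatrix, indicator_of_mem hzΩ.1, bil_smul_matrix, bil]
    simp only [hsp W z hz, hsp φ z (hdφ z)]
  rw [e1, e2, hdist]

/-- The weak equation in its final form. -/
lemma weak_eqn (h : WeakData p Λ m M G A W) {φ : Space d × ℝ → ℝ} {K : NNReal}
    (hφ : LipschitzWith K φ) {ρ : ℝ} (hρ : ρ < 1) (h0 : ∀ x t, ρ ≤ ‖x‖ → φ (x, t) = 0)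
    {t₁ t₂ : ℝ} (ht₁ : -1 ≤ t₁) (ht₂ : t₂ ≤ 0) :
    ∫ z in ball (0 : Space d) 1 ×ˢ Ioc t₁ t₂,
      (timeWeight p G z.1 * (p * W z ^ (p - 1) * td W z) * φ z
        + bil (diffMatrix G A z.1) (sg W z) (sg φ z)) = 0 := by
  obtain ⟨KW, hKW⟩ := h.lip
  rw [← h.coeff.weak_up_to_boundary (h.lipschitzWith_rpow hKW) h.abs_rpow_le hKW
    (fun φ => h.weak_smooth) hφ hρ h0 ht₁ ht₂]
  refine integral_congr_ae (ae_restrict_of_ae ?_)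
  filter_upwards [hKW.ae_differentiableAt (μ := volume)] with z hz
  rw [td_comp hz (h.hasDerivAt_rpow z)]

end WeakData

/-- The ellipticity constant of the rescaled equations. -/
def solConst (p Λ m M : ℝ) : ℝ :=
  1 + Λ ^ (p + 1) + Λ ^ 3 + p * M ^ (p - 1) + (p * m ^ (p - 1))⁻¹

/-- The rescaled and normalized solution. -/
def rescaled (W : Space d × ℝ → ℝ) (x₀ : Space d) (t₀ r σ a s : ℝ) (z : Space d × ℝ) : ℝ :=
  max 0 (min 1 ((W (x₀ + r • z.1, t₀ + σ * z.2) - a) / s))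

namespace WeakData

variable {p Λ m M : ℝ} {G : Space d → ℝ} {A : Space d → Matrix (Fin (d + 1)) (Fin (d + 1)) ℝ}
  {W : Space d × ℝ → ℝ}

lemma one_le_solConst (h : WeakData p Λ m M G A W) : 1 ≤ solConst p Λ m M := by
  have := h.Λ_pos
  have := h.m_pos
  have := h.one_le_p
  have := h.m_le
  have h1 : 0 ≤ Λ ^ (p + 1) + Λ ^ 3 + p * M ^ (p - 1) + (p * m ^ (p - 1))⁻¹ := by
    have : 0 ≤ M := by linarith
    positivity
  unfold solConst
  linarith

lemma solConst_ge (h : WeakData p Λ m M G A W) : Λ ^ (p + 1) ≤ solConst p Λ m M ∧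
    Λ ^ 3 ≤ solConst p Λ m M ∧ p * M ^ (p - 1) ≤ solConst p Λ m M ∧
    (p * m ^ (p - 1))⁻¹ ≤ solConst p Λ m M := by
  have := h.Λ_pos
  have := h.m_pos
  have := h.one_le_p
  have := h.m_le
  have hM : 0 ≤ M := by linarith
  have h1 : 0 ≤ Λ ^ (p + 1) := by positivity
  have h2 : 0 ≤ Λ ^ 3 := by positivity
  have h3 : 0 ≤ p * M ^ (p - 1) := by positivity
  have h4 : 0 ≤ (p * m ^ (p - 1))⁻¹ := by positivity
  unfold solConst
  refine ⟨?_, ?_, ?_, ?_⟩ <;> linarith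

lemma lipschitzWith_affine {r σ : ℝ} (x₀ : Space d) (t₀ : ℝ) :
    ∃ K, LipschitzWith K fun z : Space d × ℝ => (x₀ + r • z.1, t₀ + σ * z.2) := by
  have h1 : LipschitzWith _ fun z : Space d × ℝ => x₀ + r • z.1 :=
    (LipschitzWith.const x₀).add ((lipschitzWith_smul r).comp LipschitzWith.prod_fst)
  have h2 : LipschitzWith _ fun z : Space d × ℝ => t₀ + σ • z.2 :=
    (LipschitzWith.const t₀).add ((lipschitzWith_smul σ).comp LipschitzWith.prod_snd)
  exact ⟨_, h1.prodMk h2⟩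

lemma affine_mem_ball {x₀ x : Space d} {r : ℝ} (hx₀ : ‖x₀‖ ≤ 1 / 2) (hr : 0 < r) (hr2 : r ≤ 1 / 2)
    (hx : x ∈ ball (0 : Space d) 1) : x₀ + r • x ∈ ball (0 : Space d) 1 := by
  rw [mem_ball_zero_iff] at hx ⊢
  refine (norm_add_le _ _).trans_lt ?_
  rw [norm_smul, Real.norm_of_nonneg hr.le]
  nlinarith

lemma affine_last {x₀ : Space d} (hx₀ : x₀ (Fin.last d) = 0) (r : ℝ) (x : Space d) :
    (x₀ + r • x) (Fin.last d) = r * x (Fin.last d) := by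
  simp [hx₀]

lemma affine_mem_halfBall {x₀ x : Space d} {r : ℝ} (hx₀ : ‖x₀‖ ≤ 1 / 2)
    (hx₀' : x₀ (Fin.last d) = 0) (hr : 0 < r) (hr2 : r ≤ 1 / 2)
    (hx : x ∈ halfBall (0 : Space d) 1) : x₀ + r • x ∈ halfBall (0 : Space d) 1 := by
  refine ⟨affine_mem_ball hx₀ hr hr2 hx.1, ?_⟩
  change 0 < (x₀ + r • x) (Fin.last d)
  rw [affine_last hx₀']
  exact mul_pos hr hx.2

lemma affine_notMem_halfBall {x₀ x : Space d} {r : ℝ}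
    (hx₀' : x₀ (Fin.last d) = 0) (hr : 0 < r) (hx : x (Fin.last d) ≤ 0) :
    x₀ + r • x ∉ halfBall (0 : Space d) 1 := by
  intro hmem
  have h1 : 0 < (x₀ + r • x) (Fin.last d) := hmem.2
  rw [affine_last hx₀'] at h1
  nlinarith

/-- The rescaled functions solve the normalized equation. -/
lemma sol_rescaled (h : WeakData p Λ m M G A W) {x₀ : Space d} {t₀ r a s : ℝ}
    (hx₀ : ‖x₀‖ ≤ 1 / 2) (hx₀' : x₀ (Fin.last d) = 0) (ht₀ : t₀ ∈ Ioo (-1 / 4 : ℝ) 0)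
    (hr : 0 < r) (hr2 : r ≤ 1 / 2) (hs : 0 < s)
    (hosc : ∀ x ∈ halfBall x₀ r, ∀ t ∈ Ioc (t₀ - r ^ (p + 1)) t₀, W (x, t) ∈ Icc a (a + s)) :
    Sol (solConst p Λ m M) ⌈p + 1⌉₊ (fun x => timeWeight p G (x₀ + r • x) / r ^ (p + 1))
      (fun x => (r ^ 2)⁻¹ • diffMatrix G A (x₀ + r • x))
      (fun v => p * (max m (min M (a + s * v))) ^ (p - 1))
      (rescaled W x₀ t₀ r (r ^ (p + 1)) a s) := by
  have hL := h.one_le_solConst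
  obtain ⟨hL1, hL2, hL3, hL4⟩ := h.solConst_ge
  set L := solConst p Λ m M with hLdef
  have hL0 : 0 < L := by linarith
  have hΛ := h.Λ_pos
  have hp := h.one_le_p
  have hm := h.m_pos
  have hM : 0 < M := hm.trans_le h.m_le
  have hco := h.coeff
  -- The time scale is forced by the weights: with this choice the two sides carry `(G / r) ^ (p +
  -- 1)` and `(G / r) ^ 2`, with `G / r` comparable to the new last coordinate uniformly in `r`.
  set σ := r ^ (p + 1) with hσ
  have hσ0 : 0 < σ := by positivity
  -- Together with `t₀ > -1/4` this keeps the rescaled time interval inside `(-1, 0]`.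
  have hσ4 : σ ≤ 1 / 4 := by
    calc σ ≤ r ^ (2 : ℝ) := Real.rpow_le_rpow_of_exponent_ge hr (by linarith) (by linarith)
      _ = r ^ 2 := Real.rpow_two r
      _ ≤ (1 / 2) ^ 2 := by gcongr
      _ = 1 / 4 := by norm_num
  obtain ⟨KW, hKW⟩ := h.lip
  obtain ⟨Ka, hKa⟩ := lipschitzWith_affine (r := r) (σ := σ) x₀ t₀
  set Φ : Space d × ℝ → Space d × ℝ := fun z => (x₀ + r • z.1, t₀ + σ * z.2) with hΦ
  have hqm := quasiMeasurePreserving_affine hr.ne' x₀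
  have hlast : ∀ x : Space d, (x₀ + r • x) (Fin.last d) = r * x (Fin.last d) := affine_last hx₀' r
  have hmemH : ∀ x ∈ ball (0 : Space d) 1, 0 < x (Fin.last d) →
      x₀ + r • x ∈ halfBall (0 : Space d) 1 := fun x hx hx' =>
    affine_mem_halfBall hx₀ hx₀' hr hr2 ⟨hx, hx'⟩
  have hxp0 : ∀ x : Space d, x (Fin.last d) ≤ 0 → xp x = 0 := fun x hx => max_eq_right hx
  have hq2 : (2 : ℝ) ≤ p + 1 := by linarith
  have hqc : p + 1 ≤ (⌈p + 1⌉₊ : ℝ) := Nat.le_ceil _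
  have hq0 : ⌈p + 1⌉₊ ≠ 0 := by
    rw [Ne, Nat.ceil_eq_zero]; linarith
  have hcl : ∀ v : ℝ, max m (min M v) ∈ Icc m M := fun v =>
    ⟨le_max_left _ _, max_le h.m_le (min_le_left _ _)⟩
  refine
    { one_le := hL
      g_meas := ((hco.γ_meas.comp_quasiMeasurePreserving hqm).div_const _)
      g_lower := fun x hx => ?_
      g_upper := fun x hx => ?_
      b_meas := fun i j => ?_
      b_lower := fun x hx ξ => ?_
      b_upper := fun x hx ξ η => ?_
      c_cont := ?_
      c_lower := fun v => ?_
      c_upper := fun v => ?_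
      lip := ?_
      nonneg := fun z => le_max_left _ _
      le_one := fun z => max_le zero_le_one (min_le_left _ _)
      eqn := ?_ }
  · rcases le_or_gt (x (Fin.last d)) 0 with hx0 | hx0
    · rw [hxp0 x hx0, zero_pow hq0, mul_zero, hco.γ_zero _ (affine_notMem_halfBall hx₀' hr hx0),
        zero_div]
    · have hy := hmemH x hx hx0
      rw [timeWeight, indicator_of_mem hy, ← Real.div_rpow (h.G_nonneg hy) hr.le]
      have hG : Λ⁻¹ * xp x ≤ G (x₀ + r • x) / r := by
        rw [le_div_iff₀ hr, xp_eq hx0]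
        refine le_trans (le_of_eq ?_) (h.G_bd _ hy).1
        rw [hlast]
        ring
      have hxpp : 0 < xp x := by rw [xp_eq hx0]; exact hx0
      -- In the unit ball `xp ≤ 1`, so rounding the exponent up to an integer only lowers the
      -- weight.
      calc L⁻¹ * xp x ^ ⌈p + 1⌉₊ ≤ (Λ ^ (p + 1))⁻¹ * xp x ^ (p + 1) := by
            have h1 : xp x ^ ⌈p + 1⌉₊ ≤ xp x ^ (p + 1) := by
              rw [← Real.rpow_natCast]
              exact Real.rpow_le_rpow_of_exponent_ge hxpp (xp_le_one hx) hqc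
            have h2 : L⁻¹ ≤ (Λ ^ (p + 1))⁻¹ := inv_anti₀ (by positivity) hL1
            gcongr
        _ = (Λ⁻¹ * xp x) ^ (p + 1) := by
            rw [Real.mul_rpow (by positivity) hxpp.le, Real.inv_rpow hΛ.le]
        _ ≤ _ := Real.rpow_le_rpow (by positivity) hG (by linarith)
  · rcases le_or_gt (x (Fin.last d)) 0 with hx0 | hx0
    · rw [hxp0 x hx0, hco.γ_zero _ (affine_notMem_halfBall hx₀' hr hx0), zero_div]
      simp
    · have hy := hmemH x hx hx0
      have hxpp : 0 < xp x := by rw [xp_eq hx0]; exact hx0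
      rw [timeWeight, indicator_of_mem hy, ← Real.div_rpow (h.G_nonneg hy) hr.le]
      have hG : G (x₀ + r • x) / r ≤ Λ * xp x := by
        rw [div_le_iff₀ hr, xp_eq hx0]
        refine (h.G_bd _ hy).2.trans (le_of_eq ?_)
        rw [hlast]
        ring
      calc _ ≤ (Λ * xp x) ^ (p + 1) :=
            Real.rpow_le_rpow (div_nonneg (h.G_nonneg hy) hr.le) hG (by linarith)
        _ = Λ ^ (p + 1) * xp x ^ (p + 1) := Real.mul_rpow hΛ.le hxpp.le
        _ ≤ L * xp x ^ 2 := by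
            have h1 : xp x ^ (p + 1) ≤ xp x ^ 2 := by
              rw [← Real.rpow_two]
              exact Real.rpow_le_rpow_of_exponent_ge hxpp (xp_le_one hx) hq2
            gcongr
  · exact ((hco.β_meas i j).comp_quasiMeasurePreserving hqm).const_mul _
  · rw [bil_smul_matrix]
    rcases le_or_gt (x (Fin.last d)) 0 with hx0 | hx0
    · rw [hxp0 x hx0, hco.β_zero _ (affine_notMem_halfBall hx₀' hr hx0)]
      simp [bil, matForm]
    · have hy := hmemH x hx hx0
      rw [diffMatrix, indicator_of_mem hy, bil_smul_matrix]
      have hG : Λ⁻¹ * (r * xp x) ≤ G (x₀ + r • x) := by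
        rw [xp_eq hx0, ← hlast]
        exact (h.G_bd _ hy).1
      have hxp := xp_nonneg x
      have hA := h.A_lower _ hy ξ
      calc L⁻¹ * xp x ^ 2 * ‖ξ‖ ^ 2 ≤ (Λ ^ 3)⁻¹ * xp x ^ 2 * ‖ξ‖ ^ 2 := by gcongr
        _ = (r ^ 2)⁻¹ * ((Λ⁻¹ * (r * xp x)) ^ 2 * (Λ⁻¹ * ‖ξ‖ ^ 2)) := by field_simp
        _ ≤ _ := by gcongr
  · rw [bil_smul_matrix, abs_mul, abs_of_nonneg (inv_nonneg.2 (sq_nonneg r))]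
    rcases le_or_gt (x (Fin.last d)) 0 with hx0 | hx0
    · rw [hxp0 x hx0, hco.β_zero _ (affine_notMem_halfBall hx₀' hr hx0)]
      simp [bil, matForm]
    · have hy := hmemH x hx hx0
      rw [diffMatrix, indicator_of_mem hy, bil_smul_matrix, abs_mul, abs_of_nonneg (sq_nonneg _)]
      have hG : G (x₀ + r • x) ≤ Λ * (r * xp x) := by
        rw [xp_eq hx0, ← hlast]
        exact (h.G_bd _ hy).2
      have hA := h.A_upper _ hy ξ η
      have hG0 := h.G_nonneg hy
      calc _ ≤ (r ^ 2)⁻¹ * ((Λ * (r * xp x)) ^ 2 * (Λ * ‖ξ‖ * ‖η‖)) := by gcongr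
        _ = Λ ^ 3 * xp x ^ 2 * ‖ξ‖ * ‖η‖ := by field_simp
        _ ≤ _ := by gcongr
  · refine continuous_const.mul (Continuous.rpow_const (by fun_prop) fun v => Or.inl ?_)
    exact (hm.trans_le (hcl _).1).ne'
  · refine (inv_anti₀ (by positivity) hL4).trans ?_
    rw [inv_inv]
    have := Real.rpow_le_rpow hm.le (hcl (a + s * v)).1 (z := p - 1) (by linarith)
    gcongr
  · refine le_trans ?_ hL3
    have := Real.rpow_le_rpow (hm.le.trans (hcl (a + s * v)).1) (hcl (a + s * v)).2
      (z := p - 1) (by linarith)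
    gcongr
  · have h1 : LipschitzWith _ fun z => W (Φ z) - a := (hKW.comp hKa).sub (LipschitzWith.const a)
    have h2 : LipschitzWith _ fun z => s⁻¹ • (W (Φ z) - a) := (lipschitzWith_smul s⁻¹).comp h1
    have h3 := (h2.const_min 1).const_max 0
    refine ⟨‖s⁻¹‖₊ * (KW * Ka + 0), ?_⟩
    convert h3 using 2
    rename_i z
    rw [rescaled, smul_eq_mul, inv_mul_eq_div]
  · rintro φ ⟨Kφ, hKφ⟩ ρ hρ h0 t₁ t₂ ht₁ h12 ht₂
    set ρ' := max ρ 0 with hρ'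
    have hρ'0 : 0 ≤ ρ' := le_max_right _ _
    have hρ'1 : ρ' < 1 := max_lt hρ one_pos
    -- the test function in the original variables
    set ψ : Space d × ℝ → ℝ := fun y => φ (-(r⁻¹ • x₀) + r⁻¹ • y.1, -(σ⁻¹ * t₀) + σ⁻¹ * y.2) with hψ
    have hψφ : ∀ z, ψ (Φ z) = φ z := fun z => by
      simp only [hψ, hΦ]
      congr 1
      ext1
      · simp only [smul_add, smul_smul, inv_mul_cancel₀ hr.ne', one_smul, neg_add_cancel_left]
      · simp only [mul_add, inv_mul_cancel_left₀ hσ0.ne', neg_add_cancel_left]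
    have hψsg : ∀ z, sg φ z = r • sg ψ (Φ z) := fun z => by
      rw [← sg_affine hr.ne' hσ0.ne' x₀ t₀ ψ z]
      congr 1
      ext y
      exact (hψφ y).symm
    have hψL : ∃ K, LipschitzWith K ψ := by
      obtain ⟨K', hK'⟩ := lipschitzWith_affine (r := r⁻¹) (σ := σ⁻¹) (-(r⁻¹ • x₀)) (-(σ⁻¹ * t₀))
      exact ⟨_, hKφ.comp hK'⟩
    have hψ0 : ∀ x t, ρ' * r ≤ ‖x - x₀‖ → ψ (x, t) = 0 := fun x t hx => by
      refine h0 _ _ ((le_max_left ρ 0).trans ?_)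
      rw [neg_add_eq_sub, ← smul_sub, norm_smul, norm_inv, Real.norm_of_nonneg hr.le,
        le_inv_mul_iff₀ hr, mul_comm]
      exact hx
    -- For such `x` one has `‖x - x₀‖ ≥ ‖x‖ - 1/2 ≥ ρ' / 2 ≥ ρ' r`. So `ψ` vanishes near the unit
    -- sphere and is admissible in the equation for `W`.
    have hψ1 : ∀ x t, (1 + ρ') / 2 ≤ ‖x‖ → ψ (x, t) = 0 := fun x t hx => by
      refine hψ0 x t ?_
      have := norm_sub_norm_le x x₀
      nlinarith
    obtain ⟨Kψ, hKψ⟩ := hψL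
    have heq := h.weak_eqn hKψ (by linarith : (1 + ρ') / 2 < 1) hψ1
      (t₁ := t₀ + σ * t₁) (t₂ := t₀ + σ * t₂) (by nlinarith [ht₀.1]) (by nlinarith [ht₀.2])
    have hballsub : ball x₀ r ⊆ ball (0 : Space d) 1 := fun x hx => by
      rw [mem_ball, dist_eq_norm] at hx
      rw [mem_ball_zero_iff]
      have := norm_sub_norm_le x x₀
      linarith
    -- Outside the ball of radius `r` the point lies in the interior of the zero set of `ψ`, so its
    -- gradient vanishes too and the integral localizes.
    rw [setIntegral_eq_of_subset_of_forall_sdiff_eq_zero (s := ball x₀ r ×ˢ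
      Ioc (t₀ + σ * t₁) (t₀ + σ * t₂)) (measurableSet_cyl _ _) (prod_mono hballsub subset_rfl)
      (fun y hy => by
        have hy1 : r ≤ ‖y.1 - x₀‖ := by
          rw [← dist_eq_norm]
          exact not_lt.1 fun e => hy.2 ⟨e, hy.1.2⟩
        have hlt : ρ' * r < ‖y.1 - x₀‖ := by nlinarith
        have hev : ψ =ᶠ[𝓝 y] fun _ => 0 := by
          have hc : ContinuousAt (fun y : Space d × ℝ => ‖y.1 - x₀‖) y := by fun_prop
          filter_upwards [hc.eventually (lt_mem_nhds hlt)] with y' hy'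
          exact hψ0 y'.1 y'.2 hy'.le
        have hsg0 : sg (fun _ : Space d × ℝ => (0 : ℝ)) y = 0 := by
          ext i
          simp [sg]
        rw [sg_congr hev, hsg0, hev.self_of_nhds]
        simp [bil, matForm])] at heq
    have haff := setIntegral_affine_eq_zero hr hσ0 x₀ t₀ t₁ t₂ _ heq
    -- comparison of the integrands
    have hae : (ball (0 : Space d) 1 ×ˢ Ioo t₁ t₂ : Set (Space d × ℝ))
        =ᵐ[volume] (ball (0 : Space d) 1 ×ˢ Ioc t₁ t₂ : Set (Space d × ℝ)) := by
      rw [Measure.volume_eq_prod]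
      exact Measure.set_prod_ae_eq (ae_eq_refl _) Ioo_ae_eq_Ioc
    -- Times before `t₂ ≤ 0` have a neighbourhood on which the oscillation bound holds, hence on
    -- which the truncation in `rescaled` is inactive. At time 0 itself this could fail, so the
    -- endpoint, a null set, is discarded.
    rw [← setIntegral_congr_set hae] at haff ⊢
    -- The factor `s` undoes the normalization: the time derivative contributes `σ / s` and the two
    -- gradients `r ^ 2 / s`, which cancel the factors `1 / σ` and `1 / r ^ 2` in the coefficients.
    have hmul : ∫ z in ball (0 : Space d) 1 ×ˢ Ioo t₁ t₂, s *
        (timeWeight p G (x₀ + r • z.1) / σ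
          * (p * (max m (min M (a + s * rescaled W x₀ t₀ r σ a s z))) ^ (p - 1))
          * td (rescaled W x₀ t₀ r σ a s) z * φ z
        + bil ((r ^ 2)⁻¹ • diffMatrix G A (x₀ + r • z.1)) (sg (rescaled W x₀ t₀ r σ a s) z)
          (sg φ z)) = 0 := by
      rw [← haff]
      refine setIntegral_congr_fun (measurableSet_ball.prod measurableSet_Ioo) fun z hz => ?_
      change _ = timeWeight p G (x₀ + r • z.1) * (p * W (Φ z) ^ (p - 1) * td W (Φ z)) * ψ (Φ z)
        + bil (diffMatrix G A (x₀ + r • z.1)) (sg W (Φ z)) (sg ψ (Φ z))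
      rcases le_or_gt (z.1 (Fin.last d)) 0 with hx0 | hx0
      · have hn := affine_notMem_halfBall hx₀' hr hx0
        simp [hco.γ_zero _ hn, hco.β_zero _ hn, bil, matForm]
      · have hnbhd : halfBall (0 : Space d) 1 ×ˢ Ioo (-1 : ℝ) 0 ∈ 𝓝 z :=
          isOpen_halfCyl.mem_nhds ⟨⟨hz.1, hx0⟩, by linarith [hz.2.1], by linarith [hz.2.2]⟩
        have hval : ∀ y ∈ halfBall (0 : Space d) 1 ×ˢ Ioo (-1 : ℝ) 0,
            rescaled W x₀ t₀ r σ a s y = s⁻¹ * (W (Φ y) - a) := fun y hy => by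
          have hyb : W (Φ y) ∈ Icc a (a + s) := by
            refine hosc _ ⟨?_, ?_⟩ _ ⟨?_, ?_⟩
            · rw [mem_ball, dist_eq_norm, add_sub_cancel_left, norm_smul,
                Real.norm_of_nonneg hr.le]
              exact mul_lt_of_lt_one_right hr (mem_ball_zero_iff.1 hy.1.1)
            · change 0 < (x₀ + r • y.1) (Fin.last d)
              rw [hlast]
              exact mul_pos hr hy.1.2
            · have := mul_lt_mul_of_pos_left hy.2.1 hσ0
              linarith
            · have := mul_lt_mul_of_pos_left hy.2.2 hσ0
              linarith
          have h1 : (W (Φ y) - a) / s ≤ 1 := by rw [div_le_one hs]; linarith [hyb.2]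
          have h2 : 0 ≤ (W (Φ y) - a) / s := div_nonneg (by linarith [hyb.1]) hs.le
          change max 0 (min 1 ((W (Φ y) - a) / s)) = _
          rw [min_eq_right h1, max_eq_right h2, div_eq_inv_mul]
        have hev : rescaled W x₀ t₀ r σ a s
            =ᶠ[𝓝 z] fun y => (fun v => s⁻¹ * (v - a)) (W (Φ y)) := by
          filter_upwards [hnbhd] with y hy
          exact hval y hy
        have hfd : fderiv ℝ (rescaled W x₀ t₀ r σ a s) z = s⁻¹ • fderiv ℝ (fun y => W (Φ y)) z := by
          have hsm := congrFun (fderiv_const_smul_field (𝕜 := ℝ) (f := fun y => W (Φ y) - a) s⁻¹) z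
          rw [Pi.smul_apply, fderiv_sub_const] at hsm
          rw [hev.fderiv_eq, ← hsm]
          rfl
        have e1 : td (rescaled W x₀ t₀ r σ a s) z = s⁻¹ * (σ * td W (Φ z)) := by
          rw [← td_affine hr.ne' hσ0.ne' x₀ t₀ W z, td, hfd]
          rfl
        have e2 : sg (rescaled W x₀ t₀ r σ a s) z = s⁻¹ • (r • sg W (Φ z)) := by
          rw [← sg_affine hr.ne' hσ0.ne' x₀ t₀ W z]
          ext i
          change fderiv ℝ (rescaled W x₀ t₀ r σ a s) z _ = _
          rw [hfd]
          rfl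
        have e3 : max m (min M (a + s * rescaled W x₀ t₀ r σ a s z)) = W (Φ z) := by
          rw [hval z (mem_of_mem_nhds hnbhd), mul_inv_cancel_left₀ hs.ne', add_sub_cancel,
            min_eq_right (h.mem _).2, max_eq_right (h.mem _).1]
        simp only [e1, e2, e3, hψφ, hψsg z]
        rw [bil_smul_matrix, bil_smul_left, bil_smul_left, bil_smul_right]
        field_simp
    rw [integral_const_mul] at hmul
    exact (mul_eq_zero.1 hmul).resolve_left hs.ne'

end WeakData

/-! ### Extension of the solution, oscillation decay and Hölder continuity -/

lemma mem_closure_halfBall_self {x₀ : Space d} (hx₀ : x₀ (Fin.last d) = 0) {r : ℝ} (hr : 0 < r) :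
    x₀ ∈ closure (halfBall x₀ r) := by
  refine Metric.mem_closure_iff.2 fun ε hε => ?_
  have hδ : 0 < min ε r / 2 := by have := lt_min hε hr; linarith
  have hnorm : ‖(EuclideanSpace.single (Fin.last d) (min ε r / 2) : Space d)‖ = min ε r / 2 := by
    rw [PiLp.norm_single, Real.norm_of_nonneg hδ.le]
  have h1 := min_le_left ε r
  have h2 := min_le_right ε r
  refine ⟨x₀ + EuclideanSpace.single (Fin.last d) (min ε r / 2), ⟨?_, ?_⟩, ?_⟩
  · rw [mem_ball, dist_eq_norm, add_sub_cancel_left, hnorm]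
    linarith
  · change 0 < (x₀ + EuclideanSpace.single (Fin.last d) (min ε r / 2)) (Fin.last d)
    simpa [hx₀] using lt_min hε hr
  · rw [dist_eq_norm, sub_add_cancel_left, norm_neg, hnorm]
    linarith

lemma flatBoundary_props {x : Space d} {R : ℝ} (hR1 : R ≤ 1)
    (hx : x ∈ flatBoundary (0 : Space d) R) :
    ‖x‖ ≤ R ∧ x (Fin.last d) = 0 ∧ x ∈ closure (halfBall (0 : Space d) 1) := by
  have hcl : x ∈ closure (halfBall (0 : Space d) R) := frontier_subset_closure hx.1
  have hsub : halfBall (0 : Space d) R ⊆ halfBall 0 1 :=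
    inter_subset_inter_left _ (ball_subset_ball hR1)
  refine ⟨?_, hx.2, closure_mono hsub hcl⟩
  have := closure_ball_subset_closedBall (closure_mono inter_subset_left hcl)
  exact mem_closedBall_zero_iff.1 this

/-- A Lipschitz function on the half cylinder extends with the same bounds. -/
lemma exists_extension {w : Space d × ℝ → ℝ} {K : NNReal} {m M : ℝ} (hmM : m ≤ M)
    (hw : LipschitzOnWith K w (closure (halfBall 0 1) ×ˢ Ioc (-1 : ℝ) 0))
    (hb : ∀ x ∈ halfBall (0 : Space d) 1, ∀ t ∈ Ioc (-1 : ℝ) 0, m ≤ w (x, t) ∧ w (x, t) ≤ M) :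
    ∃ W : Space d × ℝ → ℝ, (∃ K, LipschitzWith K W) ∧ (∀ z, W z ∈ Icc m M) ∧
      EqOn w W (closure (halfBall 0 1) ×ˢ Ioc (-1 : ℝ) 0) := by
  obtain ⟨f, hf, hfw⟩ := hw.extend_real
  refine ⟨fun z => max m (min M (f z)), ⟨K, (hf.const_min M).const_max m⟩,
    fun z => ⟨le_max_left _ _, max_le hmM (min_le_left _ _)⟩, ?_⟩
  rintro ⟨x, t⟩ ⟨hx, ht⟩
  -- The bounds on `w` are known only over the open half ball; continuity of the extension carries
  -- them to its closure, so the clamp to `[m, M]` does not alter `w`.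
  have hcl : IsClosed {y : Space d | f (y, t) ∈ Icc m M} :=
    isClosed_Icc.preimage (hf.continuous.comp (by fun_prop))
  have hsub : halfBall (0 : Space d) 1 ⊆ {y : Space d | f (y, t) ∈ Icc m M} := fun y hy => by
    have e : w (y, t) = f (y, t) := hfw (mk_mem_prod (subset_closure hy) ht)
    have := hb y hy t ht
    rw [e] at this
    exact this
  have hmem : f (x, t) ∈ Icc m M := closure_minimal hsub hcl hx
  have e : w (x, t) = f (x, t) := hfw (mk_mem_prod hx ht)
  dsimp only
  rw [e, min_eq_right hmem.2, max_eq_right hmem.1]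

namespace WeakData

variable {p Λ m M : ℝ} {G : Space d → ℝ} {A : Space d → Matrix (Fin (d + 1)) (Fin (d + 1)) ℝ}
  {W : Space d × ℝ → ℝ}

/-- Oscillation decay on a sequence of intrinsic half cylinders. -/
lemma exists_oscillation (h : WeakData p Λ m M G A W) {ε : ℝ} (hε1 : ε ≤ 1 / 2)
    (hdecay : ∀ (g : Space d → ℝ) (b : Space d → Matrix (Fin (d + 1)) (Fin (d + 1)) ℝ) (c : ℝ → ℝ)
      (u : Space d × ℝ → ℝ), Sol (solConst p Λ m M) ⌈p + 1⌉₊ g b c u →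
      (∀ x ∈ halfBall (0 : Space d) (1 / 4), ∀ t ∈ Ioc (-1 / 4 : ℝ) 0, ε ≤ u (x, t)) ∨
      (∀ x ∈ halfBall (0 : Space d) (1 / 4), ∀ t ∈ Ioc (-1 / 4 : ℝ) 0, u (x, t) ≤ 1 - ε))
    {x₀ : Space d} {t₀ : ℝ} (hx₀ : ‖x₀‖ ≤ 1 / 2) (hx₀' : x₀ (Fin.last d) = 0)
    (ht₀ : t₀ ∈ Ioo (-1 / 4 : ℝ) 0) (j : ℕ) :
    ∃ a : ℝ, ∀ x ∈ halfBall x₀ (1 / 2 * (1 / 4) ^ j),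
      ∀ t ∈ Ioc (t₀ - (1 / 2 * (1 / 4 : ℝ) ^ j) ^ (p + 1)) t₀,
      W (x, t) ∈ Icc a (a + (M - m + 1) * (1 - ε) ^ j) := by
  have hp := h.one_le_p
  induction j with
  -- The initial oscillation is taken as `M - m + 1` so that the normalizing factor `s` is positive
  -- even when `m = M`.
  | zero => exact ⟨m, fun x _ t _ => ⟨(h.mem _).1, by have := (h.mem (x, t)).2; simp; linarith⟩⟩
  | succ j ih =>
    obtain ⟨a, ha⟩ := ih
    set r : ℝ := 1 / 2 * (1 / 4) ^ j with hr
    have hr0 : 0 < r := by positivity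
    have hr2 : r ≤ 1 / 2 := by
      have : ((1 : ℝ) / 4) ^ j ≤ 1 := pow_le_one₀ (by norm_num) (by norm_num)
      rw [hr]; linarith
    have hrs : 1 / 2 * (1 / 4 : ℝ) ^ (j + 1) = r * (1 / 4) := by rw [hr]; ring
    set s : ℝ := (M - m + 1) * (1 - ε) ^ j with hs
    have hs0 : 0 < s := mul_pos (by linarith [h.m_le]) (pow_pos (by linarith) _)
    have hss : (M - m + 1) * (1 - ε) ^ (j + 1) = (1 - ε) * s := by rw [hs]; ring
    rw [hrs, hss, Real.mul_rpow hr0.le (by norm_num)]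
    set σ := r ^ (p + 1) with hσ
    have hσ0 : 0 < σ := by positivity
    -- Hence the intrinsic cylinder of radius `r / 4`, once rescaled, fits into the time interval
    -- `(-1/4, 0]` of the decay estimate.
    have h4 : ((1 : ℝ) / 4) ^ (p + 1) ≤ 1 / 4 := by
      calc ((1 : ℝ) / 4) ^ (p + 1) ≤ (1 / 4) ^ (1 : ℝ) :=
            Real.rpow_le_rpow_of_exponent_ge (by norm_num) (by norm_num) (by linarith)
        _ = 1 / 4 := Real.rpow_one _
    have hsol := h.sol_rescaled hx₀ hx₀' ht₀ hr0 hr2 hs0 ha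
    have key : ∀ x ∈ halfBall x₀ (r * (1 / 4)), ∀ t ∈ Ioc (t₀ - σ * (1 / 4) ^ (p + 1)) t₀,
        ∃ y ∈ halfBall (0 : Space d) (1 / 4), ∃ τ ∈ Ioc (-1 / 4 : ℝ) 0,
          W (x, t) ∈ Icc a (a + s) ∧ rescaled W x₀ t₀ r σ a s (y, τ) = (W (x, t) - a) / s := by
      intro x hx t ht
      have hW : W (x, t) ∈ Icc a (a + s) := by
        refine ha x ⟨ball_subset_ball (by linarith) hx.1, hx.2⟩ t ⟨?_, ht.2⟩
        have := ht.1
        nlinarith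
      refine ⟨r⁻¹ • (x - x₀), ⟨?_, ?_⟩, σ⁻¹ * (t - t₀), ⟨?_, ?_⟩, hW, ?_⟩
      · rw [mem_ball_zero_iff, norm_smul, norm_inv, Real.norm_of_nonneg hr0.le,
          inv_mul_lt_iff₀ hr0, ← dist_eq_norm]
        exact hx.1
      · change 0 < (r⁻¹ • (x - x₀)) (Fin.last d)
        have hxl : 0 < x (Fin.last d) := hx.2
        rw [PiLp.smul_apply, PiLp.sub_apply, hx₀', sub_zero, smul_eq_mul]
        positivity
      · rw [lt_inv_mul_iff₀ hσ0]
        have := ht.1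
        nlinarith
      · rw [inv_mul_le_iff₀ hσ0]
        have := ht.2
        linarith
      · rw [rescaled]
        dsimp only
        rw [smul_smul, mul_inv_cancel₀ hr0.ne', one_smul, add_sub_cancel,
          mul_inv_cancel_left₀ hσ0.ne', add_sub_cancel]
        have h1 : (W (x, t) - a) / s ≤ 1 := by rw [div_le_one hs0]; linarith [hW.2]
        have h2 : 0 ≤ (W (x, t) - a) / s := div_nonneg (by linarith [hW.1]) hs0.le
        rw [min_eq_right h1, max_eq_right h2]
    rcases hdecay _ _ _ _ hsol with hlow | hup
    · refine ⟨a + ε * s, fun x hx t ht => ?_⟩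
      obtain ⟨y, hy, τ, hτ, hW, he⟩ := key x hx t ht
      have h1 := hlow y hy τ hτ
      rw [he, le_div_iff₀ hs0] at h1
      exact ⟨by linarith, by linarith [hW.2]⟩
    · refine ⟨a, fun x hx t ht => ?_⟩
      obtain ⟨y, hy, τ, hτ, hW, he⟩ := key x hx t ht
      have h1 := hup y hy τ hτ
      rw [he, div_le_iff₀ hs0] at h1
      exact ⟨hW.1, by linarith⟩

/-- Hölder continuity at a boundary point. -/
lemma holder (h : WeakData p Λ m M G A W) {ε α : ℝ} (hε1 : ε ≤ 1 / 2) (hα : 0 < α)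
    (hαε : (1 / 4 : ℝ) ^ α = 1 - ε)
    (hdecay : ∀ (g : Space d → ℝ) (b : Space d → Matrix (Fin (d + 1)) (Fin (d + 1)) ℝ) (c : ℝ → ℝ)
      (u : Space d × ℝ → ℝ), Sol (solConst p Λ m M) ⌈p + 1⌉₊ g b c u →
      (∀ x ∈ halfBall (0 : Space d) (1 / 4), ∀ t ∈ Ioc (-1 / 4 : ℝ) 0, ε ≤ u (x, t)) ∨
      (∀ x ∈ halfBall (0 : Space d) (1 / 4), ∀ t ∈ Ioc (-1 / 4 : ℝ) 0, u (x, t) ≤ 1 - ε))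
    {x₀ : Space d} {t₀ : ℝ} (hx₀ : ‖x₀‖ ≤ 1 / 2) (hx₀' : x₀ (Fin.last d) = 0)
    (ht₀ : t₀ ∈ Ioo (-1 / 4 : ℝ) 0) {x : Space d} (hx : 0 < x (Fin.last d)) {t : ℝ} (ht : t ≤ t₀) :
    |W (x, t) - W (x₀, t₀)|
      ≤ (M - m + 1) * 3 ^ α / (1 - ε) * (‖x - x₀‖ + |t - t₀| ^ (1 / (p + 1))) ^ α := by
  have hp := h.one_le_p
  obtain ⟨K, hK⟩ := h.lip
  set ϱ := ‖x - x₀‖ + |t - t₀| ^ (1 / (p + 1)) with hϱ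
  have hτ0 : 0 ≤ |t - t₀| ^ (1 / (p + 1)) := Real.rpow_nonneg (abs_nonneg _) _
  have hne : x - x₀ ≠ 0 := fun e => by
    rw [sub_eq_zero.1 e, hx₀'] at hx
    exact lt_irrefl _ hx
  have hn0 : 0 < ‖x - x₀‖ := norm_pos_iff.2 hne
  have hϱ0 : 0 < ϱ := by linarith
  have hγ0 : 0 < 1 - ε := by linarith
  have hS0 : 0 < M - m + 1 := by linarith [h.m_le]
  have hγ1 : 1 - ε ≤ 1 := by
    rw [← hαε]
    exact Real.rpow_le_one (by norm_num) (by norm_num) hα.le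
  have hrew : (M - m + 1) * 3 ^ α / (1 - ε) * ϱ ^ α = (M - m + 1) * ((3 * ϱ) ^ α / (1 - ε)) := by
    rw [Real.mul_rpow (by norm_num) hϱ0.le]
    ring
  rw [hrew]
  rcases le_or_gt (3 * ϱ) 1 with hle | hgt
  -- `(1/4) ^ (n + 1) < 3 ϱ ≤ (1/4) ^ n`. The factor 3 puts `ϱ` strictly below the radius `(1/4) ^ n
  -- / 2` of the cylinder.
  · obtain ⟨n, hn1, hn2⟩ := exists_nat_pow_near_of_lt_one (mul_pos three_pos hϱ0) hle
      (by norm_num : (0 : ℝ) < 1 / 4) (by norm_num)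
    obtain ⟨a, ha⟩ := h.exists_oscillation hε1 hdecay hx₀ hx₀' ht₀ n
    set r : ℝ := 1 / 2 * (1 / 4) ^ n with hr
    have hr0 : 0 < r := by positivity
    have hϱr : ϱ < r := by rw [hr]; linarith
    have hxt : W (x, t) ∈ Icc a (a + (M - m + 1) * (1 - ε) ^ n) := by
      refine ha x ⟨?_, hx⟩ t ⟨?_, ht⟩
      · rw [mem_ball, dist_eq_norm]
        linarith
      · have h1 : |t - t₀| ^ (1 / (p + 1)) < r := by linarith
        have h2 := Real.rpow_lt_rpow hτ0 h1 (by linarith : 0 < p + 1)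
        rw [← Real.rpow_mul (abs_nonneg _), one_div_mul_cancel (by linarith), Real.rpow_one,
          abs_lt] at h2
        linarith [h2.1]
    have hx₀t : W (x₀, t₀) ∈ Icc a (a + (M - m + 1) * (1 - ε) ^ n) := by
      have hcl : IsClosed {y : Space d | W (y, t₀) ∈ Icc a (a + (M - m + 1) * (1 - ε) ^ n)} :=
        isClosed_Icc.preimage (hK.continuous.comp (by fun_prop))
      -- The centre lies on the flat boundary, outside the half ball, so the bound reaches it by
      -- continuity.
      refine closure_minimal (fun y hy => ?_) hcl (mem_closure_halfBall_self hx₀' hr0)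
      exact ha y hy t₀ ⟨by linarith [Real.rpow_pos_of_pos hr0 (p + 1)], le_rfl⟩
    calc |W (x, t) - W (x₀, t₀)| ≤ (M - m + 1) * (1 - ε) ^ n := by
          rw [abs_le]
          constructor <;> linarith [hxt.1, hxt.2, hx₀t.1, hx₀t.2]
      _ ≤ _ := by
          refine mul_le_mul_of_nonneg_left ?_ hS0.le
          -- `(1 - ε) ^ (n + 1) = ((1/4) ^ (n + 1)) ^ α ≤ (3 ϱ) ^ α`; the spare factor `1 - ε` is
          -- the one in the denominator of the constant.
          rw [le_div_iff₀ hγ0, ← pow_succ, ← hαε, ← Real.rpow_natCast, ← Real.rpow_mul (by norm_num),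
            mul_comm, Real.rpow_mul (by norm_num), Real.rpow_natCast]
          exact Real.rpow_le_rpow (by positivity) hn1.le hα.le
  · calc |W (x, t) - W (x₀, t₀)| ≤ (M - m + 1) * 1 := by
          rw [abs_le]
          constructor <;> linarith [(h.mem (x, t)).1, (h.mem (x, t)).2, (h.mem (x₀, t₀)).1,
            (h.mem (x₀, t₀)).2]
      _ ≤ _ := by
          refine mul_le_mul_of_nonneg_left ?_ hS0.le
          rw [le_div_iff₀ hγ0, one_mul]
          exact hγ1.trans (Real.one_le_rpow hgt.le hα.le)

end WeakData

lemma exists_rpow_eq {γ : ℝ} (h0 : 0 < γ) (h1 : γ < 1) : ∃ α : ℝ, 0 < α ∧ (1 / 4 : ℝ) ^ α = γ := by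
  refine ⟨Real.logb (1 / 4) γ, ?_, Real.rpow_logb (by norm_num) (by norm_num) h0⟩
  exact Real.logb_pos_of_base_lt_one (by norm_num) (by norm_num) h0 h1

end FastDiffusion

end

theorem theorem3p10 (d : ℕ) (p Λ m M : ℝ) (hp : 1 ≤ p) (hΛ : 1 ≤ Λ) (hm : 0 < m) (hmM : m ≤ M) :
    ∃ α C : ℝ, 0 < α ∧ 0 < C ∧
      ∀ (G : FastDiffusion.Space d → ℝ)
        (A : FastDiffusion.Space d → Matrix (Fin (d + 1)) (Fin (d + 1)) ℝ)
        (w : FastDiffusion.Space d × ℝ → ℝ),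
        -- `G` is measurable and comparable to `x_n` on `B_1^+`
        AEMeasurable G (volume.restrict (FastDiffusion.halfBall 0 1)) →
        (∀ x ∈ FastDiffusion.halfBall (0 : FastDiffusion.Space d) 1,
          Λ⁻¹ * x (Fin.last d) ≤ G x ∧ G x ≤ Λ * x (Fin.last d)) →
        -- `A` is measurable, bounded and uniformly elliptic on `B_1^+`
        (∀ i j, AEMeasurable (fun x => A x i j)
          (volume.restrict (FastDiffusion.halfBall 0 1))) →
        (∀ x ∈ FastDiffusion.halfBall (0 : FastDiffusion.Space d) 1, ∀ ξ : FastDiffusion.Space d,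
          Λ⁻¹ * ‖ξ‖ ^ 2 ≤ FastDiffusion.matForm (A x) (fun i => ξ i) (fun i => ξ i) ∧
          FastDiffusion.matForm (A x) (fun i => ξ i) (fun i => ξ i) ≤ Λ * ‖ξ‖ ^ 2) →
        (∀ x ∈ FastDiffusion.halfBall (0 : FastDiffusion.Space d) 1,
          ∀ ξ η : FastDiffusion.Space d,
          |FastDiffusion.matForm (A x) (fun i => ξ i) (fun i => η i)| ≤ Λ * ‖ξ‖ * ‖η‖) →
        -- `w` is Lipschitz up to the boundary, between `m` and `M`, and solves the equation
        (∃ K : NNReal, LipschitzOnWith K w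
          (closure (FastDiffusion.halfBall 0 1) ×ˢ Set.Ioc (-1 : ℝ) 0)) →
        (∀ x ∈ FastDiffusion.halfBall (0 : FastDiffusion.Space d) 1, ∀ t ∈ Set.Ioc (-1 : ℝ) 0,
          m ≤ w (x, t) ∧ w (x, t) ≤ M) →
        FastDiffusion.IsDistribSolution p G A w →
        ∀ xbar ∈ FastDiffusion.flatBoundary (0 : FastDiffusion.Space d) (1 / 2),
        ∀ tbar ∈ Set.Ioo (-1 / 4 : ℝ) 0,
        ∀ x ∈ FastDiffusion.halfBall xbar (1 / 2),
        ∀ t ∈ Set.Ioc (-1 / 4 + tbar) tbar,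
          |w (x, t) - w (xbar, tbar)| ≤ C * (‖x - xbar‖ + |t - tbar| ^ (1 / (p + 1))) ^ α := by
  open FastDiffusion in
  have hL : 1 ≤ solConst p Λ m M := by
    have hM : 0 < M := hm.trans_le hmM
    have hp0 : 0 < p := by linarith
    have hΛ0 : 0 < Λ := by linarith
    have : 0 ≤ Λ ^ (p + 1) + Λ ^ 3 + p * M ^ (p - 1) + (p * m ^ (p - 1))⁻¹ := by positivity
    unfold solConst
    linarith
  -- Here `ε`, and with it `α` and the constant, is fixed before `G`, `A` and `w` appear, from `d`,
  -- `p`, `Λ`, `m` and `M` only.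
  obtain ⟨ε, hε0, hε1, hdecay⟩ := FastDiffusion.exists_decay d ⌈p + 1⌉₊ hL
  obtain ⟨α, hα, hαε⟩ := FastDiffusion.exists_rpow_eq (γ := 1 - ε) (by linarith) (by linarith)
  have hγ0 : 0 < 1 - ε := by linarith
  have hS0 : 0 < M - m + 1 := by linarith
  refine ⟨α, (M - m + 1) * 3 ^ α / (1 - ε), hα, by positivity, ?_⟩
  rintro G A w hG hGb hA hAe hAb ⟨K, hwL⟩ hwb hw xbar hxbar tbar htbar x hx t ht
  obtain ⟨W, hWL, hWb, hwW⟩ := FastDiffusion.exists_extension hmM hwL hwb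
  obtain ⟨hx1, hx2, hx3⟩ := FastDiffusion.flatBoundary_props (by norm_num) hxbar
  have hdata : FastDiffusion.WeakData p Λ m M G A W :=
    { one_le_p := hp
      one_le_Λ := hΛ
      m_pos := hm
      m_le := hmM
      G_meas := hG
      G_bd := hGb
      A_meas := hA
      A_lower := fun x hx ξ => (hAe x hx ξ).1
      A_upper := hAb
      lip := hWL
      mem := hWb
      eqn := fun φ hφ hc hsub => by
        have hms : MeasurableSet (FastDiffusion.halfBall (0 : FastDiffusion.Space d) 1
            ×ˢ Set.Ioo (-1 : ℝ) 0) := FastDiffusion.isOpen_halfCyl.measurableSet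
        have heq : ∀ y ∈ FastDiffusion.halfBall (0 : FastDiffusion.Space d) 1,
            ∀ s ∈ Set.Ioo (-1 : ℝ) 0, w (y, s) = W (y, s) := fun y hy s hs =>
          hwW (Set.mk_mem_prod (subset_closure hy) (Set.Ioo_subset_Ioc_self hs))
        have h1 := hw φ hφ hc hsub
        refine Eq.trans ?_ (h1.trans ?_)
        · refine setIntegral_congr_fun hms fun z hz => ?_
          simp only [← heq z.1 hz.1 z.2 hz.2]
        · refine setIntegral_congr_fun hms fun z hz => ?_
          -- The half ball is open, so the extension agrees with `w` near each of its points and has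
          -- the same spatial derivatives.
          have hsp : ∀ j, FastDiffusion.spacePartial w j z = FastDiffusion.spacePartial W j z :=
            fun j => by
              have hev : (fun y : FastDiffusion.Space d => w (y, z.2))
                  =ᶠ[nhds z.1] fun y => W (y, z.2) := by
                filter_upwards [(FastDiffusion.isOpen_halfBall 0 1).mem_nhds hz.1] with y hy
                exact heq y hy z.2 hz.2
              rw [FastDiffusion.spacePartial, FastDiffusion.spacePartial, hev.fderiv_eq]
          simp only [hsp] }
  have hxb : x ∈ FastDiffusion.halfBall (0 : FastDiffusion.Space d) 1 := by
    refine ⟨?_, hx.2⟩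
    have h1 : ‖x - xbar‖ < 1 / 2 := by
      rw [← dist_eq_norm]
      exact hx.1
    rw [mem_ball_zero_iff]
    linarith [norm_sub_norm_le x xbar]
  have ht' : t ∈ Set.Ioc (-1 : ℝ) 0 := ⟨by linarith [ht.1, htbar.1], by linarith [ht.2, htbar.2]⟩
  have htbar' : tbar ∈ Set.Ioc (-1 : ℝ) 0 := ⟨by linarith [htbar.1], htbar.2.le⟩
  have e1 : w (x, t) = W (x, t) := hwW (Set.mk_mem_prod (subset_closure hxb) ht')
  have e2 : w (xbar, tbar) = W (xbar, tbar) := hwW (Set.mk_mem_prod hx3 htbar')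
  rw [e1, e2]
  exact hdata.holder hε1 hα hαε hdecay hx1 hx2 htbar hx.2 ht.2
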